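/- Let $\alpha,\sigma\in(0,1)$, $\varepsilon,L,T>0$, $\theta=\alpha/2$, $f(u)=u^3-u$, $\omega_\mu(t)=t^{\mu-1}/\Gamma(\mu)$. Let $u$ be an $L$-periodic (in both space variables) classical solution, continuous on $\mathbb R^2\times[0,T]$, of $$\partial_t^\alpha u=\varepsilon^2\Delta u-f(u)\quad(0<t\le T),\qquad u(\cdot,0)=u_0,\qquad \partial_t^\alpha v(t)=\int_0^t\omega_{1-\alpha}(t-s)v'(s)\,ds .$$ Let $0=t_0<t_1<\dots<t_N=T$, $\tau_k=t_k-t_{k-1}$, $\tau=\max_{1\le k\le N}\tau_k$, $\rho_k=\tau_k/\tau_{k+1}$, $t_{k-\theta}=(1-\theta)t_k+\theta t_{k-1}$, and similarly $w^{k-\theta}=(1-\theta)w^k+\theta w^{k-1}$ for sequences. The nonuniform Alikhanov formula is $(\partial_\tau^\alpha v)^{n-\theta}=\sum_{k=1}^nA^{(n)}_{n-k}(v^k-v^{k-1})$ with $$A^{(n)}_{n-k}=a^{(n)}_{n-k}+\rho_{k-1}b^{(n)}_{n-k+1}-b^{(n)}_{n-k}$$ (the second term is absent for $k=1$ and the third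 for $k=n$), where $$a_{n-k}^{(n)}=\frac1{\tau_k}\int_{t_{k-1}}^{\min\{t_k,t_{n-\theta}\}}\omega_{1-\alpha}(t_{n-\theta}-s)\,ds,\qquad b_{n-k}^{(n)}=\frac{2}{\tau_k(\tau_k+\tau_{k+1})}\int_{t_{k-1}}^{t_k}(s-t_{k-1/2})\,\omega_{1-\alpha}(t_{n-\theta}-s)\,ds .$$ For a positive integer $M$ let $h=L/M$, let $D_h$ be the central difference (five-point) Laplacian on the periodic $M\times M$ grid of mesh size $h$, and let $\|\cdot\|_\infty$ be the maximum norm of grid functions. Let the grid functions $u^0,\dots,u^N$ solve the scheme $$(\partial_\tau^\alpha u)^{n-\theta}=\varepsilon^2D_hu^{n-\theta}-\bigl(\theta f(u^{n-1})+(1-\theta)f(u^n)\bigr)\quad(1\le n\le N),\qquad u^0=u_0\ \text{on the grid}.$$ **Theorem.** Assume that $\|u_0\|_{L^\infty}\le1$, that $u$ is regular in the sense that, for $0<t\le T$, $$\|u(t)\|_{W^{4,\infty}}\le K,\qquad \|u^{(\ell)}(t)\|_{W^{2,\infty}}\le K(1+t^{\sigma-\ell})\quad(\ell=1,2,3),$$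 ($u$ being three times continuously differentiable in $t\in(0,T]$, with time derivatives that are continuous in space), that **M1** holds, i.e. $\rho_k\le7/4$ for $1\le k\le N-1$, and that $$\tau\le\min\Bigl\{\sqrt[\alpha]{\tfrac{\omega_{2-\alpha}(1)}{11}},\ \sqrt[\alpha]{\tfrac{\theta\,\omega_{2-\alpha}(1-\theta)}{2(1-\theta)}},\ \sqrt[\alpha]{\tfrac{h^2\omega_{2-\alpha}(1-\theta)}{4\varepsilon^2}}\Bigr\}.$$ Then for $1\le n\le N$ $$\|u(t_n)-u^n\|_\infty\le C\Bigl(\frac{\tau_1^\sigma}{\sigma}+\frac1{1-\alpha}\max_{2\le k\le n}t_k^\alpha t_{k-1}^{\sigma-3}\tau_k^{3-\alpha}+h^2\Bigr)$$ (the maximum is $0$ for $n=1$). If moreover **M2** holds, i.e. for some $\gamma\ge1$ and $C_{1\gamma},C_{2\gamma}>0$ one has $\tau_k\le\tau\min\{1,C_{1\gamma}t_k^{1-1/\gamma}\}$ for $1\le k\le N$ and $t_k\le C_{2\gamma}t_{k-1}$ for $2\le k\le N$, then for $1\le n\le N$ $$\|u(t_n)-u^n\|_\infty\le\frac{C}{\sigma(1-\alpha)}\,\tau^{\min\{\gamma\sigma,2\}}+Ch^2,$$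 and in particular $\|u(t_n)-u^n\|_\infty\le\frac{C}{\sigma(1-\alpha)}\tau^2+Ch^2$ if $\gamma\ge\max\{1,2/\sigma\}$. The constants $C>0$ depend only on the data $\alpha,\varepsilon,L,T$ of the problem and on the regularity parameters $\sigma,K$ of the solution (and, under **M2**, on $\gamma,C_{1\gamma},C_{2\gamma}$); they do not depend on the time mesh, on $N$, on $M$ or on $n$. -/

import Mathlib

noncomputable section

namespace TimeFracAllenCahn

/-! ### The continuous problem -/

/-- The plane `ℝ²`; functions on the periodic square `(0, L)²` are `L`-periodic functions on it. -/
abbrev Plane : Type := EuclideanSpace ℝ (Fin 2)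

/-- The kernel `ω_μ(t) = t^(μ-1) / Γ(μ)`. -/
def omega (μ t : ℝ) : ℝ := t ^ (μ - 1) / Real.Gamma μ

/-- The Caputo derivative `(∂_t^α v)(t) = ∫_0^t ω_{1-α}(t-s) v'(s) ds`. -/
def caputo (α : ℝ) (v : ℝ → ℝ) (t : ℝ) : ℝ :=
  ∫ s in (0 : ℝ)..t, omega (1 - α) (t - s) * deriv v s

/-- The bulk force `f(u) = u³ - u`. -/
def bulk (z : ℝ) : ℝ := z ^ 3 - z

/-- `u x t` is a (classical) solution of the time-fractional Allen-Cahn equation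
`∂_t^α u = ε² Δu - f(u)` for `0 < t ≤ T` on the square of side `L` with periodic boundary
conditions and initial value `u₀`. -/
structure IsSolution (α ε L T : ℝ) (u₀ : Plane → ℝ) (u : Plane → ℝ → ℝ) : Prop where
  periodic : ∀ t ∈ Set.Icc 0 T, ∀ (x : Plane) (i : Fin 2),
    u (x + EuclideanSpace.single i L) t = u x t
  continuous : ContinuousOn (fun p : Plane × ℝ => u p.1 p.2) (Set.univ ×ˢ Set.Icc 0 T)
  initial : ∀ x, u x 0 = u₀ x
  space_smooth : ∀ t ∈ Set.Ioc 0 T, ContDiff ℝ 2 (fun x => u x t)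
  time_smooth : ∀ x, ContDiffOn ℝ 1 (u x) (Set.Ioc 0 T)
  time_integrable : ∀ x, IntervalIntegrable (deriv (u x)) MeasureTheory.volume 0 T
  equation : ∀ t ∈ Set.Ioc 0 T, ∀ x,
    caputo α (u x) t = ε ^ 2 * Laplacian.laplacian (fun y => u y t) x - bulk (u x t)

/-! ### Sobolev norms and the regularity assumption -/

/-- `w` is the weak partial derivative `∂_i v`. -/
def IsWeakPartial (i : Fin 2) (v w : Plane → ℝ) : Prop :=
  ∀ φ : Plane → ℝ, ContDiff ℝ (⊤ : ℕ∞) φ → HasCompactSupport φ →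
    ∫ x, v x * fderiv ℝ φ x (EuclideanSpace.single i 1) = - ∫ x, w x * φ x

/-- `‖v‖_{W^{k,∞}} ≤ B`: the function `v` is measurable, it has weak partial derivatives of all
orders up to `k`, and each of them, and `v` itself, is essentially bounded by `B`. (For an
`L`-periodic `v` the essential suprema over the plane and over the square coincide.) -/
def SobolevBound : ℕ → ℝ → (Plane → ℝ) → Prop
  | 0, B, v => MeasureTheory.AEStronglyMeasurable v ∧ ∀ᵐ x, |v x| ≤ B
  | k + 1, B, v => (MeasureTheory.AEStronglyMeasurable v ∧ ∀ᵐ x, |v x| ≤ B) ∧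
      ∀ i : Fin 2, ∃ w : Plane → ℝ, IsWeakPartial i v w ∧ SobolevBound k B w

/-- The time derivative `u^{(ℓ)}(x, t)` for `0 < t ≤ T` (one-sided at `t = T`). -/
def timeDeriv (T : ℝ) (l : ℕ) (u : Plane → ℝ → ℝ) (x : Plane) (t : ℝ) : ℝ :=
  iteratedDerivWithin l (u x) (Set.Ioc 0 T) t

/-- The regularity assumption with constant `K` and parameter `σ`:
`‖u(t)‖_{W^{4,∞}} ≤ K` and `‖u^{(ℓ)}(t)‖_{W^{2,∞}} ≤ K (1 + t^{σ-ℓ})` for `ℓ = 1, 2, 3`,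
`0 < t ≤ T`. -/
structure IsRegular (σ K T : ℝ) (u : Plane → ℝ → ℝ) : Prop where
  time_smooth : ∀ x, ContDiffOn ℝ 3 (u x) (Set.Ioc 0 T)
  continuous : ∀ l ∈ Finset.Icc (1 : ℕ) 3, ∀ t ∈ Set.Ioc 0 T,
    Continuous (fun x => timeDeriv T l u x t)
  space_bound : ∀ t ∈ Set.Ioc 0 T, SobolevBound 4 K (fun x => u x t)
  time_bound : ∀ l ∈ Finset.Icc (1 : ℕ) 3, ∀ t ∈ Set.Ioc 0 T,
    SobolevBound 2 (K * (1 + t ^ (σ - (l : ℝ)))) (fun x => timeDeriv T l u x t)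

/-! ### Time meshes -/

/-- `0 = t_0 < t_1 < ⋯ < t_N = T`; the values `t k` for `k > N` play no role. -/
structure IsMesh (T : ℝ) (N : ℕ) (t : ℕ → ℝ) : Prop where
  zero : t 0 = 0
  last : t N = T
  lt : ∀ k < N, t k < t (k + 1)

/-- The step size `τ_k = t_k - t_{k-1}`, for `k ≥ 1`. -/
def step (t : ℕ → ℝ) (k : ℕ) : ℝ := t k - t (k - 1)

/-- The maximum step size `τ = max_{1 ≤ k ≤ N} τ_k`. -/
def maxStep (N : ℕ) (t : ℕ → ℝ) : ℝ := ⨆ k : Finset.Icc 1 N, step t k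

/-- The step ratio `ρ_k = τ_k / τ_{k+1}`. -/
def ratio (t : ℕ → ℝ) (k : ℕ) : ℝ := step t k / step t (k + 1)

/-- The off-set time level `t_{k-θ} = (1-θ) t_k + θ t_{k-1}`. -/
def offset (θ : ℝ) (t : ℕ → ℝ) (k : ℕ) : ℝ := (1 - θ) * t k + θ * t (k - 1)

/-- The condition `M1`: the step ratios are at most `7/4`. -/
def CondM1 (N : ℕ) (t : ℕ → ℝ) : Prop :=
  ∀ k, 1 ≤ k → k + 1 ≤ N → ratio t k ≤ 7 / 4

/-- The graded-like condition `M2` with parameter `γ` and constants `c₁`, `c₂`. -/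
def CondM2 (γ c₁ c₂ : ℝ) (N : ℕ) (t : ℕ → ℝ) : Prop :=
  (∀ k, 1 ≤ k → k ≤ N → step t k ≤ maxStep N t * min 1 (c₁ * t k ^ (1 - 1 / γ))) ∧
  (∀ k, 2 ≤ k → k ≤ N → t k ≤ c₂ * t (k - 1))

/-! ### The nonuniform Alikhanov formula, with `θ = α / 2` -/

/-- `a_{n-k}^{(n)} = τ_k⁻¹ ∫_{t_{k-1}}^{min(t_k, t_{n-θ})} ω_{1-α}(t_{n-θ} - s) ds`. -/
def kernelA (α : ℝ) (t : ℕ → ℝ) (n k : ℕ) : ℝ :=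
  1 / step t k * ∫ s in (t (k - 1))..(min (t k) (offset (α / 2) t n)),
    omega (1 - α) (offset (α / 2) t n - s)

/-- `b_{n-k}^{(n)} = 2 / (τ_k (τ_k + τ_{k+1})) ∫_{t_{k-1}}^{t_k} (s - t_{k-1/2})
ω_{1-α}(t_{n-θ} - s) ds`. -/
def kernelB (α : ℝ) (t : ℕ → ℝ) (n k : ℕ) : ℝ :=
  2 / (step t k * (step t k + step t (k + 1))) *
    ∫ s in (t (k - 1))..(t k), (s - offset (1 / 2) t k) * omega (1 - α) (offset (α / 2) t n - s)

/-- The discrete convolution kernel `A_{n-k}^{(n)}`, for `1 ≤ k ≤ n`: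
`a_{n-k}^{(n)} + ρ_{k-1} b_{n-k+1}^{(n)} - b_{n-k}^{(n)}`, where the second term is absent for
`k = 1` and the third for `k = n`. -/
def kernel (α : ℝ) (t : ℕ → ℝ) (n k : ℕ) : ℝ :=
  kernelA α t n k
    + (if 2 ≤ k then ratio t (k - 1) * kernelB α t n (k - 1) else 0)
    - (if k < n then kernelB α t n k else 0)

/-- The Alikhanov formula `(∂_τ^α v)^{n-θ} = ∑_{k=1}^n A_{n-k}^{(n)} (v^k - v^{k-1})`. -/
def discreteCaputo (α : ℝ) (t : ℕ → ℝ) (v : ℕ → ℝ) (n : ℕ) : ℝ :=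
  ∑ k ∈ Finset.Icc 1 n, kernel α t n k * (v k - v (k - 1))

/-! ### The space grid and the fully discrete scheme -/

/-- Grid functions on the periodic `M × M` grid, with the maximum norm. -/
abbrev GridFun (M : ℕ) : Type := ZMod M × ZMod M → ℝ

/-- The grid point `x_h = (i h, j h)` with `h = L / M`. -/
def gridPoint (L : ℝ) (M : ℕ) (p : ZMod M × ZMod M) : Plane :=
  !₂[(p.1.val : ℝ) * (L / M), (p.2.val : ℝ) * (L / M)]

/-- The central difference approximation `D_h` of the Laplace operator on the periodic grid. -/
def discreteLaplacian (L : ℝ) (M : ℕ) (v : GridFun M) : GridFun M := fun p =>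
  (v (p.1 + 1, p.2) + v (p.1 - 1, p.2) + v (p.1, p.2 + 1) + v (p.1, p.2 - 1) - 4 * v p)
    / (L / M) ^ 2

/-- `U 0, …, U N` solves the fully discrete scheme
`(∂_τ^α U)^{n-θ} = ε² D_h U^{n-θ} - f(U)^{n-θ}`, `1 ≤ n ≤ N`, `U⁰ = u₀` on the grid,
where `w^{n-θ} = (1-θ) w^n + θ w^{n-1}` and `θ = α / 2`. -/
structure IsSchemeSolution (α ε L : ℝ) (u₀ : Plane → ℝ) (N : ℕ) (t : ℕ → ℝ) (M : ℕ)
    (U : ℕ → GridFun M) : Prop where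
  initial : ∀ p, U 0 p = u₀ (gridPoint L M p)
  scheme : ∀ n, 1 ≤ n → n ≤ N → ∀ p,
    discreteCaputo α t (fun k => U k p) n
      = ε ^ 2 * discreteLaplacian L M
          (fun q => (1 - α / 2) * U n q + α / 2 * U (n - 1) q) p
        - (α / 2 * bulk (U (n - 1) p) + (1 - α / 2) * bulk (U n p))

/-- The maximum-norm error `‖u(t_n) - uⁿ‖_∞` on the grid. -/
def gridError (L : ℝ) (u : Plane → ℝ → ℝ) (t : ℕ → ℝ) (M : ℕ) [NeZero M]
    (U : ℕ → GridFun M) (n : ℕ) : ℝ :=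
  ‖(fun p => u (gridPoint L M p) (t n) - U n p : GridFun M)‖

/-- The maximum step size condition of the convergence theorem, with `θ = α / 2`. -/
def StepCondition (α ε h τ : ℝ) : Prop :=
  τ ≤ (omega (2 - α) 1 / 11) ^ (1 / α) ∧
  τ ≤ (α / 2 * omega (2 - α) (1 - α / 2) / (2 * (1 - α / 2))) ^ (1 / α) ∧
  τ ≤ (h ^ 2 * omega (2 - α) (1 - α / 2) / (4 * ε ^ 2)) ^ (1 / α)

/-- `max_{2 ≤ k ≤ n} t_k^α t_{k-1}^{σ-3} τ_k^{3-α}`, which is `0` for `n = 1`. -/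
def meshTerm (α σ : ℝ) (t : ℕ → ℝ) (n : ℕ) : ℝ :=
  ⨆ k : Finset.Icc 2 n, t k ^ α * t (k - 1) ^ (σ - 3) * step t k ^ (3 - α)

end TimeFracAllenCahn

end

/-!
The error is estimated by the maximum principle together with a discrete Grönwall inequality for
the Alikhanov formula; the truncation error enters in a form that the Grönwall inequality absorbs
without loss.

*Kernel.* With `A k = kernel α t n k`, condition `M1` makes `A` positive and nondecreasing in `k`
(`kernel_mono`), bounded below by `c * (t_n - t_{k-1})^(-α)` (`kernel_lower`) and bounded above on
the diagonal by a multiple of `τ_n^(-α)` (`kernel_diag_le`). Summation by parts writes the Alikhanov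
formula as
`A n * e n - ∑_{1 ≤ k < n} (A (k + 1) - A k) * e k - A 1 * e 0` with nonnegative weights. Under the
step conditions all coefficients of the scheme at past and neighbouring values are nonnegative, so
that the scheme preserves the bound `|U| ≤ 1` (`abs_scheme_le_one`), and the error `e` satisfies
(`kernel_mul_norm_le`)
`A n * ‖e n‖ ≤ ∑_{1 ≤ k < n} (A (k + 1) - A k) * ‖e k‖ + (1 - θ) * ‖e n‖ + ℓ * ‖e (n - 1)‖ + R n`,
where `ℓ` is a Lipschitz constant of the nonlinearity, for the implicit part the one-sided Lipschitz
constant is `1`, and `R n` bounds the residual of the exact solution.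

*Grönwall.* The discrete Caputo derivative of a steep exponential dominates the reaction
terms at this exponential (`exists_barrier`); comparison with it gives `discrete_gronwall`, which also admits
residuals `∑_{k < n} (A (k + 1) - A k) * g k + Q * t_n^(-α)`, provided `A n * g n ≤ Q * t_n^(-α)`:
the first part is removed by passing from `e` to `e + g`.

*Consistency.* The Alikhanov formula is the Caputo derivative at `t_{n-θ}` of the piecewise quadratic
interpolant, linear on the last interval. On the other intervals the slope of the interpolation
error has mean zero, so that it sees only the variation of the memory kernel, which is controlled by
the increments of the discrete kernel (`memory_sub_le_kernel_sub`). On the last interval the leading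
part of the slope is a multiple of the distance to the midpoint, which the choice `θ = α / 2` makes
invisible (`integral_memory_mul_sub_mid`). With Rolle-type interpolation estimates the error is at
most `∑_{k < n} (A (k + 1) - A k) * g k + C * Γ * t_n^(-α)` with `g k = C * Γ * (τ_k / t_k)^α`, where
`Γ` bounds `τ_1^σ` and `t_k^α t_{k-1}^(σ-3) τ_k^(3-α)` for `k ≥ 2` (`exists_consistency_bound`).
Evaluating the other terms of the equation at `t_{n-θ}` instead of averaging them over `t_{n-1}`,
`t_n` costs `C * (Γ + τ_n^α) * t_n^(-α)` (`exists_variation_bound`), and here the third step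
condition is used a second time: it says `τ^α ≤ C h²`, so that the part with `τ_n^α` belongs to the
spatial error. The central difference is consistent of order `h²` for solutions in `W^{4,∞}`
(`SobolevBound.abs_fivePoint_sub_laplacian_le`, by mollification).

The resulting estimate `‖e n‖ ≤ C * (Γ + h²)` (`exists_error_bound`) contains both assertions, since
`M2` gives `Γ ≤ C * τ^min(γσ, 2)` (`exists_meshBound_of_condM2`).
-/

noncomputable section

namespace TimeFracAllenCahn

/-! ### Summation by parts and a discrete fractional Grönwall inequality -/

open Finset in
/-- Summation by parts for one row of a discrete convolution. -/
lemma sum_mul_diff_eq (A e : ℕ → ℝ) {n : ℕ} (hn : 1 ≤ n) :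
    ∑ k ∈ Icc 1 n, A k * (e k - e (k - 1))
      = A n * e n - ∑ k ∈ Ico 1 n, (A (k + 1) - A k) * e k - A 1 * e 0 := by
  induction n, hn using Nat.le_induction with
  | base => simp; ring
  | succ n hn ih =>
    rw [Finset.sum_Icc_succ_top (by omega), ih, Finset.sum_Ico_succ_top hn]
    simp only [Nat.add_sub_cancel]
    ring

open Finset in
/-- A convolution with a nonnegative nondecreasing row dominates the increment of a
nondecreasing sequence from level `i` on, weighted by the smallest coefficient involved. -/
lemma mul_sub_le_sum_mul_diff {A v : ℕ → ℝ} {n i : ℕ} (hi : i < n)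
    (hA0 : ∀ k, 1 ≤ k → k ≤ n → 0 ≤ A k) (hA : ∀ k, 1 ≤ k → k < n → A k ≤ A (k + 1))
    (hv : ∀ k, 1 ≤ k → k ≤ n → v (k - 1) ≤ v k) :
    A (i + 1) * (v n - v i) ≤ ∑ k ∈ Icc 1 n, A k * (v k - v (k - 1)) := by
  induction n, (show i + 1 ≤ n from hi) using Nat.le_induction with
  | base =>
    rw [Finset.sum_Icc_succ_top (by omega)]
    simp only [Nat.add_sub_cancel]
    have : 0 ≤ ∑ k ∈ Icc 1 i, A k * (v k - v (k - 1)) := by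
      refine Finset.sum_nonneg fun k hk => ?_
      rw [mem_Icc] at hk
      exact mul_nonneg (hA0 k hk.1 (by omega)) (sub_nonneg.2 (hv k hk.1 (by omega)))
    linarith
  | succ n hn ih =>
    have h1 := ih (by omega) (fun k h h' => hA0 k h (by omega)) (fun k h h' => hA k h (by omega))
      (fun k h h' => hv k h (by omega))
    rw [Finset.sum_Icc_succ_top (by omega)]
    simp only [Nat.add_sub_cancel]
    have h2 : A (i + 1) ≤ A (n + 1) := by
      have : ∀ m, i + 1 ≤ m → m ≤ n + 1 → A (i + 1) ≤ A m := by
        intro m hm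
        induction m, hm using Nat.le_induction with
        | base => intro _; exact le_rfl
        | succ m hm ihm =>
          intro h'
          exact (ihm (by omega)).trans (hA m (by omega) (by omega))
      exact this (n + 1) (by omega) le_rfl
    have h3 := hv (n + 1) (by omega) le_rfl
    simp only [Nat.add_sub_cancel] at h3
    nlinarith [mul_le_mul_of_nonneg_right h2 (sub_nonneg.2 h3)]

lemma IsMesh.mono {T : ℝ} {N : ℕ} {t : ℕ → ℝ} (h : IsMesh T N t) {i j : ℕ} (hij : i ≤ j)
    (hj : j ≤ N) : t i ≤ t j := by
  induction j, hij using Nat.le_induction with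
  | base => exact le_rfl
  | succ j hij ih => exact (ih (by omega)).trans (h.lt j (by omega)).le

lemma IsMesh.strict {T : ℝ} {N : ℕ} {t : ℕ → ℝ} (h : IsMesh T N t) {i j : ℕ} (hij : i < j)
    (hj : j ≤ N) : t i < t j :=
  (h.lt i (by omega)).trans_le (h.mono (by omega) hj)

lemma IsMesh.pos {T : ℝ} {N : ℕ} {t : ℕ → ℝ} (h : IsMesh T N t) {j : ℕ} (hj0 : 1 ≤ j)
    (hj : j ≤ N) : 0 < t j := by
  rw [← h.zero]; exact h.strict (by omega) hj

lemma IsMesh.nonneg {T : ℝ} {N : ℕ} {t : ℕ → ℝ} (h : IsMesh T N t) {j : ℕ}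
    (hj : j ≤ N) : 0 ≤ t j := by
  rw [← h.zero]; exact h.mono (by omega) hj

lemma IsMesh.le_last {T : ℝ} {N : ℕ} {t : ℕ → ℝ} (h : IsMesh T N t) {j : ℕ}
    (hj : j ≤ N) : t j ≤ T := by
  rw [← h.last]; exact h.mono hj le_rfl

lemma IsMesh.step_pos {T : ℝ} {N : ℕ} {t : ℕ → ℝ} (h : IsMesh T N t) {k : ℕ} (hk : 1 ≤ k)
    (hkN : k ≤ N) : 0 < step t k :=
  sub_pos.2 (h.strict (by omega) hkN)

lemma IsMesh.step_le {T : ℝ} {N : ℕ} {t : ℕ → ℝ} (h : IsMesh T N t) {k : ℕ}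
    (hkN : k ≤ N) : step t k ≤ t k :=
  sub_le_self _ (h.nonneg (by omega))

lemma CondM1.step_le {T : ℝ} {N : ℕ} {t : ℕ → ℝ} (h : IsMesh T N t) (hM : CondM1 N t) {k : ℕ}
    (hk : 1 ≤ k) (hkN : k + 1 ≤ N) : step t k ≤ 7 / 4 * step t (k + 1) := by
  have := hM k hk hkN
  rwa [ratio, div_le_iff₀ (h.step_pos (by omega) hkN)] at this

/-- The barrier: exponential in time, but `0` at the initial level. -/
def barrier (μ : ℝ) (t : ℕ → ℝ) (k : ℕ) : ℝ := if k = 0 then 0 else Real.exp (μ * t k)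

/-- The convolution kernels `A^{(n)}_{n-k}`, written `A n k`, have the structure on which the
stability estimate rests: rows that increase with `k`, a lower bound by the continuous kernel,
and a diagonal that dominates the implicit reaction term. -/
structure KernelStructure (α c lam : ℝ) (N : ℕ) (t : ℕ → ℝ) (A : ℕ → ℕ → ℝ) : Prop where
  mono : ∀ n k, 1 ≤ k → k < n → n ≤ N → A n k ≤ A n (k + 1)
  lower : ∀ n k, 1 ≤ k → k ≤ n → n ≤ N → c * (t n - t (k - 1)) ^ (-α) ≤ A n k
  diag : ∀ n, 1 ≤ n → n ≤ N → 4 * lam ≤ A n n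

/-- For a large rate `μ` the discrete Caputo derivative of the exponential barrier dominates the
reaction terms, uniformly in the mesh. Either the last step is long compared with `1 / μ`, and the
diagonal coefficient suffices, or the barrier grows by a fixed factor over a window of length
`δ ~ 1 / μ`, where the kernel is at least `c δ^(-α)`; `M1` keeps the window from overshooting. -/
lemma exists_barrier {α c lam Lam : ℝ} (hα : 0 < α) (hc : 0 < c) (hlam : 0 < lam)
    (hLam : 0 ≤ Lam) :
    ∃ μ : ℝ, 0 < μ ∧ ∀ (T : ℝ) (N : ℕ) (t : ℕ → ℝ) (A : ℕ → ℕ → ℝ), IsMesh T N t → CondM1 N t →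
      KernelStructure α c lam N t A → ∀ n, 1 ≤ n → n ≤ N →
        2 * (lam * barrier μ t n + Lam * barrier μ t (n - 1))
            ≤ ∑ k ∈ Finset.Icc 1 n, A n k * (barrier μ t k - barrier μ t (k - 1)) ∧
        c * t n ^ (-α)
            ≤ ∑ k ∈ Finset.Icc 1 n, A n k * (barrier μ t k - barrier μ t (k - 1)) := by
  -- Growth by `exp m` makes `v (n - 1)` small enough for the diagonal coefficient alone.
  obtain ⟨m, hm0, hm1, hm2⟩ : ∃ m : ℝ, 0 < m ∧ Real.exp (-m) ≤ 1 / 2 ∧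
      Real.exp (-m) * (4 * lam + 2 * Lam) ≤ 2 * lam := by
    have h1 : Filter.Tendsto (fun m : ℝ => Real.exp (-m)) Filter.atTop (nhds 0) :=
      Real.tendsto_exp_neg_atTop_nhds_zero
    have h2 : Filter.Tendsto (fun m : ℝ => Real.exp (-m) * (4 * lam + 2 * Lam)) Filter.atTop
        (nhds 0) := by simpa using h1.mul_const (4 * lam + 2 * Lam)
    obtain ⟨m, h⟩ := ((Filter.eventually_gt_atTop (0 : ℝ)).and
      ((h1.eventually_le_const (by norm_num : (0 : ℝ) < 1 / 2)).and
        (h2.eventually_le_const (by linarith : (0 : ℝ) < 2 * lam)))).exists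
    exact ⟨m, h.1, h.2.1, h.2.2⟩
  -- Over a window of length `δ` the lower bound of the kernel is four times the sum of the reaction
  -- coefficients.
  obtain ⟨δ, hδ0, hδ⟩ : ∃ δ : ℝ, 0 < δ ∧ 4 * (lam + Lam) = c * δ ^ (-α) := by
    have h0 : 0 < 4 * (lam + Lam) / c := by positivity
    refine ⟨(4 * (lam + Lam) / c) ^ (-1 / α), by positivity, ?_⟩
    rw [← Real.rpow_mul h0.le]
    have : -1 / α * -α = 1 := by field_simp
    rw [this, Real.rpow_one]; field_simp
  -- The window is sought with length `4 δ / 11`; by `M1` one more step multiplies this by at most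
  -- `1 + 7/4 = 11/4`.
  set μ := 11 * m / (4 * δ) with hμ
  have hμ0 : 0 < μ := by positivity
  have hμδ : μ * (4 * δ / 11) = m := by rw [hμ]; field_simp
  refine ⟨μ, hμ0, ?_⟩
  intro T N t A hmesh hM hA n hn hnN
  set v := barrier μ t with hv
  have hv0 : v 0 = 0 := by simp [hv, barrier]
  have hvpos : ∀ k, 1 ≤ k → v k = Real.exp (μ * t k) := by
    intro k hk; simp [hv, barrier, show k ≠ 0 by omega]
  have hvnn : ∀ k, 0 ≤ v k := by
    intro k; simp only [hv, barrier]; split_ifs; exacts [le_rfl, (Real.exp_pos _).le]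
  have hvmono : ∀ k, 1 ≤ k → k ≤ n → v (k - 1) ≤ v k := by
    intro k hk hkn
    rcases Nat.eq_or_lt_of_le hk with rfl | hk'
    · simpa [hv0] using hvnn 1
    · rw [hvpos k hk, hvpos (k - 1) (by omega)]
      refine Real.exp_le_exp.2 (mul_le_mul_of_nonneg_left (hmesh.mono (by omega) (by omega)) hμ0.le)
  have hA0 : ∀ k, 1 ≤ k → k ≤ n → 0 ≤ A n k := fun k hk hkn =>
    le_trans (mul_nonneg hc.le (Real.rpow_nonneg
      (sub_nonneg.2 (hmesh.mono (by omega) hnN)) _)) (hA.lower n k hk hkn hnN)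
  have key : ∀ i, i < n → A n (i + 1) * (v n - v i)
      ≤ ∑ k ∈ Finset.Icc 1 n, A n k * (v k - v (k - 1)) := fun i hi =>
    mul_sub_le_sum_mul_diff hi hA0 (fun k hk hkn => hA.mono n k hk hkn hnN) hvmono
  have hgrow : ∀ i, 1 ≤ i → i ≤ n → m ≤ μ * (t n - t i) → v i ≤ Real.exp (-m) * v n := by
    intro i hi hin hmi
    rw [hvpos i hi, hvpos n hn, ← Real.exp_add]
    exact Real.exp_le_exp.2 (by linarith)
  have hv1 : 1 ≤ v n := by
    rw [hvpos n hn]; exact Real.one_le_exp (mul_nonneg hμ0.le (hmesh.nonneg hnN))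
  have hkey0 : c * t n ^ (-α) * v n ≤ ∑ k ∈ Finset.Icc 1 n, A n k * (v k - v (k - 1)) := by
    refine le_trans ?_ (key 0 (by omega))
    have := hA.lower n 1 le_rfl hn hnN
    simp only [Nat.sub_self, hmesh.zero, sub_zero] at this
    rw [hv0, sub_zero]
    exact mul_le_mul_of_nonneg_right this (hvnn n)
  have htn : 0 < t n := hmesh.pos hn hnN
  -- A window reaching back from `t n` to `t i`, of length at most `δ`.
  have hwin : ∀ i, i < n → t n - t i ≤ δ → (i = 0 ∨ m ≤ μ * (t n - t i)) →
      2 * (lam * v n + Lam * v (n - 1))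
        ≤ ∑ k ∈ Finset.Icc 1 n, A n k * (v k - v (k - 1)) := by
    intro i hi hiδ hcase
    have h1 : v i ≤ 1 / 2 * v n := by
      rcases Nat.eq_zero_or_pos i with rfl | hpos
      · rw [hv0]; linarith
      · have := hgrow i hpos hi.le (hcase.resolve_left (by omega))
        nlinarith
    have h2 : c * δ ^ (-α) ≤ A n (i + 1) := by
      refine le_trans ?_ (hA.lower n (i + 1) (by omega) (by omega) hnN)
      simp only [Nat.add_sub_cancel]
      exact mul_le_mul_of_nonneg_left (Real.rpow_le_rpow_of_nonpos
        (sub_pos.2 (hmesh.strict hi hnN)) hiδ (by linarith)) hc.le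
    have h3 : v (n - 1) ≤ v n := hvmono n hn le_rfl
    refine le_trans ?_ (key i hi)
    have h4 : 4 * (lam + Lam) * (1 / 2 * v n) ≤ A n (i + 1) * (v n - v i) := by
      rw [hδ]
      exact mul_le_mul h2 (by linarith) (by linarith) (hA0 _ (by omega) (by omega))
    nlinarith [mul_le_mul_of_nonneg_left h3 hLam]
  refine ⟨?_, le_trans ?_ hkey0⟩
  · by_cases hlong : m ≤ μ * (t n - t (n - 1))
    · rcases Nat.eq_or_lt_of_le hn with rfl | hn'
      · -- At the first level the barrier starts from `0`.
        refine le_trans ?_ (key 0 (by omega))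
        have := hA.diag 1 le_rfl hnN
        simp only [Nat.sub_self, hv0, zero_add, sub_zero, mul_zero, add_zero]
        nlinarith
      · have h1 := hgrow (n - 1) (by omega) (by omega) hlong
        have h2 := key (n - 1) (by omega)
        rw [show n - 1 + 1 = n by omega] at h2
        refine le_trans ?_ h2
        have h3 := hA.diag n hn hnN
        have h4 : 4 * lam * (v n - v (n - 1)) ≤ A n n * (v n - v (n - 1)) :=
          mul_le_mul_of_nonneg_right h3 (sub_nonneg.2 (hvmono n hn le_rfl))
        refine le_trans ?_ h4
        have h5 : (4 * lam + 2 * Lam) * v (n - 1) ≤ (4 * lam + 2 * Lam) * (Real.exp (-m) * v n) :=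
          mul_le_mul_of_nonneg_left h1 (by positivity)
        nlinarith [mul_le_mul_of_nonneg_right hm2 (hvnn n)]
    · push Not at hlong
      have hlt : ∀ s : ℝ, μ * s < m → s < 4 * δ / 11 := by
        intro s hs; rw [← hμδ] at hs; exact lt_of_mul_lt_mul_left hs hμ0.le
      classical
      have hex : ∃ j, t n - t j < 4 * δ / 11 := ⟨n - 1, hlt _ hlong⟩
      -- The earliest level in the window; the level before it is at distance between
      -- `4 δ / 11` and `δ`.
      obtain ⟨j, hj, hjmin⟩ : ∃ j, t n - t j < 4 * δ / 11 ∧ ∀ i < j, ¬ (t n - t i < 4 * δ / 11) :=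
        ⟨Nat.find hex, Nat.find_spec hex, fun i hi => Nat.find_min hex hi⟩
      have hjn : j ≤ n - 1 := by
        by_contra hcon
        exact hjmin (n - 1) (by omega) (hlt _ hlong)
      rcases Nat.eq_zero_or_pos j with rfl | hjpos
      · exact hwin 0 (by omega) (by linarith) (Or.inl rfl)
      · refine hwin (j - 1) (by omega) ?_ (Or.inr ?_)
        · have h1 := hM.step_le hmesh hjpos (by omega : j + 1 ≤ N)
          have h2 : step t (j + 1) ≤ t n - t j := by
            simp only [step, Nat.add_sub_cancel]
            linarith [hmesh.mono (by omega : j + 1 ≤ n) hnN]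
          have h3 : t n - t (j - 1) = (t n - t j) + step t j := by rw [step]; ring
          rw [h3]; linarith
        · have := hjmin (j - 1) (by omega)
          push Not at this
          rw [← hμδ]
          exact mul_le_mul_of_nonneg_left this hμ0.le
  · have h0 : 0 ≤ c * t n ^ (-α) := mul_nonneg hc.le (Real.rpow_nonneg htn.le _)
    nlinarith

open Finset in
/-- A discrete fractional Grönwall inequality. The auxiliary sequence `g` carries those parts of
the consistency error that are distributed over the past levels with the weights
`A n (k + 1) - A n k`. Induction shows that `E + g` stays below a multiple of the barrier. -/
lemma discrete_gronwall {α c lam Lam : ℝ} (T : ℝ) (hα : 0 < α) (hc : 0 < c)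
    (hlam : 0 < lam) (hLam : 0 ≤ Lam) :
    ∃ C : ℝ, 0 < C ∧ ∀ (N : ℕ) (t : ℕ → ℝ) (A : ℕ → ℕ → ℝ), IsMesh T N t → CondM1 N t →
      KernelStructure α c lam N t A → ∀ (n₀ : ℕ) (E g : ℕ → ℝ) (Q : ℝ), n₀ ≤ N → 0 ≤ Q →
        E 0 = 0 → g 0 = 0 → (∀ k, 0 ≤ g k) →
        (∀ n, 1 ≤ n → n ≤ n₀ → A n n * g n ≤ Q * t n ^ (-α)) →
        (∀ n, 1 ≤ n → n ≤ n₀ → A n n * E n ≤ ∑ k ∈ Ico 1 n, (A n (k + 1) - A n k) * (E k + g k)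
          + lam * E n + Lam * E (n - 1) + Q * t n ^ (-α)) →
        ∀ n, 1 ≤ n → n ≤ n₀ → E n ≤ C * Q := by
  obtain ⟨μ, hμ, hbar⟩ := exists_barrier hα hc hlam hLam
  refine ⟨4 / c * Real.exp (μ * T), by positivity, ?_⟩
  intro N t A hmesh hM hA n₀ E g Q hn₀ hQ hE0 hg0 hg hgA hE
  set B : ℕ → ℝ := fun k => 4 / c * Q * barrier μ t k with hB
  have hB0 : B 0 = 0 := by simp [hB, barrier]
  have main : ∀ n, n ≤ n₀ → E n + g n ≤ B n := by
    intro n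
    induction n using Nat.strong_induction_on with
    | _ n ih =>
      intro hn
      rcases Nat.eq_zero_or_pos n with rfl | hpos
      · rw [hE0, hg0, hB0]; norm_num
      have hnN : n ≤ N := by omega
      obtain ⟨hb1, hb2⟩ := hbar T N t A hmesh hM hA n hpos hnN
      have hs := sum_mul_diff_eq (A n) B hpos
      rw [hB0, mul_zero, sub_zero] at hs
      have hs' : ∑ k ∈ Icc 1 n, A n k * (B k - B (k - 1))
          = 4 / c * Q * ∑ k ∈ Icc 1 n, A n k * (barrier μ t k - barrier μ t (k - 1)) := by
        rw [mul_sum]; exact sum_congr rfl fun k _ => by simp only [hB]; ring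
      have hp : ∑ k ∈ Ico 1 n, (A n (k + 1) - A n k) * (E k + g k)
          ≤ ∑ k ∈ Ico 1 n, (A n (k + 1) - A n k) * B k := by
        refine sum_le_sum fun k hk => ?_
        rw [mem_Ico] at hk
        exact mul_le_mul_of_nonneg_left (ih k hk.2 (by omega))
          (sub_nonneg.2 (hA.mono n k hk.1 hk.2 hnN))
      have h1 := hE n hpos hn
      have h2 := hgA n hpos hn
      have h3 := hA.diag n hpos hnN
      have h4 := ih (n - 1) (by omega) (by omega)
      have hq : 0 ≤ 4 / c * Q := by positivity
      have h5 : lam * B n + Lam * B (n - 1) + 2 * (Q * t n ^ (-α))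
          ≤ ∑ k ∈ Icc 1 n, A n k * (B k - B (k - 1)) := by
        rw [hs']
        have e1 := mul_le_mul_of_nonneg_left hb1 hq
        have e2 := mul_le_mul_of_nonneg_left hb2 hq
        have e3 : 4 / c * Q * (c * t n ^ (-α)) = 4 * (Q * t n ^ (-α)) := by field_simp
        have e4 : 4 / c * Q * (2 * (lam * barrier μ t n + Lam * barrier μ t (n - 1)))
            = 2 * (lam * B n + Lam * B (n - 1)) := by simp only [hB]; ring
        linarith
      have h6 : (A n n - lam) * (E n + g n) ≤ (A n n - lam) * B n := by
        have e1 : Lam * E (n - 1) ≤ Lam * B (n - 1) :=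
          mul_le_mul_of_nonneg_left (by linarith [hg (n - 1)]) hLam
        have e2 := mul_nonneg hlam.le (hg n)
        nlinarith
      exact le_of_mul_le_mul_left h6 (by linarith)
  intro n hn hn'
  have h1 := main n hn'
  have h2 : B n ≤ 4 / c * Real.exp (μ * T) * Q := by
    simp only [hB, barrier, show n ≠ 0 by omega, if_false]
    have : Real.exp (μ * t n) ≤ Real.exp (μ * T) :=
      Real.exp_le_exp.2 (mul_le_mul_of_nonneg_left (hmesh.le_last (by omega)) hμ.le)
    have hq : 0 ≤ 4 / c * Q := by positivity
    nlinarith [mul_le_mul_of_nonneg_left this hq]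
  linarith [hg n]

end TimeFracAllenCahn

end

noncomputable section

namespace TimeFracAllenCahn

/-! ### Mean values and first moments -/

/-- The mean value of `f` over `[a, b]`. -/
def avg (f : ℝ → ℝ) (a b : ℝ) : ℝ := 1 / (b - a) * ∫ s in a..b, f s

/-- The first moment of `f` over `[a, b]` about the midpoint, scaled by `(b - a)^(-2)`. -/
def moment (f : ℝ → ℝ) (a b : ℝ) : ℝ := 1 / (b - a) ^ 2 * ∫ s in a..b, (s - (a + b) / 2) * f s

lemma integral_sub_mid (a b : ℝ) : ∫ s in a..b, (s - (a + b) / 2) = 0 := by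
  rw [intervalIntegral.integral_sub (by simp) (by simp)]
  simp [integral_id]; ring

lemma integral_sub_mid_sq (a b : ℝ) : ∫ s in a..b, (s - (a + b) / 2) ^ 2 = (b - a) ^ 3 / 12 := by
  rw [intervalIntegral.integral_comp_sub_right (fun x => x ^ 2), integral_pow]
  push_cast; ring

lemma integral_right_sub (a b : ℝ) : ∫ s in a..b, (b - s) = (b - a) ^ 2 / 2 := by
  rw [intervalIntegral.integral_comp_sub_left (fun x => x)]
  simp [integral_id]

/-- For `0 ≤ c ≤ 2` the combination `avg f - c * moment f` is a mean value of `f` with a nonnegative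
weight of total mass one. -/
lemma le_avg_sub_moment {f : ℝ → ℝ} {a b m c : ℝ} (hab : a < b) (hf : ContinuousOn f (Set.Icc a b))
    (hm : ∀ s ∈ Set.Icc a b, m ≤ f s) (hc0 : 0 ≤ c) (hc : c ≤ 2) :
    m ≤ avg f a b - c * moment f a b := by
  have hba : 0 < b - a := sub_pos.2 hab
  have hfi : IntervalIntegrable f MeasureTheory.volume a b := by
    apply ContinuousOn.intervalIntegrable; rwa [Set.uIcc_of_le hab.le]
  have hfi2 : IntervalIntegrable (fun s => (s - (a + b) / 2) * f s) MeasureTheory.volume a b :=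
    hfi.continuousOn_mul (by fun_prop)
  have h1 : ∫ s in a..b, (m * (1 - c / (b - a) * (s - (a + b) / 2)))
      ≤ ∫ s in a..b, (f s - c / (b - a) * ((s - (a + b) / 2) * f s)) := by
    refine intervalIntegral.integral_mono_on hab.le (by apply Continuous.intervalIntegrable; fun_prop)
      (hfi.sub (hfi2.const_mul _)) fun s hs => ?_
    have h2 : 0 ≤ 1 - c / (b - a) * (s - (a + b) / 2) := by
      have : c / (b - a) * (s - (a + b) / 2) ≤ 1 := by
        rw [div_mul_eq_mul_div, div_le_one hba]
        nlinarith [hs.1, hs.2]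
      linarith
    nlinarith [mul_le_mul_of_nonneg_right (hm s hs) h2]
  rw [intervalIntegral.integral_sub hfi (hfi2.const_mul _), intervalIntegral.integral_const_mul,
    intervalIntegral.integral_const_mul, intervalIntegral.integral_sub (by simp)
      (by apply Continuous.intervalIntegrable; fun_prop), intervalIntegral.integral_const_mul,
    integral_sub_mid] at h1
  simp only [intervalIntegral.integral_const, smul_eq_mul, mul_one, mul_zero, sub_zero] at h1
  rw [avg, moment]
  have h3 : 1 / (b - a) * (m * (b - a)) ≤ 1 / (b - a) * ((∫ s in a..b, f s)
      - c / (b - a) * ∫ s in a..b, (s - (a + b) / 2) * f s) :=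
    mul_le_mul_of_nonneg_left h1 (by positivity)
  have e1 : 1 / (b - a) * (m * (b - a)) = m := by field_simp
  have e2 : 1 / (b - a) * ((∫ s in a..b, f s)
      - c / (b - a) * ∫ s in a..b, (s - (a + b) / 2) * f s)
      = 1 / (b - a) * (∫ s in a..b, f s)
        - c * (1 / (b - a) ^ 2 * ∫ s in a..b, (s - (a + b) / 2) * f s) := by
    generalize ∫ s in a..b, (s - (a + b) / 2) * f s = I
    field_simp
  linarith

lemma moment_le_half_avg {f : ℝ → ℝ} {a b : ℝ} (hab : a < b) (hf : ContinuousOn f (Set.Icc a b))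
    (hm : ∀ s ∈ Set.Icc a b, 0 ≤ f s) : moment f a b ≤ 1 / 2 * avg f a b := by
  have := le_avg_sub_moment hab hf hm zero_le_two le_rfl
  linarith

lemma moment_nonneg {f : ℝ → ℝ} {a b : ℝ} (hab : a < b) (hf : ContinuousOn f (Set.Icc a b))
    (hm : MonotoneOn f (Set.Icc a b)) : 0 ≤ moment f a b := by
  have hfi : IntervalIntegrable f MeasureTheory.volume a b := by
    apply ContinuousOn.intervalIntegrable; rwa [Set.uIcc_of_le hab.le]
  have hfi2 : IntervalIntegrable (fun s => (s - (a + b) / 2) * f s) MeasureTheory.volume a b :=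
    hfi.continuousOn_mul (by fun_prop)
  refine mul_nonneg (by positivity) ?_
  have hmid : (a + b) / 2 ∈ Set.Icc a b := ⟨by linarith, by linarith⟩
  have h1 : ∫ s in a..b, (s - (a + b) / 2) * f ((a + b) / 2)
      ≤ ∫ s in a..b, (s - (a + b) / 2) * f s := by
    refine intervalIntegral.integral_mono_on hab.le
      (by apply Continuous.intervalIntegrable; fun_prop) hfi2 fun s hs => ?_
    rcases le_total s ((a + b) / 2) with h | h
    · exact mul_le_mul_of_nonpos_left (hm hs hmid h) (by linarith)
    · exact mul_le_mul_of_nonneg_left (hm hmid hs h) (by linarith)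
  rwa [intervalIntegral.integral_mul_const, integral_sub_mid, zero_mul] at h1

lemma moment_le_of_slope {f : ℝ → ℝ} {a b p : ℝ} (hab : a < b)
    (hf : ContinuousOn f (Set.Icc a b))
    (hp : ∀ x ∈ Set.Icc a b, ∀ y ∈ Set.Icc a b, x ≤ y → f y - f x ≤ p * (y - x)) :
    moment f a b ≤ p * (b - a) / 12 := by
  have hba : 0 < b - a := sub_pos.2 hab
  have hfi : IntervalIntegrable f MeasureTheory.volume a b := by
    apply ContinuousOn.intervalIntegrable; rwa [Set.uIcc_of_le hab.le]
  have hfi2 : IntervalIntegrable (fun s => (s - (a + b) / 2) * f s) MeasureTheory.volume a b :=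
    hfi.continuousOn_mul (by fun_prop)
  have hmid : (a + b) / 2 ∈ Set.Icc a b := ⟨by linarith, by linarith⟩
  have h1 : ∫ s in a..b, (s - (a + b) / 2) * f s
      ≤ ∫ s in a..b, ((s - (a + b) / 2) * f ((a + b) / 2) + p * (s - (a + b) / 2) ^ 2) := by
    refine intervalIntegral.integral_mono_on hab.le hfi2
      (by apply Continuous.intervalIntegrable; fun_prop) fun s hs => ?_
    rcases le_total s ((a + b) / 2) with h | h
    · nlinarith [hp s hs _ hmid h]
    · nlinarith [hp _ hmid s hs h]
  rw [intervalIntegral.integral_add (by apply Continuous.intervalIntegrable; fun_prop)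
      (by apply Continuous.intervalIntegrable; fun_prop), intervalIntegral.integral_mul_const,
    integral_sub_mid, zero_mul, zero_add, intervalIntegral.integral_const_mul,
    integral_sub_mid_sq] at h1
  rw [moment]
  calc _ ≤ 1 / (b - a) ^ 2 * (p * ((b - a) ^ 3 / 12)) :=
        mul_le_mul_of_nonneg_left h1 (by positivity)
    _ = _ := by field_simp

lemma half_mul_le_sub_avg {f : ℝ → ℝ} {a b p : ℝ} (hab : a < b)
    (hf : ContinuousOn f (Set.Icc a b))
    (hp : ∀ s ∈ Set.Icc a b, p * (b - s) ≤ f b - f s) :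
    1 / 2 * (p * (b - a)) ≤ f b - avg f a b := by
  have hba : 0 < b - a := sub_pos.2 hab
  have hfi : IntervalIntegrable f MeasureTheory.volume a b := by
    apply ContinuousOn.intervalIntegrable; rwa [Set.uIcc_of_le hab.le]
  have h1 : ∫ s in a..b, p * (b - s) ≤ ∫ s in a..b, (f b - f s) :=
    intervalIntegral.integral_mono_on hab.le (by apply Continuous.intervalIntegrable; fun_prop)
      ((by simp : IntervalIntegrable (fun _ => f b) MeasureTheory.volume a b).sub hfi) hp
  rw [intervalIntegral.integral_const_mul, integral_right_sub,
    intervalIntegral.integral_sub (by simp) hfi, intervalIntegral.integral_const, smul_eq_mul] at h1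
  have h2 := mul_le_mul_of_nonneg_left h1 (by positivity : 0 ≤ 1 / (b - a))
  rw [avg]
  have e1 : 1 / (b - a) * (p * ((b - a) ^ 2 / 2)) = 1 / 2 * (p * (b - a)) := by field_simp
  have e2 : 1 / (b - a) * ((b - a) * f b - ∫ s in a..b, f s)
      = f b - 1 / (b - a) * ∫ s in a..b, f s := by field_simp
  linarith

lemma half_sub_le_sub_avg {f : ℝ → ℝ} {a b : ℝ} (hab : a < b)
    (hf : ContinuousOn f (Set.Icc a b)) (hconv : ConvexOn ℝ (Set.Icc a b) f) :
    1 / 2 * (f b - f a) ≤ f b - avg f a b := by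
  have hba : 0 < b - a := sub_pos.2 hab
  have := half_mul_le_sub_avg (p := (f b - f a) / (b - a)) hab hf ?_
  · rwa [div_mul_cancel₀ _ hba.ne'] at this
  · intro s hs
    have h := hconv.2 (Set.left_mem_Icc.2 hab.le) (Set.right_mem_Icc.2 hab.le)
      (div_nonneg (sub_nonneg.2 hs.2) hba.le) (div_nonneg (sub_nonneg.2 hs.1) hba.le)
      (by field_simp; ring)
    have e : ((b - s) / (b - a)) • a + ((s - a) / (b - a)) • b = s := by
      simp only [smul_eq_mul]; field_simp; ring
    rw [e] at h
    simp only [smul_eq_mul] at h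
    have e2 : (b - s) / (b - a) * f a + (s - a) / (b - a) * f b
        = f b - (f b - f a) / (b - a) * (b - s) := by field_simp; ring
    linarith

/-! ### The weakly singular kernel -/

/-- The integrand `s ↦ ω_{1-α}(r - s)` of the Caputo derivative at time `r`. -/
def memory (α r s : ℝ) : ℝ := omega (1 - α) (r - s)

lemma memory_eq (α r s : ℝ) : memory α r s = (r - s) ^ (-α) / Real.Gamma (1 - α) := by
  rw [memory, omega]; congr 2; ring

section
variable {α r : ℝ}

lemma memory_nonneg (hα1 : α < 1) {s : ℝ} (hs : s ≤ r) : 0 ≤ memory α r s := by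
  rw [memory_eq]
  exact div_nonneg (Real.rpow_nonneg (sub_nonneg.2 hs) _) (Real.Gamma_pos_of_pos (by linarith)).le

lemma memory_hasDerivAt (α : ℝ) {s : ℝ} (hs : s < r) :
    HasDerivAt (memory α r) (α * (r - s) ^ (-α - 1) / Real.Gamma (1 - α)) s := by
  have h1 : HasDerivAt (fun s => r - s) (-1) s := by simpa using (hasDerivAt_id s).const_sub r
  have h2 := (h1.rpow_const (p := -α) (Or.inl (sub_pos.2 hs).ne')).div_const (Real.Gamma (1 - α))
  refine (h2.congr_deriv (by ring)).congr_of_eventuallyEq ?_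
  exact Filter.Eventually.of_forall fun x => memory_eq α r x

lemma memory_continuousOn (α r : ℝ) : ContinuousOn (memory α r) (Set.Iio r) := fun _ hs =>
  (memory_hasDerivAt α hs).continuousAt.continuousWithinAt

lemma memory_slope (hα0 : 0 < α) (hα1 : α < 1) {x y : ℝ} (hxy : x ≤ y) (hy : y < r) :
    α * (r - x) ^ (-α - 1) / Real.Gamma (1 - α) * (y - x) ≤ memory α r y - memory α r x ∧
    memory α r y - memory α r x ≤ α * (r - y) ^ (-α - 1) / Real.Gamma (1 - α) * (y - x) := by
  rcases hxy.eq_or_lt with rfl | hlt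
  · simp
  have hG : 0 < Real.Gamma (1 - α) := Real.Gamma_pos_of_pos (by linarith)
  obtain ⟨c, hc, hc'⟩ := exists_hasDerivAt_eq_slope (memory α r)
    (fun s => α * (r - s) ^ (-α - 1) / Real.Gamma (1 - α)) hlt
    ((memory_continuousOn α r).mono fun z hz => lt_of_le_of_lt hz.2 hy)
    (fun z hz => memory_hasDerivAt α (hz.2.trans hy))
  have hyx : 0 < y - x := sub_pos.2 hlt
  rw [eq_div_iff hyx.ne'] at hc'
  rw [← hc']
  have hcr : c < r := hc.2.trans hy
  constructor
  · refine mul_le_mul_of_nonneg_right ?_ hyx.le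
    gcongr ?_ / _
    refine mul_le_mul_of_nonneg_left (Real.rpow_le_rpow_of_nonpos (by linarith) (by linarith [hc.1])
      (by linarith)) hα0.le
  · refine mul_le_mul_of_nonneg_right ?_ hyx.le
    gcongr ?_ / _
    refine mul_le_mul_of_nonneg_left (Real.rpow_le_rpow_of_nonpos (by linarith) (by linarith [hc.2])
      (by linarith)) hα0.le

lemma memory_monotoneOn (hα0 : 0 < α) (hα1 : α < 1) : MonotoneOn (memory α r) (Set.Iio r) := by
  intro x hx y hy hxy
  have h := (memory_slope hα0 hα1 hxy hy).1
  have hG : 0 < Real.Gamma (1 - α) := Real.Gamma_pos_of_pos (by linarith)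
  have : 0 ≤ α * (r - x) ^ (-α - 1) / Real.Gamma (1 - α) * (y - x) := by
    have : 0 < r - x := sub_pos.2 hx
    have : 0 ≤ y - x := sub_nonneg.2 hxy
    positivity
  linarith

lemma memory_convexOn (hα0 : 0 < α) (hα1 : α < 1) : ConvexOn ℝ (Set.Iio r) (memory α r) := by
  refine MonotoneOn.convexOn_of_deriv (convex_Iio r) (memory_continuousOn α r) ?_ ?_
  · rw [interior_Iio]
    exact fun s hs => (memory_hasDerivAt α hs).differentiableAt.differentiableWithinAt
  · rw [interior_Iio]
    intro x hx y hy hxy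
    rw [(memory_hasDerivAt α hx).deriv, (memory_hasDerivAt α hy).deriv]
    have hG : 0 < Real.Gamma (1 - α) := Real.Gamma_pos_of_pos (by linarith)
    gcongr ?_ / _
    exact mul_le_mul_of_nonneg_left (Real.rpow_le_rpow_of_nonpos (sub_pos.2 hy) (by linarith)
      (by linarith)) hα0.le

lemma memory_intervalIntegrable (hα1 : α < 1) (r a b : ℝ) :
    IntervalIntegrable (memory α r) MeasureTheory.volume a b := by
  have h1 : IntervalIntegrable (fun x : ℝ => x ^ (-α)) MeasureTheory.volume (r - a) (r - b) :=
    intervalIntegral.intervalIntegrable_rpow' (by linarith)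
  have h2 := (h1.comp_sub_left r).div_const (Real.Gamma (1 - α))
  simp only [sub_sub_cancel] at h2
  have e : memory α r = fun s => (r - s) ^ (-α) / Real.Gamma (1 - α) := funext (memory_eq α r)
  rw [e]; exact h2

lemma memory_integral (hα1 : α < 1) (a : ℝ) :
    ∫ s in a..r, memory α r s = omega (2 - α) (r - a) := by
  simp_rw [memory_eq]
  rw [intervalIntegral.integral_comp_sub_left (fun x : ℝ => x ^ (-α) / Real.Gamma (1 - α)) r, intervalIntegral.integral_div,
    integral_rpow (Or.inl (by linarith)), sub_self, Real.zero_rpow (by linarith), omega,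
    show (2 : ℝ) - α = (1 - α) + 1 by ring, Real.Gamma_add_one (by linarith)]
  have : 0 < Real.Gamma (1 - α) := Real.Gamma_pos_of_pos (by linarith)
  have : 1 - α ≠ 0 := by linarith
  rw [show -α + 1 = 1 - α by ring, show 1 - α + 1 - 1 = 1 - α by ring]
  field_simp; ring

end

end TimeFracAllenCahn

end

noncomputable section

namespace TimeFracAllenCahn

/-! ### The Alikhanov kernel on meshes satisfying `M1` -/

lemma offset_eq_add (θ : ℝ) (t : ℕ → ℝ) (n : ℕ) :
    offset θ t n = t (n - 1) + (1 - θ) * step t n := by rw [offset, step]; ring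

lemma offset_eq_sub (θ : ℝ) (t : ℕ → ℝ) (n : ℕ) :
    offset θ t n = t n - θ * step t n := by rw [offset, step]; ring

section
variable {α T : ℝ} {N : ℕ} {t : ℕ → ℝ} {n k : ℕ}

lemma lt_offset (hα1 : α < 1) (hmesh : IsMesh T N t) (hn : 1 ≤ n) (hnN : n ≤ N) :
    t (n - 1) < offset (α / 2) t n := by
  rw [offset_eq_add]
  nlinarith [hmesh.step_pos hn hnN]

lemma offset_lt (hα0 : 0 < α) (hmesh : IsMesh T N t) (hn : 1 ≤ n) (hnN : n ≤ N) :
    offset (α / 2) t n < t n := by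
  rw [offset_eq_sub]
  nlinarith [hmesh.step_pos hn hnN]

lemma mesh_lt_offset (hα1 : α < 1) (hmesh : IsMesh T N t) (hkn : k < n) (hnN : n ≤ N) :
    t k < offset (α / 2) t n :=
  (hmesh.mono (by omega : k ≤ n - 1) (by omega)).trans_lt
    (lt_offset hα1 hmesh (by omega) hnN)

lemma kernelA_eq_avg (hα1 : α < 1) (hmesh : IsMesh T N t) (hkn : k < n) (hnN : n ≤ N) :
    kernelA α t n k = avg (memory α (offset (α / 2) t n)) (t (k - 1)) (t k) := by
  rw [kernelA, avg, min_eq_left (mesh_lt_offset hα1 hmesh hkn hnN).le]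
  rfl

lemma kernelA_diag (hα0 : 0 < α) (hα1 : α < 1) (hmesh : IsMesh T N t) (hn : 1 ≤ n)
    (hnN : n ≤ N) :
    kernelA α t n n = omega (2 - α) (1 - α / 2) * step t n ^ (-α) := by
  rw [kernelA, min_eq_right (offset_lt hα0 hmesh hn hnN).le]
  have h := memory_integral (r := offset (α / 2) t n) hα1 (t (n - 1))
  simp only [memory] at h
  have hs := hmesh.step_pos hn hnN
  rw [h, offset_eq_add, add_sub_cancel_left, omega, omega, Real.mul_rpow (by linarith) hs.le,
    show (2 : ℝ) - α - 1 = -α + 1 by ring, Real.rpow_add_one hs.ne']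
  field_simp

lemma kernelB_eq_moment (hmesh : IsMesh T N t) (hk : 1 ≤ k) (hkN : k + 1 ≤ N) :
    kernelB α t n k = 2 * step t k / (step t k + step t (k + 1))
      * moment (memory α (offset (α / 2) t n)) (t (k - 1)) (t k) := by
  have h1 := hmesh.step_pos hk (by omega)
  have h2 := hmesh.step_pos (by omega : 1 ≤ k + 1) hkN
  have e : offset (1 / 2) t k = (t (k - 1) + t k) / 2 := by rw [offset]; ring
  rw [kernelB, moment, e, ← step]
  simp only [memory]
  generalize ∫ s in (t (k - 1))..(t k), (s - (t (k - 1) + t k) / 2) *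
    omega (1 - α) (offset (α / 2) t n - s) = I
  field_simp

lemma memory_continuousOn_Icc (hα1 : α < 1) (hmesh : IsMesh T N t) (hkn : k < n) (hnN : n ≤ N) :
    ContinuousOn (memory α (offset (α / 2) t n)) (Set.Icc (t (k - 1)) (t k)) :=
  (memory_continuousOn _ _).mono fun _ hs =>
    lt_of_le_of_lt hs.2 (mesh_lt_offset hα1 hmesh hkn hnN)

lemma memory_monotoneOn_Icc (hα0 : 0 < α) (hα1 : α < 1) (hmesh : IsMesh T N t) (hkn : k < n)
    (hnN : n ≤ N) :
    MonotoneOn (memory α (offset (α / 2) t n)) (Set.Icc (t (k - 1)) (t k)) :=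
  (memory_monotoneOn hα0 hα1).mono fun _ hs =>
    lt_of_le_of_lt hs.2 (mesh_lt_offset hα1 hmesh hkn hnN)

lemma moment_memory_nonneg (hα0 : 0 < α) (hα1 : α < 1) (hmesh : IsMesh T N t) (hk : 1 ≤ k)
    (hkn : k < n) (hnN : n ≤ N) :
    0 ≤ moment (memory α (offset (α / 2) t n)) (t (k - 1)) (t k) :=
  moment_nonneg (hmesh.strict (by omega) (by omega)) (memory_continuousOn_Icc hα1 hmesh hkn hnN)
    (memory_monotoneOn_Icc hα0 hα1 hmesh hkn hnN)

lemma kernelB_nonneg (hα0 : 0 < α) (hα1 : α < 1) (hmesh : IsMesh T N t) (hk : 1 ≤ k)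
    (hkn : k < n) (hnN : n ≤ N) : 0 ≤ kernelB α t n k := by
  rw [kernelB_eq_moment hmesh hk (by omega)]
  have h1 := hmesh.step_pos hk (by omega)
  have h2 := hmesh.step_pos (by omega : 1 ≤ k + 1) (by omega)
  exact mul_nonneg (by positivity) (moment_memory_nonneg hα0 hα1 hmesh hk hkn hnN)

/-- The factor `2 ρ / (1 + ρ)` of the moment is at most `2`, so that subtracting `b` from `a`
leaves a mean value with a nonnegative weight. -/
lemma le_kernelA_sub_kernelB (hα0 : 0 < α) (hα1 : α < 1) (hmesh : IsMesh T N t)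
    (hk : 1 ≤ k) (hkn : k < n) (hnN : n ≤ N) :
    memory α (offset (α / 2) t n) (t (k - 1)) ≤ kernelA α t n k - kernelB α t n k := by
  rw [kernelA_eq_avg hα1 hmesh hkn hnN, kernelB_eq_moment hmesh hk (by omega)]
  have h1 := hmesh.step_pos hk (by omega)
  have h2 := hmesh.step_pos (by omega : 1 ≤ k + 1) (by omega)
  have hlt : t (k - 1) < t k := hmesh.strict (by omega) (by omega)
  refine le_avg_sub_moment hlt (memory_continuousOn_Icc hα1 hmesh hkn hnN) (fun s hs =>
    memory_monotoneOn_Icc hα0 hα1 hmesh hkn hnN (Set.left_mem_Icc.2 hlt.le) hs hs.1)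
    (by positivity) ?_
  rw [div_le_iff₀ (by positivity)]
  linarith

/-- By `M1` the factor `2 ρ / (1 + ρ)` of the moment is at most `14 / 11`, and the moment is at most
half the mean value; this leaves `1 - 7 / 11`. -/
lemma kernelA_sub_kernelB_ge (hα0 : 0 < α) (hα1 : α < 1) (hmesh : IsMesh T N t)
    (hM : CondM1 N t) (hk : 1 ≤ k) (hkn : k < n) (hnN : n ≤ N) :
    4 / 11 * kernelA α t n k ≤ kernelA α t n k - kernelB α t n k := by
  rw [kernelA_eq_avg hα1 hmesh hkn hnN, kernelB_eq_moment hmesh hk (by omega)]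
  have h1 := hmesh.step_pos hk (by omega)
  have h2 := hmesh.step_pos (by omega : 1 ≤ k + 1) (by omega)
  have hlt : t (k - 1) < t k := hmesh.strict (by omega) (by omega)
  have h3 := moment_le_half_avg hlt (memory_continuousOn_Icc hα1 hmesh hkn hnN) fun s hs =>
    memory_nonneg hα1 (hs.2.trans (mesh_lt_offset hα1 hmesh hkn hnN).le)
  have h4 : 2 * step t k / (step t k + step t (k + 1)) ≤ 14 / 11 := by
    rw [div_le_div_iff₀ (by positivity) (by norm_num)]
    have := hM.step_le hmesh hk (by omega)
    linarith
  have h5 := moment_memory_nonneg hα0 hα1 hmesh hk hkn hnN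
  nlinarith [mul_le_mul_of_nonneg_right h4 h5]

lemma memory_sub_le_memory_sub_kernelA (hα0 : 0 < α) (hα1 : α < 1) (hmesh : IsMesh T N t)
    (hk : 1 ≤ k) (hkn : k < n) (hnN : n ≤ N) :
    1 / 2 * (memory α (offset (α / 2) t n) (t k) - memory α (offset (α / 2) t n) (t (k - 1)))
      ≤ memory α (offset (α / 2) t n) (t k) - kernelA α t n k := by
  rw [kernelA_eq_avg hα1 hmesh hkn hnN]
  exact half_sub_le_sub_avg (hmesh.strict (by omega) (by omega))
    (memory_continuousOn_Icc hα1 hmesh hkn hnN)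
    ((memory_convexOn hα0 hα1).subset (fun _ hs =>
      lt_of_le_of_lt hs.2 (mesh_lt_offset hα1 hmesh hkn hnN)) (convex_Icc _ _))

/-- The moment over one interval is controlled by the deficit of the mean value over the next
interval: both are compared with the slope of the kernel at the common mesh point. The factor
`2 / 3` is what the bound `7 / 4` on the step ratios yields, as `(7/4)^3 / (1 + 7/4) ≤ 2`. -/
lemma ratio_mul_kernelB_le (hα0 : 0 < α) (hα1 : α < 1) (hmesh : IsMesh T N t)
    (hM : CondM1 N t) (hk : 2 ≤ k) (hkn : k < n) (hnN : n ≤ N) :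
    ratio t (k - 1) * kernelB α t n (k - 1)
      ≤ 2 / 3 * (memory α (offset (α / 2) t n) (t k) - kernelA α t n k) := by
  set r := offset (α / 2) t n with hr
  have hkr : t k < r := mesh_lt_offset hα1 hmesh hkn hnN
  have hlt : t (k - 1) < t k := hmesh.strict (by omega) (by omega)
  have hlt' : t (k - 1 - 1) < t (k - 1) := hmesh.strict (by omega) (by omega)
  set p := α * (r - t (k - 1)) ^ (-α - 1) / Real.Gamma (1 - α) with hp
  have hG : 0 < Real.Gamma (1 - α) := Real.Gamma_pos_of_pos (by linarith)
  have hr0 : 0 < r - t (k - 1) := by linarith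
  have hp0 : 0 ≤ p := by positivity
  have h1 : moment (memory α r) (t (k - 1 - 1)) (t (k - 1)) ≤ p * step t (k - 1) / 12 := by
    refine moment_le_of_slope hlt' (memory_continuousOn_Icc hα1 hmesh (by omega) hnN)
      fun x hx y hy hxy => ?_
    refine (memory_slope hα0 hα1 hxy (by linarith [hy.2])).2.trans ?_
    refine mul_le_mul_of_nonneg_right ?_ (by linarith)
    rw [hp]
    gcongr ?_ / _
    exact mul_le_mul_of_nonneg_left (Real.rpow_le_rpow_of_nonpos hr0 (by linarith [hy.2])
      (by linarith)) hα0.le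
  have h2 : 1 / 2 * (p * step t k) ≤ memory α r (t k) - kernelA α t n k := by
    rw [kernelA_eq_avg hα1 hmesh hkn hnN]
    refine half_mul_le_sub_avg hlt (memory_continuousOn_Icc hα1 hmesh hkn hnN) fun s hs => ?_
    refine le_trans (mul_le_mul_of_nonneg_right ?_ (by linarith [hs.2]))
      (memory_slope hα0 hα1 hs.2 hkr).1
    rw [hp]
    gcongr ?_ / _
    exact mul_le_mul_of_nonneg_left (Real.rpow_le_rpow_of_nonpos (by linarith [hs.2])
      (by linarith [hs.1]) (by linarith)) hα0.le
  have hB := kernelB_eq_moment (α := α) (n := n) hmesh (by omega : 1 ≤ k - 1) (by omega)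
  rw [show k - 1 + 1 = k by omega, ← hr] at hB
  have hx := hmesh.step_pos (by omega : 1 ≤ k - 1) (by omega)
  have hy := hmesh.step_pos (by omega : 1 ≤ k) (by omega)
  have hxy := hM.step_le hmesh (by omega : 1 ≤ k - 1) (by omega)
  rw [show k - 1 + 1 = k by omega] at hxy
  rw [hB, ratio, show k - 1 + 1 = k by omega]
  set x := step t (k - 1)
  set y := step t k
  calc x / y * (2 * x / (x + y) * moment (memory α r) (t (k - 1 - 1)) (t (k - 1)))
      ≤ x / y * (2 * x / (x + y) * (p * x / 12)) := by gcongr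
    _ = p * (x ^ 3 / (6 * y * (x + y))) := by field_simp; ring
    _ ≤ p * (y / 3) := by
        refine mul_le_mul_of_nonneg_left ?_ hp0
        rw [div_le_div_iff₀ (by positivity) (by norm_num)]
        have e1 : x ^ 2 ≤ (7 / 4 * y) ^ 2 := by gcongr
        nlinarith [mul_le_mul_of_nonneg_right e1 hx.le, mul_pos hy hy, mul_pos hx hy,
          mul_le_mul_of_nonneg_right hxy (mul_pos hy hy).le]
    _ = 2 / 3 * (1 / 2 * (p * y)) := by ring
    _ ≤ _ := by gcongr

/-- The increment `A_{n-k-1} - A_{n-k}` is compared with the value of the memory kernel at `t_k`,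
which separates the contribution of the `(k + 1)`-st interval from that of the `k`-th. Of the
latter, at least one half of the kernel variation, a share of `1 - 2 / 3` remains. -/
lemma kernel_succ_sub (hα0 : 0 < α) (hα1 : α < 1) (hmesh : IsMesh T N t)
    (hM : CondM1 N t) (hk : 1 ≤ k) (hkn : k < n) (hnN : n ≤ N) :
    (kernelA α t n (k + 1) - (if k + 1 < n then kernelB α t n (k + 1) else 0))
        - memory α (offset (α / 2) t n) (t k)
      + 1 / 6 * (memory α (offset (α / 2) t n) (t k) - memory α (offset (α / 2) t n) (t (k - 1)))
      ≤ kernel α t n (k + 1) - kernel α t n k := by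
  have h1 : (if 2 ≤ k then ratio t (k - 1) * kernelB α t n (k - 1) else 0)
      ≤ 2 / 3 * (memory α (offset (α / 2) t n) (t k) - kernelA α t n k) := by
    split_ifs with h
    · exact ratio_mul_kernelB_le hα0 hα1 hmesh hM h hkn hnN
    · have h2 := memory_sub_le_memory_sub_kernelA hα0 hα1 hmesh hk hkn hnN
      have h3 := memory_monotoneOn (r := offset (α / 2) t n) hα0 hα1
        (mesh_lt_offset hα1 hmesh (by omega : k - 1 < n) hnN) (mesh_lt_offset hα1 hmesh hkn hnN)
        (hmesh.mono (by omega : k - 1 ≤ k) (by omega))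
      linarith
  have h2 := memory_sub_le_memory_sub_kernelA hα0 hα1 hmesh hk hkn hnN
  have h3 := kernelB_nonneg hα0 hα1 hmesh hk hkn hnN
  have h4 : 0 ≤ ratio t k * kernelB α t n k :=
    mul_nonneg (div_nonneg (hmesh.step_pos hk (by omega)).le
      (hmesh.step_pos (by omega) (by omega)).le) h3
  rw [kernel, kernel, if_pos (by omega : 2 ≤ k + 1), Nat.add_sub_cancel, if_pos hkn]
  linarith

/-- The value of the memory kernel at `t_{n-1}` is the fraction `(1 - 2θ) / (1 - θ)` of its mean
value over the last, truncated interval. -/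
lemma memory_last (hα0 : 0 < α) (hα1 : α < 1) (hmesh : IsMesh T N t) (hn : 1 ≤ n) (hnN : n ≤ N) :
    memory α (offset (α / 2) t n) (t (n - 1))
      = (1 - α) / (1 - α / 2) * kernelA α t n n := by
  have hs := hmesh.step_pos hn hnN
  have hh : 0 < 1 - α / 2 := by linarith
  rw [kernelA_diag hα0 hα1 hmesh hn hnN, memory_eq, offset_eq_add, add_sub_cancel_left,
    Real.mul_rpow hh.le hs.le, omega, show (2 : ℝ) - α - 1 = -α + 1 by ring,
    Real.rpow_add_one hh.ne', show (2 : ℝ) - α = (1 - α) + 1 by ring,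
    Real.Gamma_add_one (by linarith)]
  have : 0 < Real.Gamma (1 - α) := Real.Gamma_pos_of_pos (by linarith)
  have : 1 - α ≠ 0 := by linarith
  have : 2 - α ≠ 0 := by linarith
  field_simp

lemma kernelA_diag_pos (hα0 : 0 < α) (hα1 : α < 1) (hmesh : IsMesh T N t) (hn : 1 ≤ n)
    (hnN : n ≤ N) : 0 < kernelA α t n n := by
  rw [kernelA_diag hα0 hα1 hmesh hn hnN, omega]
  have hs := hmesh.step_pos hn hnN
  have : 0 < Real.Gamma (2 - α) := Real.Gamma_pos_of_pos (by linarith)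
  have : 0 < 1 - α / 2 := by linarith
  positivity

lemma memory_last_le (hα0 : 0 < α) (hα1 : α < 1) (hmesh : IsMesh T N t) (hn : 1 ≤ n)
    (hnN : n ≤ N) : memory α (offset (α / 2) t n) (t (n - 1)) ≤ kernelA α t n n := by
  rw [memory_last hα0 hα1 hmesh hn hnN]
  have h := kernelA_diag_pos hα0 hα1 hmesh hn hnN
  have : (1 - α) / (1 - α / 2) ≤ 1 := by
    rw [div_le_one (by linarith)]; linarith
  nlinarith

/-- Strict monotonicity of the rows of the Alikhanov kernel, in a form that bounds the variation
of the memory kernel over a mesh interval. -/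
lemma memory_sub_le_kernel_sub (hα0 : 0 < α) (hα1 : α < 1) (hmesh : IsMesh T N t)
    (hM : CondM1 N t) (hk : 1 ≤ k) (hkn : k < n) (hnN : n ≤ N) :
    1 / 6 * (memory α (offset (α / 2) t n) (t k) - memory α (offset (α / 2) t n) (t (k - 1)))
      ≤ kernel α t n (k + 1) - kernel α t n k := by
  refine le_trans ?_ (kernel_succ_sub hα0 hα1 hmesh hM hk hkn hnN)
  have : memory α (offset (α / 2) t n) (t k)
      ≤ kernelA α t n (k + 1) - (if k + 1 < n then kernelB α t n (k + 1) else 0) := by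
    split_ifs with h
    · have := le_kernelA_sub_kernelB hα0 hα1 hmesh (by omega : 1 ≤ k + 1) h hnN
      rwa [Nat.add_sub_cancel] at this
    · obtain rfl : n = k + 1 := by omega
      have := memory_last_le hα0 hα1 hmesh (by omega : 1 ≤ k + 1) hnN
      rw [Nat.add_sub_cancel] at this
      linarith
  linarith

lemma memory_sub_nonneg (hα0 : 0 < α) (hα1 : α < 1) (hmesh : IsMesh T N t) (hkn : k < n)
    (hnN : n ≤ N) :
    0 ≤ memory α (offset (α / 2) t n) (t k) - memory α (offset (α / 2) t n) (t (k - 1)) :=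
  sub_nonneg.2 (memory_monotoneOn hα0 hα1 (mesh_lt_offset hα1 hmesh (by omega : k - 1 < n) hnN)
    (mesh_lt_offset hα1 hmesh hkn hnN) (hmesh.mono (by omega : k - 1 ≤ k) (by omega)))

lemma kernel_mono (hα0 : 0 < α) (hα1 : α < 1) (hmesh : IsMesh T N t)
    (hM : CondM1 N t) (hk : 1 ≤ k) (hkn : k < n) (hnN : n ≤ N) :
    kernel α t n k ≤ kernel α t n (k + 1) := by
  have := memory_sub_le_kernel_sub hα0 hα1 hmesh hM hk hkn hnN
  have := memory_sub_nonneg hα0 hα1 hmesh hkn hnN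
  linarith

/-- The gap between the two leading coefficients, which is what makes the explicit part of the
scheme monotone. -/
lemma kernel_diag_sub (hα0 : 0 < α) (hα1 : α < 1) (hmesh : IsMesh T N t)
    (hM : CondM1 N t) (hn : 2 ≤ n) (hnN : n ≤ N) :
    α / 2 / (1 - α / 2) * kernelA α t n n ≤ kernel α t n n - kernel α t n (n - 1) := by
  have h1 := kernel_succ_sub hα0 hα1 hmesh hM (by omega : 1 ≤ n - 1) (by omega : n - 1 < n) hnN
  have h2 := memory_sub_nonneg (n := n) (k := n - 1) hα0 hα1 hmesh (by omega) hnN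
  rw [show n - 1 + 1 = n by omega, if_neg (lt_irrefl n)] at h1
  have h3 := memory_last hα0 hα1 hmesh (by omega : 1 ≤ n) hnN
  have e : (1 - α) / (1 - α / 2) = 1 - α / 2 / (1 - α / 2) := by
    have : 2 - α ≠ 0 := by linarith
    have : (1 : ℝ) - α / 2 ≠ 0 := by linarith
    field_simp; ring
  rw [e] at h3
  linarith

lemma kernelA_le_kernel_diag (hα0 : 0 < α) (hα1 : α < 1) (hmesh : IsMesh T N t)
    (hnN : n ≤ N) : kernelA α t n n ≤ kernel α t n n := by
  rw [kernel, if_neg (lt_irrefl n)]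
  split_ifs with h
  · have h1 := kernelB_nonneg (n := n) (k := n - 1) hα0 hα1 hmesh (by omega) (by omega) hnN
    have h2 : 0 ≤ ratio t (n - 1) := div_nonneg (hmesh.step_pos (by omega) (by omega)).le
      (hmesh.step_pos (by omega) (by omega)).le
    nlinarith [mul_nonneg h2 h1]
  · linarith

/-- The correction `ρ b` of the leading coefficient is at most `(7 / 4) b_{1}`, and `b_{1}` is bounded
by `a_{1}`, which stays below the kernel value at `t_{n-1}`. -/
lemma kernel_diag_le (hα0 : 0 < α) (hα1 : α < 1) (hmesh : IsMesh T N t)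
    (hM : CondM1 N t) (hn : 1 ≤ n) (hnN : n ≤ N) :
    kernel α t n n ≤ 3 * kernelA α t n n := by
  rw [kernel, if_neg (lt_irrefl n)]
  have h0 := kernelA_diag_pos hα0 hα1 hmesh hn hnN
  split_ifs with h
  · have h1 := le_kernelA_sub_kernelB (n := n) (k := n - 1) hα0 hα1 hmesh (by omega) (by omega)
      hnN
    have h2 := memory_sub_le_memory_sub_kernelA (n := n) (k := n - 1) hα0 hα1 hmesh (by omega)
      (by omega) hnN
    have h3 := kernelA_sub_kernelB_ge (n := n) (k := n - 1) hα0 hα1 hmesh hM (by omega) (by omega)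
      hnN
    have h4 := memory_last_le hα0 hα1 hmesh hn hnN
    have h5 := hM (n - 1) (by omega) (by omega)
    have h6 := kernelB_nonneg (n := n) (k := n - 1) hα0 hα1 hmesh (by omega) (by omega) hnN
    have h7 := memory_sub_nonneg (n := n) (k := n - 1) hα0 hα1 hmesh (by omega) hnN
    have h8 := mul_le_mul_of_nonneg_right h5 h6
    linarith
  · linarith

lemma memory_le_kernelA (hα0 : 0 < α) (hα1 : α < 1) (hmesh : IsMesh T N t)
    (hk : 1 ≤ k) (hkn : k ≤ n) (hnN : n ≤ N) :
    memory α (offset (α / 2) t n) (t (k - 1)) ≤ kernelA α t n k := by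
  rcases hkn.eq_or_lt with rfl | hlt
  · exact memory_last_le hα0 hα1 hmesh hk hnN
  · rw [kernelA_eq_avg hα1 hmesh hlt hnN]
    have h : t (k - 1) < t k := hmesh.strict (by omega) (by omega)
    have := le_avg_sub_moment (c := 0) h (memory_continuousOn_Icc hα1 hmesh hlt hnN)
      (fun s hs => memory_monotoneOn_Icc hα0 hα1 hmesh hlt hnN (Set.left_mem_Icc.2 h.le) hs hs.1)
      le_rfl (by norm_num)
    linarith

/-- The discrete kernel is bounded below by a multiple of the continuous one, which yields the
singularity that the barrier argument needs. -/
lemma kernel_lower (hα0 : 0 < α) (hα1 : α < 1) (hmesh : IsMesh T N t)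
    (hM : CondM1 N t) (hk : 1 ≤ k) (hkn : k ≤ n) (hnN : n ≤ N) :
    4 / 11 / Real.Gamma (1 - α) * (t n - t (k - 1)) ^ (-α) ≤ kernel α t n k := by
  have hG : 0 < Real.Gamma (1 - α) := Real.Gamma_pos_of_pos (by linarith)
  have h1 : (t n - t (k - 1)) ^ (-α) / Real.Gamma (1 - α)
      ≤ memory α (offset (α / 2) t n) (t (k - 1)) := by
    rw [memory_eq]
    gcongr ?_ / _
    exact Real.rpow_le_rpow_of_nonpos
      (sub_pos.2 (mesh_lt_offset hα1 hmesh (by omega : k - 1 < n) hnN))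
      (by linarith [offset_lt hα0 hmesh (by omega : 1 ≤ n) hnN]) (by linarith)
  have h2 := memory_le_kernelA hα0 hα1 hmesh hk hkn hnN
  have h3 : 4 / 11 * kernelA α t n k ≤ kernel α t n k := by
    rcases hkn.eq_or_lt with rfl | hlt
    · have := kernelA_le_kernel_diag hα0 hα1 hmesh hnN
      have := kernelA_diag_pos hα0 hα1 hmesh hk hnN
      linarith
    · have h4 := kernelA_sub_kernelB_ge hα0 hα1 hmesh hM hk hlt hnN
      have h5 : 0 ≤ if 2 ≤ k then ratio t (k - 1) * kernelB α t n (k - 1) else 0 := by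
        split_ifs with h
        · exact mul_nonneg (div_nonneg (hmesh.step_pos (by omega) (by omega)).le
            (hmesh.step_pos (by omega) (by omega)).le)
            (kernelB_nonneg hα0 hα1 hmesh (by omega) (by omega) hnN)
        · exact le_rfl
      rw [kernel, if_pos hlt]
      linarith
  calc _ = 4 / 11 * ((t n - t (k - 1)) ^ (-α) / Real.Gamma (1 - α)) := by ring
    _ ≤ _ := by linarith

end

end TimeFracAllenCahn

end

noncomputable section

namespace TimeFracAllenCahn

/-! ### Consistency of the difference Laplacian for functions with bounded weak derivatives -/

open MeasureTheory Filter Topology ContinuousLinearMap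
open scoped Convolution ContDiff

/-- The unit vector in the `i`-th coordinate direction. -/
abbrev unitVec (i : Fin 2) : Plane := EuclideanSpace.single i 1

lemma SobolevBound.base {k : ℕ} {B : ℝ} {v : Plane → ℝ} (h : SobolevBound k B v) :
    AEStronglyMeasurable v ∧ ∀ᵐ x, |v x| ≤ B := by
  cases k with
  | zero => exact h
  | succ k => exact h.1

lemma SobolevBound.abs_apply_le {k : ℕ} {B : ℝ} {v : Plane → ℝ} (h : SobolevBound k B v)
    (hv : Continuous v) (x : Plane) : |v x| ≤ B := by
  have h1 : volume {x | ¬ |v x| ≤ B} = 0 := h.base.2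
  have h2 : IsOpen {x | ¬ |v x| ≤ B} := by
    simp only [not_le]; exact isOpen_lt continuous_const hv.abs
  by_contra hx
  have := (h2.measure_eq_zero_iff volume).1 h1
  exact this.subset hx

lemma SobolevBound.nonneg {k : ℕ} {B : ℝ} {v : Plane → ℝ} (h : SobolevBound k B v) : 0 ≤ B := by
  obtain ⟨x, hx⟩ := h.base.2.exists
  exact (abs_nonneg _).trans hx

lemma SobolevBound.locallyIntegrable {k : ℕ} {B : ℝ} {v : Plane → ℝ} (h : SobolevBound k B v) :
    LocallyIntegrable v := by
  have : MemLp v ⊤ := memLp_top_of_bound h.base.1 B h.base.2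
  exact this.locallyIntegrable le_top

/-- The regularization of `v` by a normalized bump function. -/
def mollify (φ : ContDiffBump (0 : Plane)) (v : Plane → ℝ) : Plane → ℝ :=
  φ.normed volume ⋆[lsmul ℝ ℝ, volume] v

lemma mollify_abs_le (φ : ContDiffBump (0 : Plane)) {k : ℕ} {B : ℝ} {v : Plane → ℝ}
    (h : SobolevBound k B v) (x : Plane) : |mollify φ v x| ≤ B := by
  rw [mollify, convolution_lsmul_swap]
  have hi : Integrable (fun t => φ.normed volume (x - t)) :=
    (φ.integrable_normed (μ := volume)).comp_sub_left x
  calc |∫ t, φ.normed volume (x - t) • v t|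
      ≤ ∫ t, φ.normed volume (x - t) * B := by
        rw [← Real.norm_eq_abs]
        refine norm_integral_le_of_norm_le (hi.mul_const B) ?_
        filter_upwards [h.base.2] with t ht
        rw [norm_smul, Real.norm_eq_abs, Real.norm_eq_abs, abs_of_nonneg (φ.nonneg_normed _)]
        exact mul_le_mul_of_nonneg_left ht (φ.nonneg_normed _)
    _ = B := by
        rw [integral_mul_const, integral_sub_left_eq_self (fun t => φ.normed volume t),
          φ.integral_normed, one_mul]

lemma hasFDerivAt_comp_const_sub {E : Type*} [NormedAddCommGroup E] [NormedSpace ℝ E] {ρ : E → ℝ}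
    (hρ : Differentiable ℝ ρ) (y t : E) :
    HasFDerivAt (fun t => ρ (y - t)) (-(fderiv ℝ ρ (y - t))) t := by
  have e1 : HasFDerivAt (fun t => y - t) (-(ContinuousLinearMap.id ℝ E)) t := by
    simpa using (hasFDerivAt_id t).const_sub y
  refine ((hρ (y - t)).hasFDerivAt.comp t e1).congr_fderiv ?_
  rw [ContinuousLinearMap.comp_neg, ContinuousLinearMap.comp_id]

lemma integral_fderiv_mul_eq {ρ : Plane → ℝ} (hρ : ContDiff ℝ (⊤ : ℕ∞) ρ)
    (hρc : HasCompactSupport ρ) {i : Fin 2} {v w : Plane → ℝ} (hw : IsWeakPartial i v w)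
    (y : Plane) :
    ∫ t, fderiv ℝ ρ (y - t) (unitVec i) * v t = ∫ t, ρ (y - t) * w t := by
  have h3 := hw (fun t => ρ (y - t)) (hρ.comp (contDiff_const.sub contDiff_id))
    (hρc.comp_homeomorph (Homeomorph.subLeft y))
  have h4 : ∀ t, fderiv ℝ (fun t => ρ (y - t)) t = -(fderiv ℝ ρ (y - t)) := fun t =>
    (hasFDerivAt_comp_const_sub (hρ.differentiable (by simp)) y t).fderiv
  simp only [h4, neg_apply, mul_neg, integral_neg, neg_inj] at h3
  simp_rw [mul_comm (ρ _), mul_comm _ (v _)]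
  exact h3

/-- Regularization turns weak partial derivatives into classical ones: the shifted kernel is
an admissible test function. -/
lemma convolution_hasDerivAt {ρ : Plane → ℝ} (hρ : ContDiff ℝ (⊤ : ℕ∞) ρ)
    (hρc : HasCompactSupport ρ) {i : Fin 2} {v w : Plane → ℝ}
    (hv : LocallyIntegrable v) (hw : IsWeakPartial i v w) (x : Plane) (r : ℝ) :
    HasDerivAt (fun r : ℝ => (ρ ⋆[lsmul ℝ ℝ, volume] v) (x + r • unitVec i))
      ((ρ ⋆[lsmul ℝ ℝ, volume] w) (x + r • unitVec i)) r := by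
  have hρ1 : ContDiff ℝ 1 ρ := hρ.of_le (by simp)
  have h1 := hρc.hasFDerivAt_convolution_left (lsmul ℝ ℝ) hρ1 hv (x + r • unitVec i)
  have hline : HasDerivAt (fun r : ℝ => x + r • unitVec i) (unitVec i) r := by
    simpa using ((hasDerivAt_id r).smul_const (unitVec i)).const_add x
  have h2 := h1.comp_hasDerivAt r hline
  refine h2.congr_deriv ?_
  have hint : Integrable (fun t => ((lsmul ℝ ℝ).precompL Plane)
      (fderiv ℝ ρ ((x + r • unitVec i) - t)) (v t)) :=
    ((hρc.fderiv ℝ).convolutionExists_left ((lsmul ℝ ℝ).precompL Plane)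
      (hρ1.continuous_fderiv one_ne_zero) hv (x + r • unitVec i)).integrable_swap
  rw [convolution_eq_swap, ContinuousLinearMap.integral_apply hint, convolution_lsmul_swap]
  simp only [precompL_apply, lsmul_apply, smul_eq_mul]
  exact integral_fderiv_mul_eq hρ hρc hw _

lemma mollify_hasDerivAt (φ : ContDiffBump (0 : Plane)) {i : Fin 2} {v w : Plane → ℝ}
    (hv : LocallyIntegrable v) (hw : IsWeakPartial i v w) (x : Plane) (r : ℝ) :
    HasDerivAt (fun r : ℝ => mollify φ v (x + r • unitVec i)) (mollify φ w (x + r • unitVec i))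
      r :=
  convolution_hasDerivAt (φ.contDiff_normed (n := ⊤)) φ.hasCompactSupport_normed hv hw x r

/-- A function with vanishing value and slope at `0` is controlled by its second derivative. -/
lemma abs_le_of_second_deriv {G G1 G2 : ℝ → ℝ} {C h : ℝ} (hh : 0 ≤ h)
    (hG : ∀ r, HasDerivAt G (G1 r) r) (hG1 : ∀ r, HasDerivAt G1 (G2 r) r)
    (h0 : G 0 = 0) (h1 : G1 0 = 0) (hC : ∀ r ∈ Set.Icc 0 h, |G2 r| ≤ C) :
    |G h| ≤ C * h ^ 2 := by
  have hC0 : 0 ≤ C := (abs_nonneg _).trans (hC 0 ⟨le_rfl, hh⟩)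
  have e1 : ∀ r ∈ Set.Icc 0 h, |G1 r| ≤ C * h := by
    intro r hr
    have := (convex_Icc 0 h).norm_image_sub_le_of_norm_hasDerivWithin_le (C := C)
      (fun x _ => (hG1 x).hasDerivWithinAt) hC (Set.left_mem_Icc.2 hh) hr
    rw [h1, sub_zero, sub_zero, Real.norm_eq_abs, Real.norm_eq_abs, abs_of_nonneg hr.1] at this
    exact this.trans (mul_le_mul_of_nonneg_left hr.2 hC0)
  have := (convex_Icc 0 h).norm_image_sub_le_of_norm_hasDerivWithin_le (C := C * h)
      (fun x _ => (hG x).hasDerivWithinAt) e1 (Set.left_mem_Icc.2 hh) (Set.right_mem_Icc.2 hh)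
  rw [h0, sub_zero, sub_zero, Real.norm_eq_abs, Real.norm_eq_abs, abs_of_nonneg hh] at this
  rw [pow_two, ← mul_assoc]; exact this

lemma abs_second_diff_sub_le {F F1 F2 : ℝ → ℝ} {C h c : ℝ} (hh : 0 ≤ h)
    (hF : ∀ r, HasDerivAt F (F1 r) r) (hF1 : ∀ r, HasDerivAt F1 (F2 r) r)
    (hC : ∀ r ∈ Set.Icc 0 h, |F2 r + F2 (-r) - 2 * c| ≤ C) :
    |F h - 2 * F 0 + F (-h) - h ^ 2 * c| ≤ C * h ^ 2 := by
  have hneg : ∀ r : ℝ, HasDerivAt (fun r => -r) (-1) r := fun r => (hasDerivAt_id r).neg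
  have := abs_le_of_second_deriv (G := fun r => F r - 2 * F 0 + F (-r) - r ^ 2 * c)
    (G1 := fun r => F1 r - F1 (-r) - 2 * r * c) (G2 := fun r => F2 r + F2 (-r) - 2 * c) hh ?_ ?_
    (by simp; ring) (by simp) hC
  · simpa using this
  · intro r
    have e1 := ((hF (-r)).comp r (hneg r))
    have e2 := (((hF r).sub_const (2 * F 0)).add e1).sub ((hasDerivAt_pow 2 r).mul_const c)
    refine e2.congr_deriv ?_
    simp; ring
  · intro r
    have e1 := ((hF1 (-r)).comp r (hneg r))
    have e2 := ((hF1 r).sub e1).sub (((hasDerivAt_id r).const_mul 2).mul_const c)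
    refine e2.congr_deriv ?_
    simp

/-- Restrictions of the regularized function to coordinate lines have as many bounded derivatives
as the function has bounded weak derivatives. -/
lemma SobolevBound.mollify_line {k : ℕ} {B : ℝ} {v : Plane → ℝ} (h : SobolevBound (k + 1) B v)
    (i : Fin 2) : ∃ w : Plane → ℝ, SobolevBound k B w ∧
      ∀ (φ : ContDiffBump (0 : Plane)) (x : Plane) (r : ℝ),
        HasDerivAt (fun r : ℝ => mollify φ v (x + r • unitVec i))
          (mollify φ w (x + r • unitVec i)) r := by
  obtain ⟨w, hw, hw'⟩ := h.2 i
  exact ⟨w, hw', fun φ x r => mollify_hasDerivAt φ h.locallyIntegrable hw x r⟩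

/-- The second difference `g (x + h e_i) - 2 g x + g (x - h e_i)`. -/
def secondDiff (g : Plane → ℝ) (i : Fin 2) (h : ℝ) (x : Plane) : ℝ :=
  g (x + h • unitVec i) - 2 * g x + g (x - h • unitVec i)

/-- Bump functions with shrinking supports. -/
lemma exists_bumps : ∃ φ : ℕ → ContDiffBump (0 : Plane),
    Tendsto (fun n => (φ n).rOut) atTop (𝓝 0) := by
  refine ⟨fun n => ⟨1 / (2 * ((n : ℝ) + 1)), 1 / ((n : ℝ) + 1), by positivity, ?_⟩,
    tendsto_one_div_add_atTop_nhds_zero_nat⟩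
  exact one_div_lt_one_div_of_lt (by positivity) (by linarith [(n.cast_nonneg : (0 : ℝ) ≤ n)])

lemma tendsto_secondDiff_mollify {φ : ℕ → ContDiffBump (0 : Plane)}
    (hφ : Tendsto (fun n => (φ n).rOut) atTop (𝓝 0)) {g : Plane → ℝ} (hg : Continuous g)
    (i : Fin 2) (h : ℝ) (x : Plane) :
    Tendsto (fun n => secondDiff (mollify (φ n) g) i h x) atTop (𝓝 (secondDiff g i h x)) := by
  have key : ∀ y, Tendsto (fun n => mollify (φ n) g y) atTop (𝓝 (g y)) := fun y =>
    ContDiffBump.convolution_tendsto_right_of_continuous hφ hg y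
  exact ((key _).sub ((key x).const_mul 2)).add (key _)

lemma secondDiff_mollify_line (φ : ContDiffBump (0 : Plane)) (g : Plane → ℝ) (i : Fin 2) (h : ℝ)
    (x : Plane) : secondDiff (mollify φ g) i h x
      = mollify φ g (x + h • unitVec i) - 2 * mollify φ g (x + (0 : ℝ) • unitVec i)
        + mollify φ g (x + (-h) • unitVec i) := by
  rw [secondDiff, zero_smul, add_zero, neg_smul, sub_eq_add_neg x]

lemma SobolevBound.abs_secondDiff_le {B : ℝ} {g : Plane → ℝ} (h : SobolevBound 2 B g)
    (hg : Continuous g) (i : Fin 2) {r : ℝ} (hr : 0 ≤ r) (x : Plane) :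
    |secondDiff g i r x| ≤ 2 * B * r ^ 2 := by
  obtain ⟨φ, hφ⟩ := exists_bumps
  obtain ⟨w1, hw1, hd1⟩ := h.mollify_line i
  obtain ⟨w2, hw2, hd2⟩ := hw1.mollify_line i
  refine le_of_tendsto (tendsto_secondDiff_mollify hφ hg i r x).abs
    (Eventually.of_forall fun n => ?_)
  have := abs_second_diff_sub_le (c := 0) (C := 2 * B) hr (hd1 (φ n) x) (hd2 (φ n) x)
    fun s _ => by
      have e1 := abs_le.1 (mollify_abs_le (φ n) hw2 (x + s • unitVec i))
      have e2 := abs_le.1 (mollify_abs_le (φ n) hw2 (x + (-s) • unitVec i))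
      rw [abs_le]; constructor <;> linarith
  rw [mul_zero, sub_zero] at this
  rwa [secondDiff_mollify_line]

/-- With four bounded weak derivatives, second difference quotients with different increments
agree up to the square of the increments. -/
lemma SobolevBound.abs_secondDiff_sub_le {B : ℝ} {g : Plane → ℝ} (h : SobolevBound 4 B g)
    (hg : Continuous g) (i : Fin 2) {r s : ℝ} (hr : 0 < r) (hs : 0 < s) (x : Plane) :
    |secondDiff g i r x / r ^ 2 - secondDiff g i s x / s ^ 2| ≤ 2 * B * (r ^ 2 + s ^ 2) := by
  obtain ⟨φ, hφ⟩ := exists_bumps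
  obtain ⟨w1, hw1, hd1⟩ := h.mollify_line i
  obtain ⟨w2, hw2, hd2⟩ := hw1.mollify_line i
  obtain ⟨w3, hw3, hd3⟩ := hw2.mollify_line i
  obtain ⟨w4, hw4, hd4⟩ := hw3.mollify_line i
  refine le_of_tendsto (((tendsto_secondDiff_mollify hφ hg i r x).div_const _).sub
    ((tendsto_secondDiff_mollify hφ hg i s x).div_const _)).abs
    (Eventually.of_forall fun n => ?_)
  -- For the regularized function, the second difference quotient approximates the second
  -- derivative, whose own second differences are bounded by the fourth derivative.
  have key : ∀ r : ℝ, 0 < r → |secondDiff (mollify (φ n) g) i r x / r ^ 2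
      - mollify (φ n) w2 x| ≤ 2 * B * r ^ 2 := by
    intro r hr
    have e := abs_second_diff_sub_le (c := mollify (φ n) w2 x) (C := 2 * B * r ^ 2) hr.le
      (hd1 (φ n) x) (hd2 (φ n) x) fun q hq => by
        have e0 := abs_second_diff_sub_le (c := 0) (C := 2 * B) hq.1
          (hd3 (φ n) x) (hd4 (φ n) x) fun s _ => by
            have e1 := abs_le.1 (mollify_abs_le (φ n) hw4 (x + s • unitVec i))
            have e2 := abs_le.1 (mollify_abs_le (φ n) hw4 (x + (-s) • unitVec i))
            rw [abs_le]; constructor <;> linarith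
        rw [mul_zero, sub_zero, zero_smul, add_zero] at e0
        have e3 : mollify (φ n) w2 (x + q • unitVec i) + mollify (φ n) w2 (x + (-q) • unitVec i)
            - 2 * mollify (φ n) w2 x = mollify (φ n) w2 (x + q • unitVec i)
            - 2 * mollify (φ n) w2 x + mollify (φ n) w2 (x + (-q) • unitVec i) := by ring
        rw [e3]
        refine e0.trans (mul_le_mul_of_nonneg_left (pow_le_pow_left₀ hq.1 hq.2 2) ?_)
        linarith [h.nonneg]
    rw [← secondDiff_mollify_line] at e
    have hr2 : 0 < r ^ 2 := by positivity
    rw [div_sub' hr2.ne', abs_div, abs_of_pos hr2, div_le_iff₀ hr2]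
    exact e
  have e1 := abs_le.1 (key r hr)
  have e2 := abs_le.1 (key s hs)
  rw [abs_le]; constructor <;> linarith

/-- Second difference quotients of a `C²` function converge to the second derivative. -/
lemma exists_secondDiff_near {g : Plane → ℝ} (hg : ContDiff ℝ 2 g) (i : Fin 2) (x : Plane)
    {η : ℝ} (hη : 0 < η) : ∃ s : ℝ, 0 < s ∧ s ≤ η ∧
      |secondDiff g i s x / s ^ 2 - iteratedFDeriv ℝ 2 g x ![unitVec i, unitVec i]| ≤ η := by
  have hg1 : ContDiff ℝ 1 (fderiv ℝ g) := hg.fderiv_right (by norm_num)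
  have hline : ∀ r : ℝ, HasDerivAt (fun r : ℝ => x + r • unitVec i) (unitVec i) r := fun r => by
    simpa using ((hasDerivAt_id r).smul_const (unitVec i)).const_add x
  set F2 : ℝ → ℝ := fun r => fderiv ℝ (fderiv ℝ g) (x + r • unitVec i) (unitVec i) (unitVec i)
    with hF2
  have hd1 : ∀ r : ℝ, HasDerivAt (fun r : ℝ => g (x + r • unitVec i))
      (fderiv ℝ g (x + r • unitVec i) (unitVec i)) r := fun r =>
    ((hg.differentiable two_ne_zero) _).hasFDerivAt.comp_hasDerivAt r (hline r)
  have hd2 : ∀ r : ℝ, HasDerivAt (fun r : ℝ => fderiv ℝ g (x + r • unitVec i) (unitVec i))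
      (F2 r) r := fun r => by
    have := ((hg1.differentiable one_ne_zero) _).hasFDerivAt.comp_hasDerivAt r (hline r)
    simpa using this.clm_apply (hasDerivAt_const r (unitVec i))
  have hcont : Continuous F2 := by
    have := hg1.continuous_fderiv one_ne_zero
    fun_prop
  have hlim : Tendsto (fun r => |F2 r + F2 (-r) - 2 * F2 0|) (𝓝 0) (𝓝 0) := by
    have : Continuous fun r => |F2 r + F2 (-r) - 2 * F2 0| := by fun_prop
    have h := this.tendsto 0
    have e : |F2 0 + F2 (-0) - 2 * F2 0| = 0 := by rw [neg_zero]; simp; ring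
    rwa [e] at h
  obtain ⟨δ, hδ, hball⟩ := Metric.eventually_nhds_iff.1 (hlim.eventually_le_const hη)
  refine ⟨min (δ / 2) η, by positivity, min_le_right _ _, ?_⟩
  set s := min (δ / 2) η with hs
  have hs0 : 0 < s := by positivity
  have hsδ : s ≤ δ / 2 := min_le_left _ _
  have e := abs_second_diff_sub_le (c := F2 0) (C := η) hs0.le hd1 hd2 fun q hq => by
    apply hball
    rw [Real.dist_eq, sub_zero, abs_of_nonneg hq.1]
    linarith [hq.2]
  have e1 : iteratedFDeriv ℝ 2 g x ![unitVec i, unitVec i] = F2 0 := by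
    rw [iteratedFDeriv_two_apply]; simp [hF2]
  have hs2 : 0 < s ^ 2 := by positivity
  rw [e1, div_sub' hs2.ne', abs_div, abs_of_pos hs2, div_le_iff₀ hs2, secondDiff, sub_eq_add_neg x,
    ← neg_smul]
  simpa using e

/-- The limit of vanishing second increment in `SobolevBound.abs_secondDiff_sub_le`. -/
lemma SobolevBound.abs_secondDiff_sub_deriv_le {B : ℝ} {g : Plane → ℝ} (h : SobolevBound 4 B g)
    (hg : ContDiff ℝ 2 g) (i : Fin 2) {r : ℝ} (hr : 0 < r) (x : Plane) :
    |secondDiff g i r x / r ^ 2 - iteratedFDeriv ℝ 2 g x ![unitVec i, unitVec i]|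
      ≤ 2 * B * r ^ 2 := by
  have hB := h.nonneg
  have hlim : Tendsto (fun η : ℝ => 2 * B * (r ^ 2 + η ^ 2) + η) (𝓝[>] 0) (𝓝 (2 * B * r ^ 2)) := by
    have : Continuous fun η : ℝ => 2 * B * (r ^ 2 + η ^ 2) + η := by fun_prop
    have h := (this.tendsto 0).mono_left (nhdsWithin_le_nhds (s := Set.Ioi 0))
    simpa using h
  refine ge_of_tendsto hlim ?_
  filter_upwards [self_mem_nhdsWithin] with η hη
  obtain ⟨s, hs0, hsη, hs⟩ := exists_secondDiff_near hg i x hη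
  have h1 := h.abs_secondDiff_sub_le hg.continuous i hr hs0 x
  have h2 : s ^ 2 ≤ η ^ 2 := pow_le_pow_left₀ hs0.le hsη 2
  have h3 := abs_sub_le (secondDiff g i r x / r ^ 2) (secondDiff g i s x / s ^ 2)
    (iteratedFDeriv ℝ 2 g x ![unitVec i, unitVec i])
  nlinarith [mul_le_mul_of_nonneg_left h2 hB]

/-- The five-point difference operator on functions of the plane. -/
def fivePoint (h : ℝ) (g : Plane → ℝ) (x : Plane) : ℝ :=
  (secondDiff g 0 h x + secondDiff g 1 h x) / h ^ 2

lemma SobolevBound.abs_fivePoint_sub_laplacian_le {B : ℝ} {g : Plane → ℝ}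
    (h : SobolevBound 4 B g) (hg : ContDiff ℝ 2 g) {r : ℝ} (hr : 0 < r) (x : Plane) :
    |fivePoint r g x - Laplacian.laplacian g x| ≤ 4 * B * r ^ 2 := by
  have e : Laplacian.laplacian g x = ∑ i, iteratedFDeriv ℝ 2 g x ![unitVec i, unitVec i] := by
    rw [InnerProductSpace.laplacian_eq_iteratedFDeriv_orthonormalBasis g
      (EuclideanSpace.basisFun (Fin 2) ℝ)]
    simp [unitVec]
  rw [e, Fin.sum_univ_two, fivePoint, add_div]
  have h0 := abs_le.1 (h.abs_secondDiff_sub_deriv_le hg 0 hr x)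
  have h1 := abs_le.1 (h.abs_secondDiff_sub_deriv_le hg 1 hr x)
  rw [abs_le]; constructor <;> linarith

lemma SobolevBound.abs_fivePoint_le {B : ℝ} {g : Plane → ℝ} (h : SobolevBound 2 B g)
    (hg : Continuous g) {r : ℝ} (hr : 0 < r) (x : Plane) : |fivePoint r g x| ≤ 4 * B := by
  have h0 := abs_le.1 (h.abs_secondDiff_le hg 0 hr.le x)
  have h1 := abs_le.1 (h.abs_secondDiff_le hg 1 hr.le x)
  have hr2 : 0 < r ^ 2 := by positivity
  rw [fivePoint, abs_div, abs_of_pos hr2, div_le_iff₀ hr2, abs_le]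
  constructor <;> linarith

end TimeFracAllenCahn

end

noncomputable section

namespace TimeFracAllenCahn

/-! ### Interpolation errors of functions with an initial singularity -/

open MeasureTheory

/-- The function `v` of time is continuous on `[0, T]` and three times differentiable inside, with
derivatives `d₁, d₂, d₃` that grow at most like `K s^(σ-ℓ)` as `s → 0`. -/
structure TimeRegular (σ K T : ℝ) (v d₁ d₂ d₃ : ℝ → ℝ) : Prop where
  cont : ContinuousOn v (Set.Icc 0 T)
  hasDeriv₁ : ∀ s ∈ Set.Ioo 0 T, HasDerivAt v (d₁ s) s
  hasDeriv₂ : ∀ s ∈ Set.Ioo 0 T, HasDerivAt d₁ (d₂ s) s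
  hasDeriv₃ : ∀ s ∈ Set.Ioo 0 T, HasDerivAt d₂ (d₃ s) s
  bound₁ : ∀ s ∈ Set.Ioo 0 T, |d₁ s| ≤ K * s ^ (σ - 1)
  bound₃ : ∀ s ∈ Set.Ioo 0 T, |d₃ s| ≤ K * s ^ (σ - 3)

/-- The variation of a function whose derivative is bounded by `K s^(σ-1)`, from the initial
singularity on. -/
lemma abs_sub_le_rpow {σ K T : ℝ} {v d : ℝ → ℝ} (hσ0 : 0 < σ)
    (hv : ContinuousOn v (Set.Icc 0 T)) (hd : ∀ s ∈ Set.Ioo 0 T, HasDerivAt v (d s) s)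
    (hb : ∀ s ∈ Set.Ioo 0 T, |d s| ≤ K * s ^ (σ - 1)) {a b : ℝ} (ha : 0 ≤ a) (hab : a ≤ b)
    (hb' : b ≤ T) : |v b - v a| ≤ K / σ * b ^ σ - K / σ * a ^ σ := by
  have hp : ∀ s ∈ Set.Ioo 0 T, HasDerivAt (fun s : ℝ => K / σ * s ^ σ) (K * s ^ (σ - 1)) s := by
    intro s hs
    have := (Real.hasDerivAt_rpow_const (p := σ) (Or.inl hs.1.ne')).const_mul (K / σ)
    refine this.congr_deriv ?_
    field_simp
  have hpc : ContinuousOn (fun s : ℝ => K / σ * s ^ σ) (Set.Icc 0 T) :=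
    (continuousOn_const.mul (continuousOn_id.rpow_const fun x _ => Or.inr hσ0.le))
  have m1 : MonotoneOn (fun s => K / σ * s ^ σ - v s) (Set.Icc 0 T) := by
    refine monotoneOn_of_deriv_nonneg (convex_Icc 0 T) (hpc.sub hv) ?_ ?_
    · rw [interior_Icc]
      exact fun s hs => ((hp s hs).sub (hd s hs)).differentiableAt.differentiableWithinAt
    · rw [interior_Icc]
      intro s hs
      have := ((hp s hs).sub (hd s hs)).deriv
      rw [show (fun s => K / σ * s ^ σ - v s) = (fun s => K / σ * s ^ σ) - v from rfl, this]
      linarith [(abs_le.1 (hb s hs)).2]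
  have m2 : MonotoneOn (fun s => K / σ * s ^ σ + v s) (Set.Icc 0 T) := by
    refine monotoneOn_of_deriv_nonneg (convex_Icc 0 T) (hpc.add hv) ?_ ?_
    · rw [interior_Icc]
      exact fun s hs => ((hp s hs).add (hd s hs)).differentiableAt.differentiableWithinAt
    · rw [interior_Icc]
      intro s hs
      have := ((hp s hs).add (hd s hs)).deriv
      rw [show (fun s => K / σ * s ^ σ + v s) = (fun s => K / σ * s ^ σ) + v from rfl, this]
      linarith [(abs_le.1 (hb s hs)).1]
  have hA : a ∈ Set.Icc 0 T := ⟨ha, hab.trans hb'⟩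
  have hB : b ∈ Set.Icc 0 T := ⟨ha.trans hab, hb'⟩
  have h1 := m1 hA hB hab
  have h2 := m2 hA hB hab
  simp only at h1 h2
  rw [abs_le]; constructor <;> linarith

/-- The variation of a function whose derivative is bounded by `K s^(σ-1)`, away from the initial
singularity. -/
lemma abs_sub_le_mul {σ K T : ℝ} {v d : ℝ → ℝ} (hσ1 : σ < 1)
    (hv : ContinuousOn v (Set.Icc 0 T)) (hd : ∀ s ∈ Set.Ioo 0 T, HasDerivAt v (d s) s)
    (hb : ∀ s ∈ Set.Ioo 0 T, |d s| ≤ K * s ^ (σ - 1)) (hK : 0 ≤ K) {a b : ℝ} (ha : 0 < a)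
    (hab : a ≤ b) (hb' : b ≤ T) : |v b - v a| ≤ K * a ^ (σ - 1) * (b - a) := by
  rcases hab.eq_or_lt with rfl | hlt
  · simp
  obtain ⟨c, hc, hc'⟩ := exists_hasDerivAt_eq_slope v d hlt
    (hv.mono (Set.Icc_subset_Icc ha.le hb')) fun s hs => hd s ⟨ha.trans hs.1, hs.2.trans_le hb'⟩
  rw [eq_div_iff (sub_pos.2 hlt).ne'] at hc'
  rw [← hc', abs_mul, abs_of_pos (sub_pos.2 hlt)]
  refine mul_le_mul_of_nonneg_right ?_ (sub_pos.2 hlt).le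
  refine (hb c ⟨ha.trans hc.1, hc.2.trans_le hb'⟩).trans (mul_le_mul_of_nonneg_left ?_ hK)
  exact Real.rpow_le_rpow_of_nonpos ha hc.1.le (by linarith)

lemma abs_sub_le_of_hasDerivAt_Ioo {f f' : ℝ → ℝ} {a b C : ℝ}
    (hf : ∀ s ∈ Set.Ioo a b, HasDerivAt f (f' s) s) (hC : ∀ s ∈ Set.Ioo a b, |f' s| ≤ C)
    {x y : ℝ} (hx : x ∈ Set.Ioo a b) (hy : y ∈ Set.Ioo a b) : |f x - f y| ≤ C * (b - a) := by
  have h := (convex_Ioo a b).norm_image_sub_le_of_norm_hasDerivWithin_le (C := C)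
    (fun s hs => (hf s hs).hasDerivWithinAt) hC hy hx
  rw [Real.norm_eq_abs, Real.norm_eq_abs] at h
  refine h.trans (mul_le_mul_of_nonneg_left ?_ ((abs_nonneg _).trans (hC x hx)))
  rw [abs_le]; constructor <;> linarith [hx.1, hx.2, hy.1, hy.2]

/-- The slope of the error of quadratic interpolation at `a < b < c`, by Rolle's theorem. -/
lemma abs_deriv_le_of_three_zeros {e e₁ e₂ e₃ : ℝ → ℝ} {a b c M : ℝ} (hab : a < b) (hbc : b < c)
    (he : ContinuousOn e (Set.Icc a c)) (h1 : ∀ s ∈ Set.Ioo a c, HasDerivAt e (e₁ s) s)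
    (h2 : ∀ s ∈ Set.Ioo a c, HasDerivAt e₁ (e₂ s) s)
    (h3 : ∀ s ∈ Set.Ioo a c, HasDerivAt e₂ (e₃ s) s) (hM : ∀ s ∈ Set.Ioo a c, |e₃ s| ≤ M)
    (ha : e a = 0) (hb : e b = 0) (hc : e c = 0) {s : ℝ} (hs : s ∈ Set.Ioo a b) :
    |e₁ s| ≤ M * (c - a) * (b - a) := by
  -- Two zeros `ξ`, `ζ` of the slope and one zero `η` of the second derivative.
  obtain ⟨ξ, hξ, hξ'⟩ := exists_hasDerivAt_eq_zero hab
    (he.mono (Set.Icc_subset_Icc le_rfl hbc.le)) (ha.trans hb.symm)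
    fun x hx => h1 x ⟨hx.1, hx.2.trans hbc⟩
  obtain ⟨ζ, hζ, hζ'⟩ := exists_hasDerivAt_eq_zero hbc
    (he.mono (Set.Icc_subset_Icc hab.le le_rfl)) (hb.trans hc.symm)
    fun x hx => h1 x ⟨hab.trans hx.1, hx.2⟩
  have hsub : Set.Icc ξ ζ ⊆ Set.Ioo a c := fun x hx =>
    ⟨hξ.1.trans_le hx.1, hx.2.trans_lt hζ.2⟩
  obtain ⟨η, hη, hη'⟩ := exists_hasDerivAt_eq_zero (hξ.2.trans hζ.1)
    (fun x hx => (h2 x (hsub hx)).continuousAt.continuousWithinAt) (hξ'.trans hζ'.symm)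
    fun x hx => h2 x (hsub (Set.Ioo_subset_Icc_self hx))
  have hηm : η ∈ Set.Ioo a c := hsub (Set.Ioo_subset_Icc_self hη)
  have b2 : ∀ x ∈ Set.Ioo a c, |e₂ x| ≤ M * (c - a) := fun x hx => by
    have := abs_sub_le_of_hasDerivAt_Ioo h3 hM hx hηm
    rwa [hη', sub_zero] at this
  have := abs_sub_le_of_hasDerivAt_Ioo (a := a) (b := b)
    (fun x hx => h2 x ⟨hx.1, hx.2.trans hbc⟩) (fun x hx => b2 x ⟨hx.1, hx.2.trans hbc⟩) hs hξ
  rwa [hξ', sub_zero] at this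

/-- The slope of the error of linear interpolation is, up to second order, a multiple of the
distance to the midpoint. -/
lemma exists_abs_deriv_sub_le_of_two_zeros {e e₁ e₂ e₃ : ℝ → ℝ} {a b M : ℝ} (hab : a < b)
    (he : ContinuousOn e (Set.Icc a b)) (h1 : ∀ s ∈ Set.Ioo a b, HasDerivAt e (e₁ s) s)
    (h2 : ∀ s ∈ Set.Ioo a b, HasDerivAt e₁ (e₂ s) s)
    (h3 : ∀ s ∈ Set.Ioo a b, HasDerivAt e₂ (e₃ s) s) (hM : ∀ s ∈ Set.Ioo a b, |e₃ s| ≤ M)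
    (ha : e a = 0) (hb : e b = 0) :
    ∃ c : ℝ, ∀ s ∈ Set.Ioo a b, |e₁ s - c * (s - (a + b) / 2)| ≤ M * (b - a) * (b - a) := by
  set m := (a + b) / 2 with hm
  have hmm : m ∈ Set.Ioo a b := ⟨by linarith, by linarith⟩
  -- Subtracting the parabola with the same zeros and curvature `e₂ m` leaves a function whose
  -- second derivative is small.
  refine ⟨e₂ m, ?_⟩
  have hQ : ∀ s ∈ Set.Ioo a b, HasDerivAt (fun s => e s - e₂ m * ((s - a) * (s - b) / 2))
      (e₁ s - e₂ m * (s - m)) s := by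
    intro s hs
    have e1 := (((hasDerivAt_id s).sub_const a).mul ((hasDerivAt_id s).sub_const b)).div_const 2
    refine ((h1 s hs).sub (e1.const_mul (e₂ m))).congr_deriv ?_
    simp only [id, hm]; ring
  have hQ1 : ∀ s ∈ Set.Ioo a b, HasDerivAt (fun s => e₁ s - e₂ m * (s - m)) (e₂ s - e₂ m) s := by
    intro s hs
    refine ((h2 s hs).sub (((hasDerivAt_id s).sub_const m).const_mul (e₂ m))).congr_deriv ?_
    simp
  obtain ⟨ξ, hξ, hξ'⟩ := exists_hasDerivAt_eq_zero hab
    (f := fun s => e s - e₂ m * ((s - a) * (s - b) / 2))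
    (he.sub (by fun_prop)) (by simp [ha, hb]) hQ
  intro s hs
  have := abs_sub_le_of_hasDerivAt_Ioo hQ1
    (fun x hx => abs_sub_le_of_hasDerivAt_Ioo h3 hM hx hmm) hs hξ
  rwa [hξ', sub_zero] at this

lemma ae_ne_real (b : ℝ) : ∀ᵐ s : ℝ, s ≠ b := by
  have : volume ({b} : Set ℝ) = 0 := by simp
  exact (measure_eq_zero_iff_ae_notMem.1 this).mono fun s hs h => hs (by simp [h])

/-- An integrand of mean zero sees only the variation of a monotone weight. -/
lemma abs_integral_mul_le_of_integral_eq_zero {f w m : ℝ → ℝ} {a b G : ℝ} (hab : a < b)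
    (hf : ContinuousOn f (Set.Icc a b)) (hmono : MonotoneOn f (Set.Icc a b))
    (hw : IntervalIntegrable w volume a b) (hw0 : ∫ s in a..b, w s = 0)
    (hm : IntervalIntegrable m volume a b) (hwm : ∀ s ∈ Set.Ioo a b, |w s| ≤ m s)
    (hG : ∫ s in a..b, m s ≤ G) : |∫ s in a..b, f s * w s| ≤ (f b - f a) * G := by
  have hfb : 0 ≤ f b - f a :=
    sub_nonneg.2 (hmono (Set.left_mem_Icc.2 hab.le) (Set.right_mem_Icc.2 hab.le) hab.le)
  have hfw : IntervalIntegrable (fun s => f s * w s) volume a b :=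
    hw.continuousOn_mul (by rwa [Set.uIcc_of_le hab.le])
  have e : ∫ s in a..b, f s * w s = ∫ s in a..b, (f s - f a) * w s := by
    simp_rw [sub_mul]
    rw [intervalIntegral.integral_sub hfw (hw.const_mul _), intervalIntegral.integral_const_mul,
      hw0, mul_zero, sub_zero]
  rw [e, ← Real.norm_eq_abs]
  refine le_trans ?_ (mul_le_mul_of_nonneg_left hG hfb)
  rw [← intervalIntegral.integral_const_mul]
  refine intervalIntegral.norm_integral_le_of_norm_le hab.le ?_ (hm.const_mul _)
  filter_upwards [ae_ne_real b] with s hsb hs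
  have hs' : s ∈ Set.Ioo a b := ⟨hs.1, lt_of_le_of_ne hs.2 hsb⟩
  rw [Real.norm_eq_abs, abs_mul]
  have hfs : 0 ≤ f s - f a := sub_nonneg.2
    (hmono (Set.left_mem_Icc.2 hab.le) (Set.Ioo_subset_Icc_self hs') hs'.1.le)
  have hfs' : f s ≤ f b :=
    hmono (Set.Ioo_subset_Icc_self hs') (Set.right_mem_Icc.2 hab.le) hs'.2.le
  rw [abs_of_nonneg hfs]
  exact mul_le_mul (by linarith) (hwm s hs') (abs_nonneg _) hfb

/-- The choice `θ = α / 2` makes linear polynomials that vanish at the midpoint of the last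
interval invisible to the memory kernel. -/
lemma integral_memory_mul_sub_mid {α a b r : ℝ} (hα1 : α < 1)
    (hab : a < b) (hr : r = a + (1 - α / 2) * (b - a)) :
    ∫ s in a..r, memory α r s * (s - (a + b) / 2) = 0 := by
  have har : 0 < r - a := by rw [hr]; nlinarith
  have hG : Real.Gamma (1 - α) ≠ 0 := (Real.Gamma_pos_of_pos (by linarith)).ne'
  have e : ∀ s ∈ Set.uIcc a r, memory α r s * (s - (a + b) / 2)
      = (fun x : ℝ => ((r - (a + b) / 2) * x ^ (-α) - x ^ (1 - α)) / Real.Gamma (1 - α))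
        (r - s) := by
    intro s hs
    rw [Set.uIcc_of_le (by linarith)] at hs
    have hx : 0 ≤ r - s := sub_nonneg.2 hs.2
    simp only [memory_eq]
    rw [show (1 : ℝ) - α = -α + 1 by ring, Real.rpow_add_one' hx (by linarith)]
    ring
  rw [intervalIntegral.integral_congr e, intervalIntegral.integral_comp_sub_left
    (fun x : ℝ => ((r - (a + b) / 2) * x ^ (-α) - x ^ (1 - α)) / Real.Gamma (1 - α)) r,
    intervalIntegral.integral_div, intervalIntegral.integral_sub
      ((intervalIntegral.intervalIntegrable_rpow' (by linarith)).const_mul _)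
      (intervalIntegral.intervalIntegrable_rpow' (by linarith)),
    intervalIntegral.integral_const_mul, integral_rpow (Or.inl (by linarith)),
    integral_rpow (Or.inl (by linarith)), sub_self, Real.zero_rpow (by linarith),
    Real.zero_rpow (by linarith), show 1 - α + 1 = (-α + 1) + 1 by ring,
    Real.rpow_add_one har.ne' (-α + 1)]
  have h1 : -α + 1 ≠ 0 := by linarith
  have h2 : -α + 1 + 1 ≠ 0 := by linarith
  have h3 : r - (a + b) / 2 = (1 - α) / 2 * (b - a) := by rw [hr]; ring
  have h4 : r - a = (1 - α / 2) * (b - a) := by rw [hr]; ring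
  have : (1 - α) / 2 * (b - a) * (((r - a) ^ (-α + 1) - 0) / (-α + 1))
      - ((r - a) ^ (-α + 1) * (r - a) - 0) / (-α + 1 + 1) = 0 := by
    rw [show ((r - a) ^ (-α + 1) * (r - a)) = (r - a) ^ (-α + 1) * ((1 - α / 2) * (b - a)) by
      rw [← h4]]
    generalize (r - a) ^ (-α + 1) = X
    field_simp; ring
  rw [h3, this, zero_div]

end TimeFracAllenCahn

end

noncomputable section

namespace TimeFracAllenCahn

open MeasureTheory

/-! ### The Alikhanov formula as the Caputo derivative of an interpolant -/

/-- The difference quotient of `v` over the `k`-th mesh interval. -/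
def slope (t : ℕ → ℝ) (v : ℝ → ℝ) (k : ℕ) : ℝ := (v (t k) - v (t (k - 1))) / step t k

/-- The derivative on the `k`-th mesh interval of the quadratic that interpolates `v` at
`t_{k-1}, t_k, t_{k+1}`. -/
def quadSlope (t : ℕ → ℝ) (v : ℝ → ℝ) (k : ℕ) (s : ℝ) : ℝ :=
  slope t v k + 2 * (s - (t (k - 1) + t k) / 2) / (step t k + step t (k + 1))
    * (slope t v (k + 1) - slope t v k)

open Finset in
/-- Both contributions of the moment `b_{n-k}` collected at the index `k`, where they form the second
divided difference. -/
lemma discreteCaputo_regroup (α : ℝ) (t w : ℕ → ℝ) {n : ℕ} (hn : 1 ≤ n) :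
    discreteCaputo α t w n
      = ∑ k ∈ Ico 1 n, (kernelA α t n k * (w k - w (k - 1))
          + kernelB α t n k * (ratio t k * (w (k + 1) - w k) - (w k - w (k - 1))))
        + kernelA α t n n * (w n - w (n - 1)) := by
  have h1 : ∑ k ∈ Icc 1 n, (if k < n then kernelB α t n k else 0) * (w k - w (k - 1))
      = ∑ k ∈ Ico 1 n, kernelB α t n k * (w k - w (k - 1)) := by
    obtain ⟨m, rfl⟩ : ∃ m, n = m + 1 := ⟨n - 1, by omega⟩
    rw [Finset.sum_Icc_succ_top (by omega), if_neg (lt_irrefl _), zero_mul, add_zero]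
    refine sum_congr (by ext; simp) fun k hk => ?_
    rw [mem_Ico] at hk
    rw [if_pos hk.2]
  have h2 : ∀ m, 1 ≤ m → ∑ k ∈ Icc 1 m, (kernelA α t n k
        + (if 2 ≤ k then ratio t (k - 1) * kernelB α t n (k - 1) else 0)) * (w k - w (k - 1))
      = ∑ k ∈ Ico 1 m, (kernelA α t n k * (w k - w (k - 1))
          + ratio t k * kernelB α t n k * (w (k + 1) - w k))
        + kernelA α t n m * (w m - w (m - 1)) := by
    intro m hm
    induction m, hm using Nat.le_induction with
    | base => simp
    | succ m hm ih =>
      rw [Finset.sum_Icc_succ_top (by omega), ih, Finset.sum_Ico_succ_top hm,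
        if_pos (by omega : 2 ≤ m + 1)]
      simp only [Nat.add_sub_cancel]
      ring
  have h3 : discreteCaputo α t w n = ∑ k ∈ Icc 1 n, (kernelA α t n k
        + (if 2 ≤ k then ratio t (k - 1) * kernelB α t n (k - 1) else 0)) * (w k - w (k - 1))
      - ∑ k ∈ Icc 1 n, (if k < n then kernelB α t n k else 0) * (w k - w (k - 1)) := by
    rw [discreteCaputo, ← sum_sub_distrib]
    exact sum_congr rfl fun k _ => by rw [kernel]; ring
  have h4 : ∑ k ∈ Ico 1 n, (kernelA α t n k * (w k - w (k - 1))
          + kernelB α t n k * (ratio t k * (w (k + 1) - w k) - (w k - w (k - 1))))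
      = ∑ k ∈ Ico 1 n, (kernelA α t n k * (w k - w (k - 1))
          + ratio t k * kernelB α t n k * (w (k + 1) - w k))
        - ∑ k ∈ Ico 1 n, kernelB α t n k * (w k - w (k - 1)) := by
    rw [← sum_sub_distrib]
    exact sum_congr rfl fun k _ => by ring
  rw [h3, h1, h2 n hn, h4]; ring

section
variable {α T : ℝ} {N : ℕ} {t : ℕ → ℝ} {n k : ℕ}

lemma memory_mul_intervalIntegrable (hα1 : α < 1) (hmesh : IsMesh T N t) (hk : 1 ≤ k)
    (hkn : k < n) (hnN : n ≤ N) {w : ℝ → ℝ} (hw : IntervalIntegrable w volume (t (k - 1)) (t k)) :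
    IntervalIntegrable (fun s => memory α (offset (α / 2) t n) s * w s) volume
      (t (k - 1)) (t k) := by
  refine hw.continuousOn_mul ?_
  rw [Set.uIcc_of_le (hmesh.mono (by omega) (by omega))]
  exact memory_continuousOn_Icc hα1 hmesh hkn hnN

lemma integral_memory_mul_quadSlope (hα1 : α < 1) (hmesh : IsMesh T N t) (v : ℝ → ℝ)
    (hk : 1 ≤ k) (hkn : k < n) (hnN : n ≤ N) :
    ∫ s in (t (k - 1))..(t k), memory α (offset (α / 2) t n) s * quadSlope t v k s
      = kernelA α t n k * (v (t k) - v (t (k - 1)))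
        + kernelB α t n k * (ratio t k * (v (t (k + 1)) - v (t k))
          - (v (t k) - v (t (k - 1)))) := by
  have h1 := hmesh.step_pos hk (by omega)
  have h2 := hmesh.step_pos (by omega : 1 ≤ k + 1) (by omega)
  have hi : ∀ w : ℝ → ℝ, Continuous w → IntervalIntegrable
      (fun s => memory α (offset (α / 2) t n) s * w s) volume (t (k - 1)) (t k) := fun w hw =>
    memory_mul_intervalIntegrable hα1 hmesh hk hkn hnN (hw.intervalIntegrable _ _)
  have e : ∀ s, memory α (offset (α / 2) t n) s * quadSlope t v k s
      = slope t v k * memory α (offset (α / 2) t n) s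
        + 2 / (step t k + step t (k + 1)) * (slope t v (k + 1) - slope t v k)
          * (memory α (offset (α / 2) t n) s * (s - (t (k - 1) + t k) / 2)) := by
    intro s; rw [quadSlope]; ring
  simp_rw [e]
  rw [intervalIntegral.integral_add ((memory_intervalIntegrable hα1 _ _ _).const_mul _)
      ((hi _ (by fun_prop)).const_mul _), intervalIntegral.integral_const_mul,
    intervalIntegral.integral_const_mul, kernelA_eq_avg hα1 hmesh hkn hnN,
    kernelB_eq_moment hmesh hk (by omega), avg, moment, ← step]
  simp_rw [mul_comm (memory _ _ _)]
  generalize ∫ s in (t (k - 1))..(t k), memory α (offset (α / 2) t n) s = I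
  generalize ∫ s in (t (k - 1))..(t k), (s - (t (k - 1) + t k) / 2)
    * memory α (offset (α / 2) t n) s = J
  rw [slope, slope, ratio, Nat.add_sub_cancel]
  field_simp

lemma integral_quadSlope (hmesh : IsMesh T N t) (v : ℝ → ℝ) (hk : 1 ≤ k) (hkN : k ≤ N) :
    ∫ s in (t (k - 1))..(t k), quadSlope t v k s = v (t k) - v (t (k - 1)) := by
  have h1 := hmesh.step_pos hk hkN
  have e : ∀ s, quadSlope t v k s = slope t v k
      + 2 / (step t k + step t (k + 1)) * (slope t v (k + 1) - slope t v k)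
        * (s - (t (k - 1) + t k) / 2) := by
    intro s; rw [quadSlope]; ring
  simp_rw [e]
  rw [intervalIntegral.integral_add (by simp) (by apply Continuous.intervalIntegrable; fun_prop),
    intervalIntegral.integral_const_mul, integral_sub_mid, intervalIntegral.integral_const,
    mul_zero, add_zero, smul_eq_mul, slope, ← step]
  field_simp

lemma continuous_quadSlope (t : ℕ → ℝ) (v : ℝ → ℝ) (k : ℕ) : Continuous (quadSlope t v k) := by
  unfold quadSlope; fun_prop

open Finset in
lemma caputo_split (hα1 : α < 1) (hmesh : IsMesh T N t) (hn : 1 ≤ n) (hnN : n ≤ N) {v : ℝ → ℝ}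
    (hv : IntervalIntegrable (deriv v) volume 0 T)
    (hlast : 2 ≤ n → IntervalIntegrable
      (fun s => memory α (offset (α / 2) t n) s * deriv v s) volume (t (n - 1))
        (offset (α / 2) t n)) :
    caputo α v (offset (α / 2) t n)
      = (∑ k ∈ Ico 1 n, ∫ s in (t (k - 1))..(t k), memory α (offset (α / 2) t n) s * deriv v s)
        + ∫ s in (t (n - 1))..(offset (α / 2) t n),
          memory α (offset (α / 2) t n) s * deriv v s := by
  have hsub : ∀ k, 1 ≤ k → k < n → IntervalIntegrable
      (fun s => memory α (offset (α / 2) t n) s * deriv v s) volume (t (k - 1)) (t k) := by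
    intro k hk hkn
    refine memory_mul_intervalIntegrable hα1 hmesh hk hkn hnN (hv.mono_set ?_)
    have h1 : t (k - 1) ≤ t k := hmesh.mono (by omega) (by omega)
    rw [Set.uIcc_of_le h1, Set.uIcc_of_le (h := (hmesh.nonneg (by omega : 0 ≤ N)).trans
      (by rw [hmesh.zero]; exact (hmesh.nonneg (by omega)).trans (hmesh.le_last hnN)))]
    exact Set.Icc_subset_Icc (hmesh.nonneg (by omega)) (hmesh.le_last (by omega))
  have key : ∀ m, m < n → IntervalIntegrable
        (fun s => memory α (offset (α / 2) t n) s * deriv v s) volume 0 (t m) ∧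
      ∑ k ∈ Ico 1 (m + 1), ∫ s in (t (k - 1))..(t k),
          memory α (offset (α / 2) t n) s * deriv v s
        = ∫ s in (0 : ℝ)..(t m), memory α (offset (α / 2) t n) s * deriv v s := by
    intro m
    induction m with
    | zero => intro _; rw [hmesh.zero]; simp
    | succ m ih =>
      intro hm
      obtain ⟨i1, i2⟩ := ih (by omega)
      have i3 := hsub (m + 1) (by omega) hm
      rw [Nat.add_sub_cancel] at i3
      refine ⟨i1.trans i3, ?_⟩
      rw [Finset.sum_Ico_succ_top (by omega), i2, Nat.add_sub_cancel,
        intervalIntegral.integral_add_adjacent_intervals i1 i3]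
  obtain ⟨k1, k2⟩ := key (n - 1) (by omega)
  rw [show n - 1 + 1 = n by omega] at k2
  rw [k2, caputo]
  change ∫ s in (0 : ℝ)..(offset (α / 2) t n), memory α (offset (α / 2) t n) s * deriv v s = _
  rcases Nat.eq_or_lt_of_le hn with rfl | h2
  · rw [Nat.sub_self, hmesh.zero]; simp
  · exact (intervalIntegral.integral_add_adjacent_intervals k1 (hlast h2)).symm

/-! ### The consistency error of the Alikhanov formula -/

variable {σ K : ℝ} {v d₁ d₂ d₃ : ℝ → ℝ}

lemma TimeRegular.deriv_eq (h : TimeRegular σ K T v d₁ d₂ d₃) {s : ℝ} (hs : s ∈ Set.Ioo 0 T) :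
    deriv v s = d₁ s := (h.hasDeriv₁ s hs).deriv

lemma TimeRegular.abs_sub_le_rpow (h : TimeRegular σ K T v d₁ d₂ d₃) (hσ0 : 0 < σ) {a b : ℝ}
    (ha : 0 ≤ a) (hab : a ≤ b) (hb : b ≤ T) : |v b - v a| ≤ K / σ * b ^ σ - K / σ * a ^ σ :=
  TimeFracAllenCahn.abs_sub_le_rpow hσ0 h.cont h.hasDeriv₁ h.bound₁ ha hab hb

/-- On each interval before the last one, the consistency error is the variation of the memory
kernel times a bound for the total variation of the interpolation error. -/
lemma abs_integral_memory_mul_sub_le (hα0 : 0 < α) (hα1 : α < 1) (hmesh : IsMesh T N t)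
    (h : TimeRegular σ K T v d₁ d₂ d₃) (hv : IntervalIntegrable (deriv v) volume 0 T)
    (hk : 1 ≤ k) (hkn : k < n) (hnN : n ≤ N) {m : ℝ → ℝ} {G : ℝ}
    (hm : IntervalIntegrable m volume (t (k - 1)) (t k))
    (hwm : ∀ s ∈ Set.Ioo (t (k - 1)) (t k), |quadSlope t v k s - d₁ s| ≤ m s)
    (hG : ∫ s in (t (k - 1))..(t k), m s ≤ G) :
    |(∫ s in (t (k - 1))..(t k), memory α (offset (α / 2) t n) s * quadSlope t v k s)
      - ∫ s in (t (k - 1))..(t k), memory α (offset (α / 2) t n) s * deriv v s|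
      ≤ (memory α (offset (α / 2) t n) (t k) - memory α (offset (α / 2) t n) (t (k - 1))) * G := by
  have hlt : t (k - 1) < t k := hmesh.strict (by omega) (by omega)
  have h0 : 0 ≤ t (k - 1) := hmesh.nonneg (by omega)
  have hT : t k ≤ T := hmesh.le_last (by omega)
  have hvi : IntervalIntegrable (deriv v) volume (t (k - 1)) (t k) := by
    refine hv.mono_set ?_
    rw [Set.uIcc_of_le hlt.le, Set.uIcc_of_le (by linarith)]
    exact Set.Icc_subset_Icc h0 hT
  have hsub : ∀ s ∈ Set.Ioo (t (k - 1)) (t k), s ∈ Set.Ioo 0 T := fun s hs =>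
    ⟨h0.trans_lt hs.1, hs.2.trans_le hT⟩
  have hqi := (continuous_quadSlope t v k).intervalIntegrable (μ := volume) (t (k - 1)) (t k)
  have hft : ∫ s in (t (k - 1))..(t k), deriv v s = v (t k) - v (t (k - 1)) :=
    intervalIntegral.integral_eq_sub_of_hasDerivAt_of_le hlt.le
      (h.cont.mono (Set.Icc_subset_Icc h0 hT))
      (fun s hs => by rw [h.deriv_eq (hsub s hs)]; exact h.hasDeriv₁ s (hsub s hs)) hvi
  rw [← intervalIntegral.integral_sub (memory_mul_intervalIntegrable hα1 hmesh hk hkn hnN hqi)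
    (memory_mul_intervalIntegrable hα1 hmesh hk hkn hnN hvi)]
  simp_rw [← mul_sub]
  refine abs_integral_mul_le_of_integral_eq_zero hlt
    (memory_continuousOn_Icc hα1 hmesh hkn hnN) (memory_monotoneOn_Icc hα0 hα1 hmesh hkn hnN)
    (hqi.sub hvi) ?_ hm (fun s hs => by rw [h.deriv_eq (hsub s hs)]; exact hwm s hs) hG
  rw [intervalIntegral.integral_sub hqi hvi, hft, integral_quadSlope hmesh v hk (by omega), sub_self]

/-- A bound that uses the first derivative only, for intervals next to the initial singularity. -/
lemma exists_bound_crude (hσ0 : 0 < σ) (hσ1 : σ < 1) (hmesh : IsMesh T N t)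
    (h : TimeRegular σ K T v d₁ d₂ d₃) (hK : 0 ≤ K) (hk : 1 ≤ k) (hkN : k + 1 ≤ N) :
    ∃ m : ℝ → ℝ, IntervalIntegrable m volume (t (k - 1)) (t k) ∧
      (∀ s ∈ Set.Ioo (t (k - 1)) (t k), |quadSlope t v k s - d₁ s| ≤ m s) ∧
      ∫ s in (t (k - 1))..(t k), m s ≤ 4 * (K / σ) * t k ^ σ := by
  have hlt : t (k - 1) < t k := hmesh.strict (by omega) (by omega)
  have h0 : 0 ≤ t (k - 1) := hmesh.nonneg (by omega)
  have htk : 0 < t k := hmesh.pos hk (by omega)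
  have hT : t k ≤ T := hmesh.le_last (by omega)
  have h1 := hmesh.step_pos hk (by omega)
  have h2 := hmesh.step_pos (by omega : 1 ≤ k + 1) (by omega)
  have hs1 : |slope t v k| ≤ K / σ * t k ^ σ / step t k := by
    rw [slope, abs_div, abs_of_pos h1]
    gcongr
    have := h.abs_sub_le_rpow hσ0 h0 hlt.le hT
    have : 0 ≤ K / σ * t (k - 1) ^ σ := by positivity
    linarith
  have hs2 : |slope t v (k + 1)| ≤ K * t k ^ (σ - 1) := by
    rw [slope, Nat.add_sub_cancel, abs_div, abs_of_pos h2, div_le_iff₀ h2]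
    have := abs_sub_le_mul hσ1 h.cont h.hasDeriv₁ h.bound₁ hK htk
      (hmesh.mono (by omega : k ≤ k + 1) hkN) (hmesh.le_last hkN)
    rwa [step, Nat.add_sub_cancel]
  set P := 2 * (K / σ * t k ^ σ / step t k) + K * t k ^ (σ - 1) with hP
  refine ⟨fun s => P + K * s ^ (σ - 1), ?_, ?_, ?_⟩
  · exact (by simp : IntervalIntegrable (fun _ => P) volume _ _).add
      ((intervalIntegral.intervalIntegrable_rpow' (by linarith)).const_mul _)
  · intro s hs
    have hq : |quadSlope t v k s| ≤ P := by
      have e1 : |2 * (s - (t (k - 1) + t k) / 2) / (step t k + step t (k + 1))| ≤ 1 := by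
        rw [abs_div, abs_of_pos (by positivity : 0 < step t k + step t (k + 1)),
          div_le_one (by positivity), abs_le]
        simp only [step, Nat.add_sub_cancel] at h2 ⊢
        constructor <;> linarith [hs.1, hs.2]
      rw [quadSlope]
      calc _ ≤ |slope t v k| + |2 * (s - (t (k - 1) + t k) / 2) / (step t k + step t (k + 1))
              * (slope t v (k + 1) - slope t v k)| := abs_add_le _ _
        _ ≤ |slope t v k| + 1 * (|slope t v (k + 1)| + |slope t v k|) := by
            rw [abs_mul]
            gcongr
            exact abs_sub _ _
        _ ≤ P := by linarith
    have := h.bound₁ s ⟨h0.trans_lt hs.1, hs.2.trans_le hT⟩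
    exact (abs_sub _ _).trans (add_le_add hq this)
  · rw [intervalIntegral.integral_add (by simp)
      ((intervalIntegral.intervalIntegrable_rpow' (by linarith)).const_mul _),
      intervalIntegral.integral_const, intervalIntegral.integral_const_mul,
      integral_rpow (Or.inl (by linarith)), smul_eq_mul, ← step, hP, sub_add_cancel]
    have e1 : step t k * t k ^ (σ - 1) ≤ t k ^ σ := by
      calc _ ≤ t k * t k ^ (σ - 1) := by
            gcongr; exact hmesh.step_le (by omega)
        _ = t k ^ σ := by rw [Real.rpow_sub_one htk.ne']; field_simp
    have e2 : step t k * (2 * (K / σ * t k ^ σ / step t k) + K * t k ^ (σ - 1))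
        = 2 * (K / σ * t k ^ σ) + K * (step t k * t k ^ (σ - 1)) := by field_simp
    have e3 : K * ((t k ^ σ - t (k - 1) ^ σ) / σ) ≤ K / σ * t k ^ σ := by
      rw [mul_div_assoc', div_mul_eq_mul_div]
      gcongr
      have : 0 ≤ t (k - 1) ^ σ := Real.rpow_nonneg h0 _
      linarith
    have e4 : K * t k ^ σ ≤ K / σ * t k ^ σ := by
      gcongr
      rw [le_div_iff₀ hσ0]; nlinarith
    rw [e2]
    nlinarith [mul_le_mul_of_nonneg_left e1 hK]

/-- A bound by the third derivative, for intervals away from the initial singularity. -/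
lemma abs_quadSlope_sub_le (hσ1 : σ < 1) (hmesh : IsMesh T N t)
    (h : TimeRegular σ K T v d₁ d₂ d₃) (hK : 0 ≤ K) (hk : 2 ≤ k) (hkN : k + 1 ≤ N) {s : ℝ}
    (hs : s ∈ Set.Ioo (t (k - 1)) (t k)) :
    |quadSlope t v k s - d₁ s|
      ≤ K * t (k - 1) ^ (σ - 3) * (step t k + step t (k + 1)) * step t k := by
  have hab : t (k - 1) < t k := hmesh.strict (by omega) (by omega)
  have hbc : t k < t (k + 1) := hmesh.strict (by omega) (by omega)
  have h0 : 0 < t (k - 1) := hmesh.pos (by omega) (by omega)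
  have hT : t (k + 1) ≤ T := hmesh.le_last hkN
  have h1 := hmesh.step_pos (by omega : 1 ≤ k) (by omega)
  have h2 := hmesh.step_pos (by omega : 1 ≤ k + 1) (by omega)
  have hsub : ∀ s ∈ Set.Ioo (t (k - 1)) (t (k + 1)), s ∈ Set.Ioo 0 T := fun s hs =>
    ⟨h0.trans hs.1, hs.2.trans_le hT⟩
  set c := (slope t v (k + 1) - slope t v k) / (step t k + step t (k + 1)) with hc
  have e1 : slope t v k * step t k = v (t k) - v (t (k - 1)) := by
    rw [slope]; field_simp
  have e2 : slope t v (k + 1) * step t (k + 1) = v (t (k + 1)) - v (t k) := by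
    rw [slope, Nat.add_sub_cancel]; field_simp
  have e3 : c * (step t k + step t (k + 1)) = slope t v (k + 1) - slope t v k := by
    rw [hc]; field_simp
  have s1 : step t k = t k - t (k - 1) := rfl
  have s2 : step t (k + 1) = t (k + 1) - t k := by rw [step, Nat.add_sub_cancel]
  have key := abs_deriv_le_of_three_zeros
    (e := fun s => v (t (k - 1)) + slope t v k * (s - t (k - 1))
      + c * ((s - t (k - 1)) * (s - t k)) - v s)
    (e₁ := fun s => slope t v k + c * ((s - t (k - 1)) + (s - t k)) - d₁ s)
    (e₂ := fun s => c * 2 - d₂ s) (e₃ := fun s => - d₃ s) (M := K * t (k - 1) ^ (σ - 3))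
    hab hbc ?_ ?_ ?_ ?_ ?_ ?_ ?_ ?_ hs
  · have e : quadSlope t v k s - d₁ s
        = slope t v k + c * ((s - t (k - 1)) + (s - t k)) - d₁ s := by
      rw [quadSlope, hc]; ring
    rw [e]
    refine key.trans (le_of_eq ?_)
    rw [s1, s2]; ring
  · refine ContinuousOn.sub (by fun_prop) (h.cont.mono (Set.Icc_subset_Icc h0.le hT))
  · intro s hs
    have f1 := (((hasDerivAt_id s).sub_const (t (k - 1))).const_mul (slope t v k)).const_add
      (v (t (k - 1)))
    have f2 := (((hasDerivAt_id s).sub_const (t (k - 1))).mul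
      ((hasDerivAt_id s).sub_const (t k))).const_mul c
    refine ((f1.add f2).sub (h.hasDeriv₁ s (hsub s hs))).congr_deriv ?_
    simp only [id]; ring
  · intro s hs
    have f1 := ((((hasDerivAt_id s).sub_const (t (k - 1))).add
      ((hasDerivAt_id s).sub_const (t k))).const_mul c).const_add (slope t v k)
    refine (f1.sub (h.hasDeriv₂ s (hsub s hs))).congr_deriv ?_
    ring
  · intro s hs
    exact (h.hasDeriv₃ s (hsub s hs)).const_sub _
  · intro s hs
    rw [abs_neg]
    refine (h.bound₃ s (hsub s hs)).trans (mul_le_mul_of_nonneg_left ?_ hK)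
    exact Real.rpow_le_rpow_of_nonpos h0 hs.1.le (by linarith)
  · simp
  · simp only [sub_self, mul_zero, add_zero]
    rw [← s1]; linarith
  · have f : t (k + 1) - t (k - 1) = step t k + step t (k + 1) := by rw [s1, s2]; ring
    rw [f, ← s2]
    have : c * ((step t k + step t (k + 1)) * step t (k + 1))
        = (slope t v (k + 1) - slope t v k) * step t (k + 1) := by rw [← mul_assoc, e3]
    rw [this]
    linarith

lemma intervalIntegrable_memory_mul_deriv_last (hα0 : 0 < α) (hα1 : α < 1) (hmesh : IsMesh T N t)
    (h : TimeRegular σ K T v d₁ d₂ d₃) (hn : 2 ≤ n) (hnN : n ≤ N) :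
    IntervalIntegrable (fun s => memory α (offset (α / 2) t n) s * deriv v s) volume (t (n - 1))
      (offset (α / 2) t n) := by
  refine (memory_intervalIntegrable hα1 _ _ _).mul_continuousOn ?_
  have h0 : 0 < t (n - 1) := hmesh.pos (by omega) (by omega)
  have h1 := offset_lt hα0 hmesh (by omega : 1 ≤ n) hnN
  have hT : t n ≤ T := hmesh.le_last hnN
  rw [Set.uIcc_of_le (lt_offset hα1 hmesh (by omega) hnN).le]
  intro s hs
  have hs' : s ∈ Set.Ioo 0 T := ⟨h0.trans_le hs.1, by linarith [hs.2]⟩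
  have e : deriv v =ᶠ[nhds s] d₁ := by
    filter_upwards [isOpen_Ioo.mem_nhds hs'] with x hx using h.deriv_eq hx
  exact ((h.hasDeriv₂ s hs').continuousAt.congr e.symm).continuousWithinAt

/-- The contribution of the last interval, away from the initial singularity. The error of linear
interpolation is of third order up to a multiple of the distance to the midpoint, which the
memory kernel does not see. -/
lemma abs_last_le (hα0 : 0 < α) (hα1 : α < 1) (hσ1 : σ < 1) (hmesh : IsMesh T N t)
    (h : TimeRegular σ K T v d₁ d₂ d₃) (hK : 0 ≤ K) (hn : 2 ≤ n) (hnN : n ≤ N) :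
    |kernelA α t n n * (v (t n) - v (t (n - 1)))
      - ∫ s in (t (n - 1))..(offset (α / 2) t n), memory α (offset (α / 2) t n) s * deriv v s|
      ≤ K * kernelA α t n n * (step t n ^ 3 * t (n - 1) ^ (σ - 3)) := by
  have hab : t (n - 1) < t n := hmesh.strict (by omega) (by omega)
  have h0 : 0 < t (n - 1) := hmesh.pos (by omega) (by omega)
  have hT : t n ≤ T := hmesh.le_last hnN
  have hs := hmesh.step_pos (by omega : 1 ≤ n) hnN
  have hr1 := lt_offset hα1 hmesh (by omega : 1 ≤ n) hnN
  have hr2 := offset_lt hα0 hmesh (by omega : 1 ≤ n) hnN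
  set r := offset (α / 2) t n with hr
  have hsub : ∀ s ∈ Set.Ioo (t (n - 1)) (t n), s ∈ Set.Ioo 0 T := fun s hs =>
    ⟨h0.trans hs.1, hs.2.trans_le hT⟩
  have e1 : slope t v n * (t n - t (n - 1)) = v (t n) - v (t (n - 1)) := by
    rw [slope, ← step]; field_simp
  obtain ⟨c, hc⟩ := exists_abs_deriv_sub_le_of_two_zeros
    (e := fun s => v (t (n - 1)) + slope t v n * (s - t (n - 1)) - v s)
    (e₁ := fun s => slope t v n - d₁ s)
    (e₂ := fun s => - d₂ s) (e₃ := fun s => - d₃ s) (M := K * t (n - 1) ^ (σ - 3)) hab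
    (ContinuousOn.sub (by fun_prop) (h.cont.mono (Set.Icc_subset_Icc h0.le hT)))
    (fun s hs => by
      have f1 := (((hasDerivAt_id s).sub_const (t (n - 1))).const_mul (slope t v n)).const_add
        (v (t (n - 1)))
      refine (f1.sub (h.hasDeriv₁ s (hsub s hs))).congr_deriv ?_
      ring)
    (fun s hs => (h.hasDeriv₂ s (hsub s hs)).const_sub _)
    (fun s hs => (h.hasDeriv₃ s (hsub s hs)).neg)
    (fun s hs => by
      rw [abs_neg]
      refine (h.bound₃ s (hsub s hs)).trans (mul_le_mul_of_nonneg_left ?_ hK)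
      exact Real.rpow_le_rpow_of_nonpos h0 hs.1.le (by linarith))
    (by simp) (by linarith)
  have hA : kernelA α t n n = 1 / step t n * ∫ s in (t (n - 1))..r, memory α r s := by
    rw [kernelA, min_eq_right hr2.le]; rfl
  have hI : ∫ s in (t (n - 1))..r, memory α r s = step t n * kernelA α t n n := by
    rw [hA]; field_simp
  have hmid := integral_memory_mul_sub_mid (r := r) hα1 hab (by rw [hr, offset_eq_add, step])
  have hmi := memory_intervalIntegrable hα1 r (t (n - 1)) r
  have hm2 : IntervalIntegrable (fun s => memory α r s * (s - (t (n - 1) + t n) / 2)) volume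
      (t (n - 1)) r := hmi.mul_continuousOn (by fun_prop)
  have hdi := intervalIntegrable_memory_mul_deriv_last hα0 hα1 hmesh h hn hnN
  rw [← hr] at hdi
  have e2 : kernelA α t n n * (v (t n) - v (t (n - 1)))
      - ∫ s in (t (n - 1))..r, memory α r s * deriv v s
      = ∫ s in (t (n - 1))..r, (slope t v n * memory α r s - memory α r s * deriv v s
        - c * (memory α r s * (s - (t (n - 1) + t n) / 2))) := by
    rw [intervalIntegral.integral_sub ((hmi.const_mul _).sub hdi) (hm2.const_mul _),
      intervalIntegral.integral_sub (hmi.const_mul _) hdi, intervalIntegral.integral_const_mul,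
      intervalIntegral.integral_const_mul, hmid, mul_zero, sub_zero, hI, ← e1, ← step]
    ring
  rw [e2, ← Real.norm_eq_abs]
  have e3 : K * kernelA α t n n * (step t n ^ 3 * t (n - 1) ^ (σ - 3))
      = ∫ s in (t (n - 1))..r, memory α r s
        * (K * t (n - 1) ^ (σ - 3) * step t n * step t n) := by
    rw [intervalIntegral.integral_mul_const, hI]; ring
  rw [e3]
  refine intervalIntegral.norm_integral_le_of_norm_le hr1.le ?_ (hmi.mul_const _)
  refine Filter.Eventually.of_forall fun s hs => ?_
  have hs' : s ∈ Set.Ioo (t (n - 1)) (t n) := ⟨hs.1, hs.2.trans_lt hr2⟩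
  have e4 : slope t v n * memory α r s - memory α r s * deriv v s
        - c * (memory α r s * (s - (t (n - 1) + t n) / 2))
      = memory α r s * (slope t v n - d₁ s - c * (s - (t (n - 1) + t n) / 2)) := by
    rw [h.deriv_eq (hsub s hs')]; ring
  rw [e4, Real.norm_eq_abs, abs_mul, abs_of_nonneg (memory_nonneg hα1 hs.2)]
  exact mul_le_mul_of_nonneg_left (hc s hs') (memory_nonneg hα1 hs.2)

/-- The consistency error at the first level: both the formula and the Caputo derivative are of the
order `t_1^(σ-α)`. -/
lemma exists_abs_first_le (hα0 : 0 < α) (hα1 : α < 1) (hσ0 : 0 < σ) (hσ1 : σ < 1) :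
    ∃ C : ℝ, 0 < C ∧ ∀ (K T : ℝ) (N : ℕ) (t : ℕ → ℝ) (v d₁ d₂ d₃ : ℝ → ℝ), IsMesh T N t →
      TimeRegular σ K T v d₁ d₂ d₃ → 0 ≤ K → 1 ≤ N →
      |kernelA α t 1 1 * (v (t 1) - v (t 0))
        - ∫ s in (t 0)..(offset (α / 2) t 1), memory α (offset (α / 2) t 1) s * deriv v s|
        ≤ C * K * (t 1 ^ (-α) * t 1 ^ σ) := by
  have hG : 0 < Real.Gamma (1 - α) := Real.Gamma_pos_of_pos (by linarith)
  have hG2 : 0 < Real.Gamma (2 - α) := Real.Gamma_pos_of_pos (by linarith)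
  have hθ : 0 < 1 - α / 2 := by linarith
  have hω : 0 < omega (2 - α) (1 - α / 2) := by rw [omega]; positivity
  set β := 1 - α / 2 with hβ
  set C1 := (β ^ σ * (β / 2) ^ (-α) / σ + (β / 2) ^ (σ - 1) * β ^ (1 - α) / (1 - α))
    / Real.Gamma (1 - α) with hC1
  have h1α : 0 < 1 - α := by linarith
  refine ⟨omega (2 - α) β / σ + C1, by positivity, ?_⟩
  intro K T N t v d₁ d₂ d₃ hmesh h hK hN
  have ht : 0 < t 1 := hmesh.pos le_rfl hN
  have hT : t 1 ≤ T := hmesh.le_last hN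
  have hr2 := offset_lt hα0 hmesh le_rfl hN
  have hst : step t 1 = t 1 := by rw [step, Nat.sub_self, hmesh.zero, sub_zero]
  have hr : offset (α / 2) t 1 = β * t 1 := by
    rw [offset_eq_add, hst, Nat.sub_self, hmesh.zero, zero_add]
  rw [hr] at hr2 ⊢
  set r := β * t 1 with hrdef
  have hr0 : 0 < r := by positivity
  have e1 : |kernelA α t 1 1 * (v (t 1) - v (t 0))|
      ≤ omega (2 - α) β / σ * K * (t 1 ^ (-α) * t 1 ^ σ) := by
    rw [kernelA_diag hα0 hα1 hmesh le_rfl hN, hst, hmesh.zero, abs_mul,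
      abs_of_nonneg (by positivity)]
    have := h.abs_sub_le_rpow hσ0 le_rfl ht.le hT
    rw [Real.zero_rpow hσ0.ne', mul_zero, sub_zero] at this
    calc _ ≤ omega (2 - α) β * t 1 ^ (-α) * (K / σ * t 1 ^ σ) := by gcongr
      _ = _ := by ring
  -- The two singularities are separated at the midpoint of `[0, r]`.
  have e2 : |∫ s in (t 0)..r, memory α r s * deriv v s|
      ≤ ∫ s in (0 : ℝ)..r, K / Real.Gamma (1 - α) * ((r / 2) ^ (-α) * s ^ (σ - 1)
        + (r / 2) ^ (σ - 1) * (r - s) ^ (-α)) := by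
    rw [hmesh.zero, ← Real.norm_eq_abs]
    refine intervalIntegral.norm_integral_le_of_norm_le hr0.le ?_ ?_
    · filter_upwards [ae_ne_real r] with s hsr hs
      have hs2 : s < r := lt_of_le_of_ne hs.2 hsr
      have hsT : s ∈ Set.Ioo 0 T := ⟨hs.1, by linarith⟩
      have hrs : 0 < r - s := sub_pos.2 hs2
      have hs0 : 0 < s := hs.1
      rw [h.deriv_eq hsT, Real.norm_eq_abs, abs_mul, abs_of_nonneg (memory_nonneg hα1 hs.2),
        memory_eq]
      have f1 : (r - s) ^ (-α) * s ^ (σ - 1)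
          ≤ (r / 2) ^ (-α) * s ^ (σ - 1) + (r / 2) ^ (σ - 1) * (r - s) ^ (-α) := by
        rcases le_total s (r / 2) with hh | hh
        · have : (r - s) ^ (-α) ≤ (r / 2) ^ (-α) :=
            Real.rpow_le_rpow_of_nonpos (by positivity) (by linarith) (by linarith)
          have : (r - s) ^ (-α) * s ^ (σ - 1) ≤ (r / 2) ^ (-α) * s ^ (σ - 1) := by gcongr
          have : 0 ≤ (r / 2) ^ (σ - 1) * (r - s) ^ (-α) := by positivity
          linarith
        · have : s ^ (σ - 1) ≤ (r / 2) ^ (σ - 1) :=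
            Real.rpow_le_rpow_of_nonpos (by positivity) hh (by linarith)
          have : (r - s) ^ (-α) * s ^ (σ - 1) ≤ (r - s) ^ (-α) * (r / 2) ^ (σ - 1) := by gcongr
          have : 0 ≤ (r / 2) ^ (-α) * s ^ (σ - 1) := by positivity
          linarith
      calc _ ≤ (r - s) ^ (-α) / Real.Gamma (1 - α) * (K * s ^ (σ - 1)) := by
            gcongr; exact h.bound₁ s hsT
        _ = K / Real.Gamma (1 - α) * ((r - s) ^ (-α) * s ^ (σ - 1)) := by ring
        _ ≤ _ := by gcongr
    · refine (IntervalIntegrable.add ?_ ?_).const_mul _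
      · exact (intervalIntegral.intervalIntegrable_rpow' (by linarith)).const_mul _
      · have := (intervalIntegral.intervalIntegrable_rpow' (a := r) (b := 0)
          (by linarith : -1 < -α)).comp_sub_left r
        simp only [sub_self, sub_zero] at this
        exact this.const_mul _
  have e3 : ∫ s in (0 : ℝ)..r, K / Real.Gamma (1 - α) * ((r / 2) ^ (-α) * s ^ (σ - 1)
        + (r / 2) ^ (σ - 1) * (r - s) ^ (-α)) = C1 * K * (t 1 ^ (-α) * t 1 ^ σ) := by
    have i1 : IntervalIntegrable (fun s : ℝ => (r / 2) ^ (-α) * s ^ (σ - 1)) volume 0 r :=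
      (intervalIntegral.intervalIntegrable_rpow' (by linarith)).const_mul _
    have i2 : IntervalIntegrable (fun s : ℝ => (r / 2) ^ (σ - 1) * (r - s) ^ (-α)) volume 0 r := by
      have := (intervalIntegral.intervalIntegrable_rpow' (a := r) (b := 0)
          (by linarith : -1 < -α)).comp_sub_left r
      simp only [sub_self, sub_zero] at this
      exact this.const_mul _
    rw [intervalIntegral.integral_const_mul, intervalIntegral.integral_add i1 i2,
      intervalIntegral.integral_const_mul, intervalIntegral.integral_const_mul,
      intervalIntegral.integral_comp_sub_left (fun x : ℝ => x ^ (-α)) r, sub_self, sub_zero,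
      integral_rpow (Or.inl (by linarith)), integral_rpow (Or.inl (by linarith)), sub_add_cancel,
      Real.zero_rpow hσ0.ne', Real.zero_rpow (by linarith), sub_zero, sub_zero,
      show -α + 1 = 1 - α by ring, hrdef, show β * t 1 / 2 = (β / 2) * t 1 by ring,
      Real.mul_rpow hθ.le ht.le, Real.mul_rpow hθ.le ht.le, Real.mul_rpow (by positivity) ht.le,
      Real.mul_rpow (by positivity) ht.le, hC1]
    have f1 : t 1 ^ (σ - 1) * t 1 ^ (1 - α) = t 1 ^ (-α) * t 1 ^ σ := by
      rw [← Real.rpow_add ht, ← Real.rpow_add ht]; congr 1; ring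
    linear_combination (K / Real.Gamma (1 - α) * (β / 2) ^ (σ - 1) * β ^ (1 - α) / (1 - α)) * f1
  rw [e3] at e2
  calc _ ≤ _ := abs_sub _ _
    _ ≤ _ := add_le_add e1 e2
    _ = _ := by ring

end

end TimeFracAllenCahn

end

noncomputable section

namespace TimeFracAllenCahn

open MeasureTheory

/-! ### Residual bounds in terms of mesh-dependent weights -/

/-- The number `Γ` bounds the time discretization terms `τ_1^σ` and
`t_k^α t_{k-1}^(σ-3) τ_k^(3-α)` up to the level `n`. -/
structure MeshBound (α σ : ℝ) (t : ℕ → ℝ) (n : ℕ) (Γ : ℝ) : Prop where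
  first : t 1 ^ σ ≤ Γ
  later : ∀ k, 2 ≤ k → k ≤ n → t k ^ α * t (k - 1) ^ (σ - 3) * step t k ^ (3 - α) ≤ Γ

section
variable {α σ K T Γ : ℝ} {N : ℕ} {t : ℕ → ℝ} {n n₀ k : ℕ} {v d₁ d₂ d₃ : ℝ → ℝ}

lemma MeshBound.nonneg (h : MeshBound α σ t n₀ Γ) (hmesh : IsMesh T N t) (hN : 1 ≤ N) : 0 ≤ Γ :=
  (Real.rpow_nonneg (hmesh.nonneg hN) _).trans h.first

/-- The later terms in `Γ`, rewritten with the weight `(τ_k / t_k)^α`. -/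
lemma MeshBound.step_cube_le (h : MeshBound α σ t n₀ Γ) (hmesh : IsMesh T N t) (hk : 2 ≤ k)
    (hkn : k ≤ n₀) (hkN : k ≤ N) :
    step t k ^ 3 * t (k - 1) ^ (σ - 3) ≤ Γ * (step t k / t k) ^ α := by
  have h1 := hmesh.step_pos (by omega : 1 ≤ k) hkN
  have h2 := hmesh.pos (by omega : 1 ≤ k) hkN
  have h3 : step t k ^ (3 - α) * step t k ^ α = step t k ^ 3 := by
    rw [← Real.rpow_add h1, sub_add_cancel]; norm_cast
  have h4 : (step t k / t k) ^ α * t k ^ α = step t k ^ α := by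
    rw [Real.div_rpow h1.le h2.le]; field_simp
  calc _ = (t k ^ α * t (k - 1) ^ (σ - 3) * step t k ^ (3 - α)) * (step t k / t k) ^ α := by
        rw [← h3]; linear_combination -(t (k - 1) ^ (σ - 3) * step t k ^ (3 - α)) * h4
    _ ≤ _ := by
        gcongr
        exact h.later k hk hkn

/-- Next to the initial singularity, where a step is longer than the distance to `0`, the size of
the singular component is controlled. -/
lemma MeshBound.rpow_le (h : MeshBound α σ t n₀ Γ) (hσ1 : σ < 1)
    (hmesh : IsMesh T N t) (hk : 1 ≤ k) (hkn : k ≤ n₀) (hkN : k ≤ N)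
    (hlong : t (k - 1) < step t k) : t k ^ σ ≤ 2 * Γ * (step t k / t k) ^ α := by
  have h2 := hmesh.pos hk hkN
  have hΓ := h.nonneg hmesh (by omega)
  rcases hk.eq_or_lt with rfl | hk2
  · rw [step, Nat.sub_self, hmesh.zero, sub_zero, div_self h2.ne', Real.one_rpow]
    linarith [h.first]
  · have h1 := hmesh.step_pos hk hkN
    have h3 := h.step_cube_le hmesh hk2 hkn hkN
    have h4 : 0 < t (k - 1) := hmesh.pos (by omega) (by omega)
    have h5 : step t k ^ σ ≤ step t k ^ 3 * t (k - 1) ^ (σ - 3) := by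
      calc step t k ^ σ = step t k ^ 3 * step t k ^ (σ - 3) := by
            rw [← Real.rpow_natCast, ← Real.rpow_add h1]; congr 1; push_cast; ring
        _ ≤ _ := by
            gcongr ?_ * ?_
            exact Real.rpow_le_rpow_of_nonpos h4 hlong.le (by linarith)
    have h6 : t k ^ σ ≤ 2 * step t k ^ σ := by
      by_cases hσ : 0 ≤ σ
      · calc t k ^ σ ≤ (2 * step t k) ^ σ := by
              refine Real.rpow_le_rpow h2.le ?_ hσ
              rw [step] at hlong ⊢; linarith
          _ = 2 ^ σ * step t k ^ σ := Real.mul_rpow zero_le_two h1.le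
          _ ≤ 2 * step t k ^ σ := by
              gcongr
              calc (2 : ℝ) ^ σ ≤ 2 ^ (1 : ℝ) :=
                    Real.rpow_le_rpow_of_exponent_le one_le_two hσ1.le
                _ = 2 := Real.rpow_one 2
      · have : t k ^ σ ≤ step t k ^ σ :=
          Real.rpow_le_rpow_of_nonpos h1 (hmesh.step_le hkN) (by linarith)
        have : 0 ≤ step t k ^ σ := Real.rpow_nonneg h1.le _
        linarith
    linarith

/-- Away from the initial singularity a possibly much longer following step is controlled by its
own term in `Γ`. -/
lemma MeshBound.step_sq_le (h : MeshBound α σ t n₀ Γ) (hα0 : 0 < α) (hα1 : α < 1)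
    (hσ0 : 0 < σ) (hmesh : IsMesh T N t) (hM : CondM1 N t) (hk : 2 ≤ k) (hkn : k + 1 ≤ n₀)
    (hkN : k + 1 ≤ N) (hσ1 : σ < 1) (hshort : step t k ≤ t (k - 1)) :
    t (k - 1) ^ (σ - 3) * (step t k + step t (k + 1)) * step t k ^ 2
      ≤ 33 * Γ * (step t k / t k) ^ α := by
  have h1 := hmesh.step_pos (by omega : 1 ≤ k) (by omega)
  have h2 := hmesh.pos (by omega : 1 ≤ k) (by omega)
  have h2' : 0 < t (k - 1) := hmesh.pos (by omega) (by omega)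
  have h1' := hmesh.step_pos (by omega : 1 ≤ k + 1) hkN
  have h2'' : 0 < t (k + 1) := hmesh.pos (by omega) hkN
  have hA := h.step_cube_le hmesh hk (by omega) (by omega)
  have hB := h.later (k + 1) (by omega) hkn
  rw [Nat.add_sub_cancel] at hB
  have hx : 0 ≤ (step t k / t k) ^ α := Real.rpow_nonneg (by positivity) _
  have h3 : step t k ^ (2 - α) * step t k ^ α = step t k ^ 2 := by
    rw [← Real.rpow_add h1, sub_add_cancel]; norm_cast
  have h4 : (step t k / t k) ^ α * t k ^ α = step t k ^ α := by
    rw [Real.div_rpow h1.le h2.le]; field_simp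
  -- The factors `4` from `f1` and `8` from `f2` make up the constant of the mixed term.
  have f1 : step t k ^ (2 - α) ≤ 4 * step t (k + 1) ^ (2 - α) := by
    calc _ ≤ (2 * step t (k + 1)) ^ (2 - α) := by
          refine Real.rpow_le_rpow h1.le ?_ (by linarith)
          have := hM.step_le hmesh (by omega : 1 ≤ k) hkN
          linarith
      _ = 2 ^ (2 - α) * step t (k + 1) ^ (2 - α) := Real.mul_rpow zero_le_two h1'.le
      _ ≤ _ := by
          gcongr
          calc (2 : ℝ) ^ (2 - α) ≤ 2 ^ (2 : ℝ) :=
                Real.rpow_le_rpow_of_exponent_le one_le_two (by linarith)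
            _ = 4 := by norm_num
  have f2 : t (k - 1) ^ (σ - 3) ≤ 8 * t k ^ (σ - 3) := by
    have g : t k / 2 ≤ t (k - 1) := by rw [step] at hshort; linarith
    calc _ ≤ (t k / 2) ^ (σ - 3) := Real.rpow_le_rpow_of_nonpos (by positivity) g (by linarith)
      _ = t k ^ (σ - 3) * 2 ^ (3 - σ) := by
          rw [Real.div_rpow h2.le zero_le_two, div_eq_mul_inv, ← Real.rpow_neg zero_le_two, neg_sub]
      _ ≤ t k ^ (σ - 3) * 8 := by
          gcongr
          calc (2 : ℝ) ^ (3 - σ) ≤ 2 ^ (3 : ℝ) :=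
                Real.rpow_le_rpow_of_exponent_le one_le_two (by linarith)
            _ = 8 := by norm_num
      _ = _ := mul_comm _ _
  have f3 : t k ^ α ≤ t (k + 1) ^ α :=
    Real.rpow_le_rpow h2.le (hmesh.mono (by omega) hkN) hα0.le
  have f4 : t (k - 1) ^ (σ - 3) * step t (k + 1) * step t k ^ 2
      ≤ 32 * Γ * (step t k / t k) ^ α := by
    calc _ = (t k ^ α * t (k - 1) ^ (σ - 3) * (step t k ^ (2 - α) * step t (k + 1)))
          * (step t k / t k) ^ α := by
          rw [← h3]
          linear_combination -(t (k - 1) ^ (σ - 3) * step t (k + 1) * step t k ^ (2 - α)) * h4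
      _ ≤ (t (k + 1) ^ α * (8 * t k ^ (σ - 3)) * (4 * step t (k + 1) ^ (2 - α) * step t (k + 1)))
          * (step t k / t k) ^ α := by gcongr
      _ = 32 * (t (k + 1) ^ α * t k ^ (σ - 3) * step t (k + 1) ^ (3 - α))
          * (step t k / t k) ^ α := by
          rw [show (3 : ℝ) - α = (2 - α) + 1 by ring, Real.rpow_add_one h1'.ne']; ring
      _ ≤ _ := by gcongr
  calc _ = step t k ^ 3 * t (k - 1) ^ (σ - 3)
        + t (k - 1) ^ (σ - 3) * step t (k + 1) * step t k ^ 2 := by ring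
    _ ≤ _ := by linarith

/-- The total variation of the interpolation error on one mesh interval. -/
lemma exists_bound_interp (hα0 : 0 < α) (hα1 : α < 1) (hσ0 : 0 < σ) (hσ1 : σ < 1)
    (hmesh : IsMesh T N t) (hM : CondM1 N t) (h : TimeRegular σ K T v d₁ d₂ d₃) (hK : 0 ≤ K)
    (hΓ : MeshBound α σ t n₀ Γ) (hk : 1 ≤ k) (hkn : k + 1 ≤ n₀) (hkN : k + 1 ≤ N) :
    ∃ m : ℝ → ℝ, IntervalIntegrable m volume (t (k - 1)) (t k) ∧
      (∀ s ∈ Set.Ioo (t (k - 1)) (t k), |quadSlope t v k s - d₁ s| ≤ m s) ∧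
      ∫ s in (t (k - 1))..(t k), m s ≤ 33 / σ * K * Γ * (step t k / t k) ^ α := by
  have hΓ0 := hΓ.nonneg hmesh (by omega)
  have h1 := hmesh.step_pos hk (by omega)
  have hx : 0 ≤ (step t k / t k) ^ α :=
    Real.rpow_nonneg (div_nonneg h1.le (hmesh.nonneg (by omega))) _
  have hσ' : 1 ≤ 1 / σ := by rw [le_div_iff₀ hσ0]; linarith
  -- A step longer than the distance to `0` is next to the singularity; this includes `k = 1`.
  rcases lt_or_ge (t (k - 1)) (step t k) with hlong | hshort
  · obtain ⟨m, m1, m2, m3⟩ := exists_bound_crude hσ0 hσ1 hmesh h hK hk hkN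
    refine ⟨m, m1, m2, m3.trans ?_⟩
    have h2 := hΓ.rpow_le hσ1 hmesh hk (by omega) (by omega) hlong
    calc 4 * (K / σ) * t k ^ σ ≤ 4 * (K / σ) * (2 * Γ * (step t k / t k) ^ α) := by gcongr
      _ = 8 * (1 / σ * K * Γ * (step t k / t k) ^ α) := by ring
      _ ≤ 33 * (1 / σ * K * Γ * (step t k / t k) ^ α) := by gcongr; norm_num
      _ = _ := by ring
  · have hk2 : 2 ≤ k := by
      by_contra hcon
      obtain rfl : k = 1 := by omega
      rw [Nat.sub_self, hmesh.zero] at hshort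
      linarith
    refine ⟨fun _ => K * t (k - 1) ^ (σ - 3) * (step t k + step t (k + 1)) * step t k, by simp,
      fun s hs => abs_quadSlope_sub_le hσ1 hmesh h hK hk2 hkN hs, ?_⟩
    rw [intervalIntegral.integral_const, smul_eq_mul, ← step]
    have h2 := hΓ.step_sq_le hα0 hα1 hσ0 hmesh hM hk2 hkn hkN hσ1 hshort
    calc _ = K * (t (k - 1) ^ (σ - 3) * (step t k + step t (k + 1)) * step t k ^ 2) := by ring
      _ ≤ K * (33 * Γ * (step t k / t k) ^ α) := by gcongr
      _ = 33 * 1 * K * Γ * (step t k / t k) ^ α := by ring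
      _ ≤ 33 * (1 / σ) * K * Γ * (step t k / t k) ^ α := by gcongr
      _ = _ := by ring

end

open Finset in
/-- The consistency error of the Alikhanov formula: a local part, and a part distributed over the
past levels with the increments of the discrete kernel as weights. -/
lemma exists_consistency_bound {α σ : ℝ} (hα0 : 0 < α) (hα1 : α < 1) (hσ0 : 0 < σ)
    (hσ1 : σ < 1) :
    ∃ C : ℝ, 0 < C ∧ ∀ (K T Γ : ℝ) (N : ℕ) (t : ℕ → ℝ) (n n₀ : ℕ) (v d₁ d₂ d₃ : ℝ → ℝ),
      IsMesh T N t → CondM1 N t → TimeRegular σ K T v d₁ d₂ d₃ → 0 ≤ K →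
      IntervalIntegrable (deriv v) volume 0 T → MeshBound α σ t n₀ Γ → 1 ≤ n → n ≤ n₀ → n₀ ≤ N →
      |discreteCaputo α t (fun k => v (t k)) n - caputo α v (offset (α / 2) t n)|
        ≤ ∑ k ∈ Ico 1 n, (kernel α t n (k + 1) - kernel α t n k)
            * (C * K * Γ * (step t k / t k) ^ α) + C * K * Γ * t n ^ (-α) := by
  obtain ⟨C₁, hC₁, hfirst⟩ := exists_abs_first_le hα0 hα1 hσ0 hσ1
  have hG2 : 0 < Real.Gamma (2 - α) := Real.Gamma_pos_of_pos (by linarith)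
  have hθ : 0 < 1 - α / 2 := by linarith
  have hω : 0 < omega (2 - α) (1 - α / 2) := by rw [omega]; positivity
  refine ⟨6 * (33 / σ) + C₁ + omega (2 - α) (1 - α / 2), by positivity, ?_⟩
  set C := 6 * (33 / σ) + C₁ + omega (2 - α) (1 - α / 2) with hC
  intro K T Γ N t n n₀ v d₁ d₂ d₃ hmesh hM h hK hv hΓ hn hnn hnN
  have hΓ0 := hΓ.nonneg hmesh (by omega)
  have hreg := discreteCaputo_regroup α t (fun k => v (t k)) hn
  have htn : 0 < t n := hmesh.pos hn (by omega)
  have hA0 := kernelA_diag_pos hα0 hα1 hmesh hn (by omega)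
  rw [hreg, caputo_split hα1 hmesh hn (by omega) hv fun h2 =>
    intervalIntegrable_memory_mul_deriv_last hα0 hα1 hmesh h h2 (by omega)]
  have hpast : |∑ k ∈ Ico 1 n, (kernelA α t n k * (v (t k) - v (t (k - 1)))
          + kernelB α t n k * (ratio t k * (v (t (k + 1)) - v (t k)) - (v (t k) - v (t (k - 1)))))
        - ∑ k ∈ Ico 1 n, ∫ s in (t (k - 1))..(t k),
            memory α (offset (α / 2) t n) s * deriv v s|
      ≤ ∑ k ∈ Ico 1 n, (kernel α t n (k + 1) - kernel α t n k)
            * (C * K * Γ * (step t k / t k) ^ α) := by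
    rw [← sum_sub_distrib]
    refine (abs_sum_le_sum_abs _ _).trans (sum_le_sum fun k hk => ?_)
    rw [mem_Ico] at hk
    obtain ⟨m, m1, m2, m3⟩ := exists_bound_interp hα0 hα1 hσ0 hσ1 hmesh hM h hK hΓ hk.1
      (by omega) (by omega)
    rw [← integral_memory_mul_quadSlope hα1 hmesh v hk.1 hk.2 (by omega)]
    refine (abs_integral_memory_mul_sub_le hα0 hα1 hmesh h hv hk.1 hk.2 (by omega) m1 m2 m3).trans
      ?_
    -- The variation of the memory kernel is paid for by the increment of the discrete kernel.
    have h1 := memory_sub_le_kernel_sub hα0 hα1 hmesh hM hk.1 hk.2 (by omega)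
    have h2 := memory_sub_nonneg hα0 hα1 hmesh hk.2 (by omega)
    have h3 := hmesh.step_pos hk.1 (by omega)
    have h4 : 0 ≤ (step t k / t k) ^ α :=
      Real.rpow_nonneg (div_nonneg h3.le (hmesh.nonneg (by omega))) _
    calc _ ≤ (6 * (kernel α t n (k + 1) - kernel α t n k))
          * (33 / σ * K * Γ * (step t k / t k) ^ α) := by gcongr; linarith
      _ = (kernel α t n (k + 1) - kernel α t n k)
          * (6 * (33 / σ) * K * Γ * (step t k / t k) ^ α) := by ring
      _ ≤ _ := by
        gcongr
        · linarith
        · rw [hC]; linarith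
  have hlast : |kernelA α t n n * (v (t n) - v (t (n - 1)))
      - ∫ s in (t (n - 1))..(offset (α / 2) t n), memory α (offset (α / 2) t n) s * deriv v s|
      ≤ C * K * Γ * t n ^ (-α) := by
    rcases hn.eq_or_lt with rfl | hn2
    · have h1 := hfirst K T N t v d₁ d₂ d₃ hmesh h hK (by omega)
      rw [Nat.sub_self]
      refine h1.trans ?_
      calc _ = C₁ * K * (t 1 ^ σ) * t 1 ^ (-α) := by ring
        _ ≤ C * K * Γ * t 1 ^ (-α) := by
          gcongr
          · rw [hC]; have : 0 < 6 * (33 / σ) := by positivity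
            linarith
          · exact hΓ.first
    · have h1 := abs_last_le hα0 hα1 hσ1 hmesh h hK hn2 (by omega)
      refine h1.trans ?_
      have hs := hmesh.step_pos hn (by omega)
      have h2 := hΓ.step_cube_le hmesh hn2 hnn (by omega)
      have h3 : step t n ^ (-α) * (step t n / t n) ^ α = t n ^ (-α) := by
        rw [Real.div_rpow hs.le htn.le, Real.rpow_neg hs.le, Real.rpow_neg htn.le]
        field_simp
      calc _ ≤ K * kernelA α t n n * (Γ * (step t n / t n) ^ α) := by gcongr
        _ = omega (2 - α) (1 - α / 2) * K * Γ * t n ^ (-α) := by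
          rw [kernelA_diag hα0 hα1 hmesh hn (by omega), ← h3]; ring
        _ ≤ _ := by
          gcongr
          rw [hC]; have : 0 < 6 * (33 / σ) := by positivity
          linarith
  calc _ = |((∑ k ∈ Ico 1 n, (kernelA α t n k * (v (t k) - v (t (k - 1)))
          + kernelB α t n k * (ratio t k * (v (t (k + 1)) - v (t k)) - (v (t k) - v (t (k - 1))))))
        - ∑ k ∈ Ico 1 n, ∫ s in (t (k - 1))..(t k),
            memory α (offset (α / 2) t n) s * deriv v s)
        + (kernelA α t n n * (v (t n) - v (t (n - 1)))
      - ∫ s in (t (n - 1))..(offset (α / 2) t n),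
          memory α (offset (α / 2) t n) s * deriv v s)| := by congr 1; ring
    _ ≤ _ := (abs_add_le _ _).trans (add_le_add hpast hlast)

/-- The variation over one time step of a function with an initial singularity. Away from `0` it
is first order in the step, which is all that is needed: the step condition makes `τ^α` a
multiple of the square of the space mesh size. -/
lemma exists_variation_bound {α σ T : ℝ} (hα0 : 0 < α) (hα1 : α < 1) (hσ0 : 0 < σ)
    (hσ1 : σ < 1) (hT : 0 < T) :
    ∃ C : ℝ, 0 < C ∧ ∀ (K Γ : ℝ) (N : ℕ) (t : ℕ → ℝ) (n n₀ : ℕ) (v d : ℝ → ℝ),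
      IsMesh T N t → 0 ≤ K → ContinuousOn v (Set.Icc 0 T) →
      (∀ s ∈ Set.Ioo 0 T, HasDerivAt v (d s) s) → (∀ s ∈ Set.Ioo 0 T, |d s| ≤ K * s ^ (σ - 1)) →
      MeshBound α σ t n₀ Γ → 1 ≤ n → n ≤ n₀ → n₀ ≤ N →
      ∀ a b, t (n - 1) ≤ a → a ≤ b → b ≤ t n →
        |v b - v a| ≤ C * K * (Γ + step t n ^ α) * t n ^ (-α) := by
  refine ⟨2 / σ * T ^ α + 2 * T ^ σ, by positivity, ?_⟩
  intro K Γ N t n n₀ v d hmesh hK hv hd hb hΓ hn hnn hnN a b ha hab hbn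
  have hΓ0 := hΓ.nonneg hmesh (by omega)
  have htn : 0 < t n := hmesh.pos hn (by omega)
  have hs := hmesh.step_pos hn (by omega)
  have hT' : t n ≤ T := hmesh.le_last (by omega)
  have ha0 : 0 ≤ a := (hmesh.nonneg (by omega)).trans ha
  have hone : t n ^ α * t n ^ (-α) = 1 := by
    rw [← Real.rpow_add htn, add_neg_cancel, Real.rpow_zero]
  have hαT : t n ^ α ≤ T ^ α := Real.rpow_le_rpow htn.le hT' hα0.le
  have hneg : 0 < t n ^ (-α) := Real.rpow_pos_of_pos htn _
  have hsα : 0 < step t n ^ α := Real.rpow_pos_of_pos hs _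
  have hTσ : 0 < T ^ σ := Real.rpow_pos_of_pos hT _
  have hTα : 0 < T ^ α := Real.rpow_pos_of_pos hT _
  rcases lt_or_ge (t (n - 1)) (step t n) with hlong | hshort
  · have h1 := abs_sub_le_rpow hσ0 hv hd hb ha0 hab (hbn.trans hT')
    have h2 := hΓ.rpow_le hσ1 hmesh hn hnn (by omega) hlong
    have h3 : (step t n / t n) ^ α ≤ 1 :=
      Real.rpow_le_one (by positivity) ((div_le_one htn).2 (hmesh.step_le (by omega))) hα0.le
    have h4 : b ^ σ ≤ t n ^ σ := Real.rpow_le_rpow (ha0.trans hab) hbn hσ0.le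
    have h5 : 0 ≤ K / σ * a ^ σ := by positivity
    calc |v b - v a| ≤ K / σ * t n ^ σ := by
          have : K / σ * b ^ σ ≤ K / σ * t n ^ σ := by gcongr
          linarith
      _ ≤ K / σ * (2 * Γ * 1) := by gcongr; exact h2.trans (by gcongr)
      _ = 2 / σ * K * Γ * (t n ^ α * t n ^ (-α)) := by rw [hone]; ring
      _ ≤ 2 / σ * K * Γ * (T ^ α * t n ^ (-α)) := by gcongr
      _ = (2 / σ * T ^ α + 0) * K * (Γ + 0) * t n ^ (-α) := by ring
      _ ≤ _ := by gcongr; positivity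
  · have hn2 : 2 ≤ n := by
      by_contra hcon
      obtain rfl : n = 1 := by omega
      rw [Nat.sub_self, hmesh.zero] at hshort
      linarith
    have ht1 : 0 < t (n - 1) := hmesh.pos (by omega) (by omega)
    have h1 := abs_sub_le_mul hσ1 hv hd hb hK (ht1.trans_le ha) hab (hbn.trans hT')
    have h2 : a ^ (σ - 1) ≤ t (n - 1) ^ (σ - 1) :=
      Real.rpow_le_rpow_of_nonpos ht1 ha (by linarith)
    have h3 : b - a ≤ step t n := by rw [step]; linarith
    have h4 : t n ^ α ≤ 2 * t (n - 1) ^ α := by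
      calc _ ≤ (2 * t (n - 1)) ^ α := by
            refine Real.rpow_le_rpow htn.le ?_ hα0.le
            rw [step] at hshort; linarith
        _ = 2 ^ α * t (n - 1) ^ α := Real.mul_rpow zero_le_two ht1.le
        _ ≤ 2 * t (n - 1) ^ α := by
            gcongr
            calc (2 : ℝ) ^ α ≤ 2 ^ (1 : ℝ) :=
                  Real.rpow_le_rpow_of_exponent_le one_le_two hα1.le
              _ = 2 := Real.rpow_one 2
    have h5 : step t n ^ (1 - α) ≤ t (n - 1) ^ (1 - α) :=
      Real.rpow_le_rpow hs.le hshort (by linarith)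
    have h6 : step t n = step t n ^ (1 - α) * step t n ^ α := by
      rw [← Real.rpow_add hs]; simp
    have h7 : t (n - 1) ^ (σ - 1) * t (n - 1) ^ (1 - α) * t (n - 1) ^ α = t (n - 1) ^ σ := by
      rw [← Real.rpow_add ht1, ← Real.rpow_add ht1]; congr 1; ring
    have h8 : t (n - 1) ^ σ ≤ T ^ σ :=
      Real.rpow_le_rpow ht1.le (hmesh.le_last (by omega)) hσ0.le
    calc |v b - v a| ≤ K * t (n - 1) ^ (σ - 1) * step t n :=
          h1.trans (mul_le_mul (mul_le_mul_of_nonneg_left h2 hK) h3 (by linarith) (by positivity))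
      _ = K * t (n - 1) ^ (σ - 1) * (step t n ^ (1 - α) * step t n ^ α)
          * (t n ^ α * t n ^ (-α)) := by rw [hone, ← h6, mul_one]
      _ ≤ K * t (n - 1) ^ (σ - 1) * (t (n - 1) ^ (1 - α) * step t n ^ α)
          * ((2 * t (n - 1) ^ α) * t n ^ (-α)) := by gcongr
      _ = 2 * K * (t (n - 1) ^ (σ - 1) * t (n - 1) ^ (1 - α) * t (n - 1) ^ α)
          * step t n ^ α * t n ^ (-α) := by ring
      _ ≤ 2 * K * T ^ σ * step t n ^ α * t n ^ (-α) := by rw [h7]; gcongr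
      _ = (0 + 2 * T ^ σ) * K * (0 + step t n ^ α) * t n ^ (-α) := by ring
      _ ≤ _ := by gcongr; positivity

end TimeFracAllenCahn

end

noncomputable section

namespace TimeFracAllenCahn

/-! ### The periodic grid -/

lemma zmod_val_add_one {M : ℕ} [NeZero M] (a : ZMod M) :
    (a + 1).val = a.val + 1 ∨ ((a + 1).val = 0 ∧ a.val + 1 = M) := by
  have h : (a + 1).val = (a.val + 1) % M := by
    rw [ZMod.val_add, ZMod.val_one_eq_one_mod, Nat.add_mod_mod]
  have ha := ZMod.val_lt a
  rcases Nat.lt_or_ge (a.val + 1) M with h' | h'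
  · left; rw [h, Nat.mod_eq_of_lt h']
  · right
    have : a.val + 1 = M := by omega
    refine ⟨?_, this⟩
    rw [h, this, Nat.mod_self]

/-- `L`-periodicity in both variables. -/
def Periodic (L : ℝ) (g : Plane → ℝ) : Prop :=
  ∀ (x : Plane) (i : Fin 2), g (x + EuclideanSpace.single i L) = g x

section
variable {L : ℝ} {M : ℕ} [NeZero M] {g : Plane → ℝ}

lemma Periodic.gridPoint_right (hg : Periodic L g) (p : ZMod M × ZMod M) :
    g (gridPoint L M (p.1 + 1, p.2)) = g (gridPoint L M p + (L / M) • unitVec 0) := by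
  have hM : (M : ℝ) ≠ 0 := Nat.cast_ne_zero.2 (NeZero.ne M)
  rcases zmod_val_add_one p.1 with h | ⟨h, h'⟩
  · congr 1
    ext i
    fin_cases i
    · simp [gridPoint, h]; ring
    · simp [gridPoint]
  · rw [← hg (gridPoint L M (p.1 + 1, p.2)) 0]
    congr 1
    have h'' : (p.1.val : ℝ) + 1 = M := by exact_mod_cast h'
    ext i
    fin_cases i
    · simp [gridPoint, h, -ZMod.natCast_val]
      field_simp
      linear_combination -L * h''
    · simp [gridPoint]

lemma Periodic.gridPoint_up (hg : Periodic L g) (p : ZMod M × ZMod M) :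
    g (gridPoint L M (p.1, p.2 + 1)) = g (gridPoint L M p + (L / M) • unitVec 1) := by
  have hM : (M : ℝ) ≠ 0 := Nat.cast_ne_zero.2 (NeZero.ne M)
  rcases zmod_val_add_one p.2 with h | ⟨h, h'⟩
  · congr 1
    ext i
    fin_cases i
    · simp [gridPoint]
    · simp [gridPoint, h]; ring
  · rw [← hg (gridPoint L M (p.1, p.2 + 1)) 1]
    congr 1
    have h'' : (p.2.val : ℝ) + 1 = M := by exact_mod_cast h'
    ext i
    fin_cases i
    · simp [gridPoint]
    · simp [gridPoint, h, -ZMod.natCast_val]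
      field_simp
      linear_combination -L * h''

lemma Periodic.sub_const (hg : Periodic L g) (y : Plane) : Periodic L fun x => g (x - y) := by
  intro x i
  simp only
  rw [← hg (x - y) i]
  congr 1
  abel

/-- On the grid the discrete Laplacian of a periodic function is its five-point difference. -/
lemma Periodic.discreteLaplacian_eq (hg : Periodic L g) (p : ZMod M × ZMod M) :
    discreteLaplacian L M (fun q => g (gridPoint L M q)) p
      = fivePoint (L / M) g (gridPoint L M p) := by
  have h1 := hg.gridPoint_right p
  have h2 := hg.gridPoint_up p
  have h3 := (hg.sub_const ((L / M) • unitVec 0)).gridPoint_right (p.1 - 1, p.2)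
  have h4 := (hg.sub_const ((L / M) • unitVec 1)).gridPoint_up (p.1, p.2 - 1)
  simp only [sub_add_cancel, add_sub_cancel_right] at h3 h4
  rw [discreteLaplacian, h1, h2, ← h3, ← h4, fivePoint, secondDiff, secondDiff]
  congr 1
  ring

end

lemma discreteLaplacian_add_smul (L : ℝ) (M : ℕ) (a b : ℝ) (v w : GridFun M)
    (p : ZMod M × ZMod M) :
    discreteLaplacian L M (fun q => a * v q + b * w q) p
      = a * discreteLaplacian L M v p + b * discreteLaplacian L M w p := by
  simp only [discreteLaplacian]; ring

lemma discreteLaplacian_le_of_max {L : ℝ} {M : ℕ} {v : GridFun M} {s E : ℝ}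
    (p : ZMod M × ZMod M) (h : ∀ q, s * v q ≤ E) :
    s * discreteLaplacian L M v p ≤ 4 / (L / M) ^ 2 * (E - s * v p) := by
  have e : s * discreteLaplacian L M v p
      = (s * v (p.1 + 1, p.2) + s * v (p.1 - 1, p.2) + s * v (p.1, p.2 + 1)
        + s * v (p.1, p.2 - 1) - 4 * (s * v p)) / (L / M) ^ 2 := by
    rw [discreteLaplacian]; ring
  rw [e, div_mul_eq_mul_div]
  gcongr
  linarith [h (p.1 + 1, p.2), h (p.1 - 1, p.2), h (p.1, p.2 + 1), h (p.1, p.2 - 1)]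

/-! ### Positivity of the coefficients of the scheme -/

/-- The weights of the levels `k < n` in the scheme solved for the level `n`. -/
def weight (α : ℝ) (t : ℕ → ℝ) (n k : ℕ) : ℝ :=
  if k = 0 then kernel α t n 1 else kernel α t n (k + 1) - kernel α t n k

open Finset in
lemma sum_weight_mul {α : ℝ} {t : ℕ → ℝ} (e : ℕ → ℝ) {n : ℕ} (hn : 1 ≤ n) :
    ∑ k ∈ range n, weight α t n k * e k
      = ∑ k ∈ Ico 1 n, (kernel α t n (k + 1) - kernel α t n k) * e k + kernel α t n 1 * e 0 := by
  rw [range_eq_Ico, ← sum_Ioo_add_eq_sum_Ico (by omega : 0 < n), weight, if_pos rfl,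
    show Ioo 0 n = Ico 1 n by ext; simp; omega]
  congr 1
  refine sum_congr rfl fun k hk => ?_
  rw [mem_Ico] at hk
  rw [weight, if_neg (by omega)]

open Finset in
lemma discreteCaputo_eq_sub_sum_weight {α : ℝ} {t : ℕ → ℝ} (e : ℕ → ℝ) {n : ℕ} (hn : 1 ≤ n) :
    discreteCaputo α t e n = kernel α t n n * e n - ∑ k ∈ range n, weight α t n k * e k := by
  rw [discreteCaputo, sum_mul_diff_eq _ _ hn, sum_weight_mul e hn]; ring

open Finset in
lemma sum_weight {α : ℝ} {t : ℕ → ℝ} {n : ℕ} (hn : 1 ≤ n) :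
    ∑ k ∈ range n, weight α t n k = kernel α t n n := by
  have h := discreteCaputo_eq_sub_sum_weight (α := α) (t := t) (fun _ => 1) hn
  simp only [discreteCaputo, sub_self, mul_zero, sum_const_zero, mul_one] at h
  linarith

lemma step_le_maxStep {N : ℕ} {t : ℕ → ℝ} {n : ℕ} (hn : 1 ≤ n) (hnN : n ≤ N) :
    step t n ≤ maxStep N t :=
  le_ciSup (f := fun k : Finset.Icc 1 N => step t k) (Set.finite_range _).bddAbove
    ⟨n, Finset.mem_Icc.2 ⟨hn, hnN⟩⟩

section
variable {α ε h T : ℝ} {N : ℕ} {t : ℕ → ℝ} {n k : ℕ}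

lemma omega_pos (hα1 : α < 1) : 0 < omega (2 - α) (1 - α / 2) := by
  have : 0 < Real.Gamma (2 - α) := Real.Gamma_pos_of_pos (by linarith)
  have : 0 < 1 - α / 2 := by linarith
  rw [omega]; positivity

lemma rpow_le_of_le_rpow_one_div {τ X : ℝ} (hα0 : 0 < α) (hτ : 0 ≤ τ) (hX : 0 ≤ X)
    (hle : τ ≤ X ^ (1 / α)) : τ ^ α ≤ X := by
  calc τ ^ α ≤ (X ^ (1 / α)) ^ α := Real.rpow_le_rpow hτ hle hα0.le
    _ = X := by rw [← Real.rpow_mul hX, one_div_mul_cancel hα0.ne', Real.rpow_one]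

lemma StepCondition.step_rpow_le (hS : StepCondition α ε h (maxStep N t)) (hα0 : 0 < α)
    (hα1 : α < 1) (hmesh : IsMesh T N t) (hn : 1 ≤ n) (hnN : n ≤ N) :
    step t n ^ α ≤ h ^ 2 * omega (2 - α) (1 - α / 2) / (4 * ε ^ 2) := by
  have hω := omega_pos hα1
  exact rpow_le_of_le_rpow_one_div hα0 (hmesh.step_pos hn hnN).le (by positivity)
    ((step_le_maxStep hn hnN).trans hS.2.2)

lemma StepCondition.reaction_le_kernelA (hS : StepCondition α ε h (maxStep N t)) (hα0 : 0 < α)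
    (hα1 : α < 1) (hmesh : IsMesh T N t) (hn : 1 ≤ n) (hnN : n ≤ N) :
    2 * (1 - α / 2) ≤ α / 2 * kernelA α t n n := by
  have hω := omega_pos hα1
  have hθ : 0 < 1 - α / 2 := by linarith
  have hs := hmesh.step_pos hn hnN
  have h1 := rpow_le_of_le_rpow_one_div hα0 hs.le (by positivity)
    ((step_le_maxStep hn hnN).trans hS.2.1)
  rw [le_div_iff₀ (by positivity)] at h1
  have hsα : 0 < step t n ^ α := Real.rpow_pos_of_pos hs _
  rw [kernelA_diag hα0 hα1 hmesh hn hnN, Real.rpow_neg hs.le, ← div_eq_mul_inv, ← mul_div_assoc,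
    le_div_iff₀ hsα]
  linarith

lemma StepCondition.diffusion_le_kernelA (hS : StepCondition α ε h (maxStep N t)) (hα0 : 0 < α)
    (hα1 : α < 1) (hε : 0 < ε) (hh : 0 < h) (hmesh : IsMesh T N t) (hn : 1 ≤ n) (hnN : n ≤ N) :
    ε ^ 2 * (4 / h ^ 2) ≤ kernelA α t n n := by
  have hs := hmesh.step_pos hn hnN
  have h1 := hS.step_rpow_le hα0 hα1 hmesh hn hnN
  rw [le_div_iff₀ (by positivity)] at h1
  have hsα : 0 < step t n ^ α := Real.rpow_pos_of_pos hs _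
  rw [kernelA_diag hα0 hα1 hmesh hn hnN, Real.rpow_neg hs.le, ← div_eq_mul_inv,
    le_div_iff₀ hsα, mul_div_assoc', div_mul_eq_mul_div, div_le_iff₀ (by positivity)]
  linarith

lemma StepCondition.diag (hS : StepCondition α ε h (maxStep N t)) (hα0 : 0 < α)
    (hα1 : α < 1) (hmesh : IsMesh T N t) (hn : 1 ≤ n) (hnN : n ≤ N) :
    4 * (1 - α / 2) ≤ kernel α t n n := by
  have h1 := hS.reaction_le_kernelA hα0 hα1 hmesh hn hnN
  have h2 := kernelA_le_kernel_diag (n := n) hα0 hα1 hmesh hnN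
  have h3 := kernelA_diag_pos hα0 hα1 hmesh hn hnN
  nlinarith

lemma weight_nonneg (hα0 : 0 < α) (hα1 : α < 1) (hmesh : IsMesh T N t) (hM : CondM1 N t)
    (hk : k < n) (hnN : n ≤ N) : 0 ≤ weight α t n k := by
  rw [weight]
  split_ifs with h0
  · have h1 := kernel_lower (k := 1) hα0 hα1 hmesh hM le_rfl (by omega : 1 ≤ n) hnN
    have hG : 0 < Real.Gamma (1 - α) := Real.Gamma_pos_of_pos (by linarith)
    refine le_trans (mul_nonneg (by positivity) (Real.rpow_nonneg ?_ _)) h1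
    exact sub_nonneg.2 (hmesh.mono (by omega) hnN)
  · exact sub_nonneg.2 (kernel_mono hα0 hα1 hmesh hM (by omega) hk hnN)

/-- The weight of the previous level dominates the explicit parts of diffusion and reaction. -/
lemma StepCondition.le_weight (hS : StepCondition α ε h (maxStep N t)) (hα0 : 0 < α)
    (hα1 : α < 1) (hε : 0 < ε) (hh : 0 < h) (hmesh : IsMesh T N t) (hM : CondM1 N t)
    (hn : 1 ≤ n) (hnN : n ≤ N) :
    ε ^ 2 * (α / 2) * (4 / h ^ 2) + 2 * (α / 2) ≤ weight α t n (n - 1) := by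
  have h1 := hS.reaction_le_kernelA hα0 hα1 hmesh hn hnN
  have h2 := hS.diffusion_le_kernelA hα0 hα1 hε hh hmesh hn hnN
  have h3 := kernelA_diag_pos hα0 hα1 hmesh hn hnN
  have hθ : 0 < 1 - α / 2 := by linarith
  have h4 : α / 2 / (1 - α / 2) * kernelA α t n n ≤ weight α t n (n - 1) := by
    rcases hn.eq_or_lt with rfl | hn2
    · rw [weight, if_pos rfl]
      refine le_trans ?_ (kernelA_le_kernel_diag (n := 1) hα0 hα1 hmesh hnN)
      have : α / 2 / (1 - α / 2) ≤ 1 := by rw [div_le_one hθ]; linarith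
      nlinarith
    · have := kernel_diag_sub hα0 hα1 hmesh hM hn2 hnN
      rwa [weight, if_neg (by omega), show n - 1 + 1 = n by omega]
  refine le_trans ?_ h4
  -- `θ / (1 - θ) = θ · θ / (1 - θ) + θ`: the two step conditions share the gap in this ratio.
  have e : α / 2 / (1 - α / 2) * kernelA α t n n
      = α / 2 / (1 - α / 2) * (α / 2 * kernelA α t n n) + α / 2 * kernelA α t n n := by
    have : 2 - α ≠ 0 := by linarith
    field_simp; ring
  have h5 : α / 2 / (1 - α / 2) * (2 * (1 - α / 2))
      ≤ α / 2 / (1 - α / 2) * (α / 2 * kernelA α t n n) := by gcongr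
  have h6 : α / 2 / (1 - α / 2) * (2 * (1 - α / 2)) = 2 * (α / 2) := by
    rw [div_mul_eq_mul_div, div_eq_iff hθ.ne']; ring
  have h7 : α / 2 * (ε ^ 2 * (4 / h ^ 2)) ≤ α / 2 * kernelA α t n n := by gcongr
  rw [e]
  linarith

open Finset in
/-- One step of a scheme of the given form, read at a grid point where `s e^n` is maximal. -/
lemma kernel_mul_le_of_max {L : ℝ} {M : ℕ} (hα0 : 0 < α) (hα1 : α < 1)
    (hn : 1 ≤ n) {e : ℕ → GridFun M} {p : ZMod M × ZMod M} {s E R : ℝ}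
    (heq : discreteCaputo α t (fun k => e k p) n = ε ^ 2 * discreteLaplacian L M
      (fun q => (1 - α / 2) * e n q + α / 2 * e (n - 1) q) p + R)
    (hmax : ∀ q, s * e n q ≤ s * e n p) (hE : ∀ q, s * e (n - 1) q ≤ E) :
    kernel α t n n * (s * e n p)
      ≤ ∑ k ∈ range n, weight α t n k * (s * e k p)
        + ε ^ 2 * (α / 2) * (4 / (L / M) ^ 2) * (E - s * e (n - 1) p) + s * R := by
  rw [discreteCaputo_eq_sub_sum_weight _ hn, discreteLaplacian_add_smul] at heq
  have h1 := discreteLaplacian_le_of_max (L := L) p hmax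
  rw [sub_self, mul_zero] at h1
  have h2 := discreteLaplacian_le_of_max (L := L) p hE
  have h3 : ∑ k ∈ range n, weight α t n k * (s * e k p)
      = s * ∑ k ∈ range n, weight α t n k * e k p := by
    rw [mul_sum]; exact sum_congr rfl fun k _ => by ring
  have e1 : kernel α t n n * (s * e n p) = s * (kernel α t n n * e n p
      - ∑ k ∈ range n, weight α t n k * e k p)
      + s * ∑ k ∈ range n, weight α t n k * e k p := by ring
  rw [e1, heq, h3]
  have f1 : ε ^ 2 * (1 - α / 2) * (s * discreteLaplacian L M (e n) p) ≤ 0 :=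
    mul_nonpos_of_nonneg_of_nonpos (mul_nonneg (sq_nonneg _) (by linarith)) h1
  have f2 : ε ^ 2 * (α / 2) * (s * discreteLaplacian L M (e (n - 1)) p)
      ≤ ε ^ 2 * (α / 2) * (4 / (L / M) ^ 2 * (E - s * e (n - 1) p)) :=
    mul_le_mul_of_nonneg_left h2 (by positivity)
  linarith

end

open Finset in
/-- The discrete maximum principle: with `s = ± 1`, the scheme is read at a maximum point of `s Uⁿ`,
where the implicit diffusion has a favourable sign. -/
lemma abs_scheme_le_one {α ε L T : ℝ} {N : ℕ} {t : ℕ → ℝ} {M : ℕ} [NeZero M] {u₀ : Plane → ℝ}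
    {U : ℕ → GridFun M} (hα0 : 0 < α) (hα1 : α < 1) (hε : 0 < ε) (hL : 0 < L)
    (hmesh : IsMesh T N t) (hM : CondM1 N t) (hS : StepCondition α ε (L / M) (maxStep N t))
    (hU : IsSchemeSolution α ε L u₀ N t M U) (hu₀ : ∀ x, |u₀ x| ≤ 1) :
    ∀ n, n ≤ N → ∀ p, |U n p| ≤ 1 := by
  have hMpos : (0 : ℝ) < M := Nat.cast_pos.2 (NeZero.pos M)
  have hh : 0 < L / M := by positivity
  intro n
  induction n using Nat.strong_induction_on with
  | _ n ih =>
    intro hnN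
    rcases Nat.eq_zero_or_pos n with rfl | hn
    · intro p; rw [hU.initial]; exact hu₀ _
    have key : ∀ s : ℝ, s ^ 2 = 1 → ∀ q, s * U n q ≤ 1 := by
      intro s hs
      obtain ⟨p, hp⟩ := Finite.exists_max fun q => s * U n q
      suffices s * U n p ≤ 1 from fun q => (hp q).trans this
      have hsabs : |s| = 1 := by
        rcases eq_or_eq_neg_of_sq_eq_sq s 1 (by rw [hs, one_pow]) with rfl | rfl <;> simp
      have hle : ∀ k < n, ∀ q, s * U k q ≤ 1 := fun k hk q => by
        calc s * U k q ≤ |s * U k q| := le_abs_self _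
          _ ≤ 1 := by rw [abs_mul, hsabs, one_mul]; exact ih k hk (by omega) q
      have hge : -1 ≤ s * U (n - 1) p := by
        have : |s * U (n - 1) p| ≤ 1 := by
          rw [abs_mul, hsabs, one_mul]; exact ih (n - 1) (by omega) (by omega) p
        exact (abs_le.1 this).1
      have h1 := kernel_mul_le_of_max (t := t) (ε := ε) (L := L) (e := U) (s := s) (E := 1)
        (R := -(α / 2 * bulk (U (n - 1) p) + (1 - α / 2) * bulk (U n p))) hα0 hα1 hn
        (by rw [hU.scheme n hn hnN p]; ring) hp (hle (n - 1) (by omega))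
      have h2 := hS.le_weight hα0 hα1 hε hh hmesh hM hn hnN
      have h3 := hS.diag hα0 hα1 hmesh hn hnN
      have h4 := sum_weight (α := α) (t := t) hn
      have hn1 : n = (n - 1) + 1 := by omega
      have h5 : ∑ k ∈ range n, weight α t n k * (s * U k p)
          ≤ kernel α t n n - weight α t n (n - 1)
            + weight α t n (n - 1) * (s * U (n - 1) p) := by
        have g1 : ∑ k ∈ range n, weight α t n k = ∑ k ∈ range (n - 1), weight α t n k
            + weight α t n (n - 1) := by
          conv_lhs => rw [hn1]
          rw [sum_range_succ, ← hn1]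
        have g2 : ∑ k ∈ range n, weight α t n k * (s * U k p)
            = ∑ k ∈ range (n - 1), weight α t n k * (s * U k p)
            + weight α t n (n - 1) * (s * U (n - 1) p) := by
          conv_lhs => rw [hn1]
          rw [sum_range_succ, ← hn1]
        have g3 : ∑ k ∈ range (n - 1), weight α t n k * (s * U k p)
            ≤ ∑ k ∈ range (n - 1), weight α t n k := by
          refine sum_le_sum fun k hk => ?_
          rw [mem_range] at hk
          exact mul_le_of_le_one_right (weight_nonneg hα0 hα1 hmesh hM (by omega) hnN)
            (hle k (by omega) p)
        linarith
      set x := s * U n p with hx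
      set y := s * U (n - 1) p with hy
      have hy1 : y ≤ 1 := hle (n - 1) (by omega) p
      have hcube : ∀ z : ℝ, s * bulk z = (s * z) ^ 3 - s * z := by
        intro z
        have : s ^ 3 = s := by rw [pow_succ, hs, one_mul]
        rw [bulk, mul_pow, this]; ring
      have h6 : s * -(α / 2 * bulk (U (n - 1) p) + (1 - α / 2) * bulk (U n p))
          = α / 2 * (y - y ^ 3) + (1 - α / 2) * (x - x ^ 3) := by
        rw [hx, hy]
        linear_combination -(α / 2) * hcube (U (n - 1) p) - (1 - α / 2) * hcube (U n p)
      rw [h6] at h1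
      set κ := ε ^ 2 * (α / 2) * (4 / (L / M) ^ 2) with hκ
      -- The explicit part is increasing in the value `y` at the previous level.
      have h7 : weight α t n (n - 1) * y + κ * (1 - y) + α / 2 * (y - y ^ 3)
          ≤ weight α t n (n - 1) := by
        have g1 : 0 ≤ (1 - y) * (weight α t n (n - 1) - κ - 2 * (α / 2)) :=
          mul_nonneg (by linarith) (by linarith)
        have g2 : 0 ≤ (1 - y) * (α / 2 * (2 - y * (1 + y))) := by
          refine mul_nonneg (by linarith) (mul_nonneg (by linarith) ?_)
          rw [show 2 - y * (1 + y) = (1 - y) * (2 + y) by ring]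
          exact mul_nonneg (by linarith) (by linarith)
        linarith
      by_contra hcon
      push Not at hcon
      have h8 : 0 < (kernel α t n n - (1 - α / 2)) * (x - 1) :=
        mul_pos (by linarith) (by linarith)
      -- A value `x > 1` would make the left side too large, by the diagonal bound.
      have h9 : 0 ≤ (1 - α / 2) * (x ^ 3 - 1) := by
        refine mul_nonneg (by linarith) ?_
        have : 1 ≤ x ^ 3 := one_le_pow₀ hcon.le
        linarith
      linarith
    intro p
    rw [abs_le]
    constructor
    · have := key (-1) (by norm_num) p; linarith
    · have := key 1 (by norm_num) p; linarith

open Finset in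
/-- The error inequality: the row of the discrete kernel applied to the maximum norms of errors.
The implicit part of the reaction enters through its one-sided Lipschitz constant `1`. -/
lemma kernel_mul_norm_le {α ε L T : ℝ} {N : ℕ} {t : ℕ → ℝ} {M : ℕ} [NeZero M]
    {e V U : ℕ → GridFun M} {n : ℕ} {Λ R : ℝ} (hα0 : 0 < α) (hα1 : α < 1) (hε : 0 < ε)
    (hL : 0 < L) (hmesh : IsMesh T N t) (hM : CondM1 N t)
    (hS : StepCondition α ε (L / M) (maxStep N t)) (hn : 1 ≤ n) (hnN : n ≤ N)
    (he : ∀ k p, e k p = V k p - U k p) (he0 : e 0 = 0) (hΛ : 0 ≤ Λ)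
    (hlip : ∀ p, |bulk (V (n - 1) p) - bulk (U (n - 1) p)| ≤ Λ * |e (n - 1) p|)
    (heq : ∀ p, |discreteCaputo α t (fun k => e k p) n - (ε ^ 2 * discreteLaplacian L M
      (fun q => (1 - α / 2) * e n q + α / 2 * e (n - 1) q) p
      - (α / 2 * (bulk (V (n - 1) p) - bulk (U (n - 1) p))
        + (1 - α / 2) * (bulk (V n p) - bulk (U n p))))| ≤ R) :
    kernel α t n n * ‖e n‖ ≤ ∑ k ∈ Ico 1 n, (kernel α t n (k + 1) - kernel α t n k) * ‖e k‖
      + (1 - α / 2) * ‖e n‖ + Λ * ‖e (n - 1)‖ + R := by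
  have hMpos : (0 : ℝ) < M := Nat.cast_pos.2 (NeZero.pos M)
  have hh : 0 < L / M := by positivity
  obtain ⟨p, hp⟩ := Finite.exists_max fun q => |e n q|
  have hnorm : ‖e n‖ = |e n p| :=
    le_antisymm ((pi_norm_le_iff_of_nonneg (abs_nonneg _)).2 hp) (norm_le_pi_norm (e n) p)
  obtain ⟨s, hs, hsp⟩ : ∃ s : ℝ, |s| = 1 ∧ s * e n p = |e n p| := by
    rcases le_total 0 (e n p) with h | h
    · exact ⟨1, by simp, by rw [abs_of_nonneg h, one_mul]⟩
    · exact ⟨-1, by simp, by rw [abs_of_nonpos h]; ring⟩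
  have hsle : ∀ z : ℝ, s * z ≤ |z| := fun z =>
    (le_abs_self _).trans (by rw [abs_mul, hs, one_mul])
  have hle : ∀ k q, s * e k q ≤ ‖e k‖ := fun k q => (hsle _).trans (norm_le_pi_norm (e k) q)
  set D := ε ^ 2 * discreteLaplacian L M
      (fun q => (1 - α / 2) * e n q + α / 2 * e (n - 1) q) p with hD
  set F := α / 2 * (bulk (V (n - 1) p) - bulk (U (n - 1) p))
        + (1 - α / 2) * (bulk (V n p) - bulk (U n p)) with hF
  set δ := discreteCaputo α t (fun k => e k p) n - (D - F) with hδ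
  have h1 := kernel_mul_le_of_max (t := t) (ε := ε) (L := L) (e := e) (s := s) (E := ‖e (n - 1)‖)
    (R := δ - F) hα0 hα1 hn (by rw [hδ, hD]; ring)
    (fun q => by rw [hsp]; exact (hsle _).trans (hp q)) (hle (n - 1))
  have h2 := hS.le_weight hα0 hα1 hε hh hmesh hM hn hnN
  have hn1 : n = (n - 1) + 1 := by omega
  have g2 : ∀ w : ℕ → ℝ, ∑ k ∈ range n, weight α t n k * w k
      = ∑ k ∈ range (n - 1), weight α t n k * w k + weight α t n (n - 1) * w (n - 1) := by
    intro w
    conv_lhs => rw [hn1]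
    rw [sum_range_succ, ← hn1]
  have g3 : ∑ k ∈ range (n - 1), weight α t n k * (s * e k p)
      ≤ ∑ k ∈ range (n - 1), weight α t n k * ‖e k‖ := by
    refine sum_le_sum fun k hk => ?_
    rw [mem_range] at hk
    exact mul_le_mul_of_nonneg_left (hle k p) (weight_nonneg hα0 hα1 hmesh hM (by omega) hnN)
  have g4 : ∑ k ∈ range n, weight α t n k * ‖e k‖
      = ∑ k ∈ Ico 1 n, (kernel α t n (k + 1) - kernel α t n k) * ‖e k‖ := by
    rw [sum_weight_mul (fun k => ‖e k‖) hn, he0, norm_zero, mul_zero, add_zero]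
  rw [g2 fun k => s * e k p] at h1
  rw [← g4, g2 fun k => ‖e k‖, hnorm, ← hsp]
  set κ := ε ^ 2 * (α / 2) * (4 / (L / M) ^ 2) with hκ
  have h3 : (weight α t n (n - 1) - κ) * (s * e (n - 1) p)
      ≤ (weight α t n (n - 1) - κ) * ‖e (n - 1)‖ :=
    mul_le_mul_of_nonneg_left (hle _ _) (by linarith)
  -- `-f' ≤ 1`, whatever the size of the arguments.
  have h4 : -(s * (bulk (V n p) - bulk (U n p))) ≤ s * e n p := by
    have e1 : bulk (V n p) - bulk (U n p)
        = e n p * (V n p ^ 2 + V n p * U n p + U n p ^ 2 - 1) := by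
      rw [he, bulk, bulk]; ring
    have e2 : 0 ≤ V n p ^ 2 + V n p * U n p + U n p ^ 2 := by
      linarith [sq_nonneg (V n p + U n p), sq_nonneg (V n p), sq_nonneg (U n p)]
    have e3 : 0 ≤ s * e n p := by rw [hsp]; exact abs_nonneg _
    rw [e1]
    linarith [mul_nonneg e3 e2]
  have h5 : -(s * (bulk (V (n - 1) p) - bulk (U (n - 1) p))) ≤ Λ * ‖e (n - 1)‖ := by
    have f1 := (abs_le.1 ((abs_mul s (bulk (V (n - 1) p) - bulk (U (n - 1) p))).le.trans
      (by rw [hs, one_mul]))).1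
    have f2 : Λ * |e (n - 1) p| ≤ Λ * ‖e (n - 1)‖ :=
      mul_le_mul_of_nonneg_left (norm_le_pi_norm (e (n - 1)) p) hΛ
    linarith [hlip p]
  have h6 : s * δ ≤ R := (hsle δ).trans (heq p)
  have h7 : s * (δ - F) = s * δ + α / 2 * -(s * (bulk (V (n - 1) p) - bulk (U (n - 1) p)))
      + (1 - α / 2) * -(s * (bulk (V n p) - bulk (U n p))) := by rw [hF]; ring
  have h8 : α / 2 * -(s * (bulk (V (n - 1) p) - bulk (U (n - 1) p))) ≤ Λ * ‖e (n - 1)‖ := by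
    refine (mul_le_mul_of_nonneg_left h5 (by linarith : 0 ≤ α / 2)).trans ?_
    exact mul_le_of_le_one_left (mul_nonneg hΛ (norm_nonneg _)) (by linarith)
  have h9 := mul_le_mul_of_nonneg_left h4 (by linarith : 0 ≤ 1 - α / 2)
  linarith

end TimeFracAllenCahn

end

noncomputable section

namespace TimeFracAllenCahn

open MeasureTheory

/-! ### Regularity of the solution along lines of constant space coordinates -/

lemma timeDeriv_zero (T : ℝ) (u : Plane → ℝ → ℝ) (x : Plane) : timeDeriv T 0 u x = u x := by
  funext t
  simp [timeDeriv]

section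
variable {α ε σ K L T : ℝ} {u₀ : Plane → ℝ} {u : Plane → ℝ → ℝ}

lemma IsRegular.hasDerivAt (h : IsRegular σ K T u) (x : Plane) {l : ℕ} (hl : l < 3) {s : ℝ}
    (hs : s ∈ Set.Ioo 0 T) : HasDerivAt (timeDeriv T l u x) (timeDeriv T (l + 1) u x s) s := by
  have hu : UniqueDiffOn ℝ (Set.Ioc (0 : ℝ) T) := uniqueDiffOn_Ioc 0 T
  have h1 : DifferentiableOn ℝ (iteratedDerivWithin l (u x) (Set.Ioc 0 T)) (Set.Ioc 0 T) :=
    (h.time_smooth x).differentiableOn_iteratedDerivWithin (by exact_mod_cast hl) hu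
  have hs' : s ∈ Set.Ioc 0 T := ⟨hs.1, hs.2.le⟩
  have h2 := (h1 s hs').hasDerivWithinAt
  rw [← iteratedDerivWithin_succ] at h2
  exact h2.hasDerivAt (Ioc_mem_nhds hs.1 hs.2)

lemma IsRegular.nonneg (h : IsRegular σ K T u) (hT : 0 < T) : 0 ≤ K :=
  (h.space_bound T ⟨hT, le_rfl⟩).nonneg

/-- The regular part of the bound `K (1 + t^(σ-ℓ))` is absorbed in the singular one, up to a
factor that depends on the final time. -/
lemma mul_one_add_rpow_le (hK : 0 ≤ K) (hσ0 : 0 < σ) {l : ℝ} (hl : σ ≤ l) (hl3 : l ≤ 3) {s : ℝ}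
    (hs : s ∈ Set.Ioc 0 T) :
    K * (1 + s ^ (σ - l)) ≤ K * (1 + max 1 T ^ 3) * s ^ (σ - l) := by
  have hm : 1 ≤ max 1 T := le_max_left _ _
  have hm0 : 0 < max 1 T := by linarith
  have h1 : max 1 T ^ (σ - l) ≤ s ^ (σ - l) :=
    Real.rpow_le_rpow_of_nonpos hs.1 (hs.2.trans (le_max_right _ _)) (by linarith)
  have h2 : max 1 T ^ (-(3 : ℝ)) ≤ max 1 T ^ (σ - l) :=
    Real.rpow_le_rpow_of_exponent_le hm (by linarith)
  have h3 : max 1 T ^ 3 * max 1 T ^ (-(3 : ℝ)) = 1 := by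
    rw [← Real.rpow_natCast, ← Real.rpow_add hm0]; norm_num
  have h4 : 1 ≤ max 1 T ^ 3 * s ^ (σ - l) := by
    exact h3.ge.trans (mul_le_mul_of_nonneg_left (h2.trans h1) (by positivity))
  rw [mul_assoc]
  refine mul_le_mul_of_nonneg_left ?_ hK
  linarith

lemma IsRegular.timeDeriv_bound (h : IsRegular σ K T u) (hT : 0 < T) (hσ0 : 0 < σ) (hσ1 : σ < 1)
    {l : ℕ} (hl : l ∈ Finset.Icc 1 3) (x : Plane) {s : ℝ} (hs : s ∈ Set.Ioc 0 T) :
    |timeDeriv T l u x s| ≤ K * (1 + max 1 T ^ 3) * s ^ (σ - (l : ℝ)) := by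
  have h1 := (h.time_bound l hl s hs).abs_apply_le (h.continuous l hl s hs) x
  rw [Finset.mem_Icc] at hl
  have h2 : (1 : ℝ) ≤ l := by exact_mod_cast hl.1
  have h3 : (l : ℝ) ≤ 3 := by exact_mod_cast hl.2
  exact h1.trans (mul_one_add_rpow_le (h.nonneg hT) hσ0 (by linarith) h3 hs)

lemma IsSolution.continuousOn_time (hu : IsSolution α ε L T u₀ u) (x : Plane) :
    ContinuousOn (u x) (Set.Icc 0 T) :=
  hu.continuous.comp (f := fun s : ℝ => (x, s)) (by fun_prop) fun _ hs => ⟨Set.mem_univ _, hs⟩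

lemma IsRegular.timeRegular (h : IsRegular σ K T u) (hu : IsSolution α ε L T u₀ u) (hT : 0 < T)
    (hσ0 : 0 < σ) (hσ1 : σ < 1) (x : Plane) :
    TimeRegular σ (K * (1 + max 1 T ^ 3)) T (u x) (timeDeriv T 1 u x) (timeDeriv T 2 u x)
      (timeDeriv T 3 u x) where
  cont := hu.continuousOn_time x
  hasDeriv₁ := fun s hs => by
    have := h.hasDerivAt x (by norm_num : 0 < 3) hs
    rwa [timeDeriv_zero] at this
  hasDeriv₂ := fun s hs => h.hasDerivAt x (by norm_num : 1 < 3) hs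
  hasDeriv₃ := fun s hs => h.hasDerivAt x (by norm_num : 2 < 3) hs
  bound₁ := fun s hs => by
    simpa using h.timeDeriv_bound hT hσ0 hσ1 (l := 1) (by simp) x ⟨hs.1, hs.2.le⟩
  bound₃ := fun s hs => by
    simpa using h.timeDeriv_bound hT hσ0 hσ1 (l := 3) (by simp) x ⟨hs.1, hs.2.le⟩

lemma IsSolution.continuousOn_fivePoint (hu : IsSolution α ε L T u₀ u) (h : ℝ) (x : Plane) :
    ContinuousOn (fun s => fivePoint h (fun y => u y s) x) (Set.Icc 0 T) := by
  have := hu.continuousOn_time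
  unfold fivePoint secondDiff
  have h0 := this x
  have h1 := this (x + h • unitVec 0)
  have h2 := this (x - h • unitVec 0)
  have h3 := this (x + h • unitVec 1)
  have h4 := this (x - h • unitVec 1)
  fun_prop

lemma IsRegular.hasDerivAt_fivePoint (hr : IsRegular σ K T u) (h : ℝ) (x : Plane) {s : ℝ}
    (hs : s ∈ Set.Ioo 0 T) : HasDerivAt (fun s => fivePoint h (fun y => u y s) x)
      (fivePoint h (fun y => timeDeriv T 1 u y s) x) s := by
  have hd : ∀ y, HasDerivAt (fun s => u y s) (timeDeriv T 1 u y s) s := fun y => by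
    have := hr.hasDerivAt y (by norm_num : 0 < 3) hs
    rwa [timeDeriv_zero] at this
  have hsec : ∀ i, HasDerivAt (fun s => secondDiff (fun y => u y s) i h x)
      (secondDiff (fun y => timeDeriv T 1 u y s) i h x) s := fun i =>
    ((hd _).sub ((hd x).const_mul 2)).add (hd _)
  exact ((hsec 0).add (hsec 1)).div_const _

lemma IsRegular.abs_fivePoint_timeDeriv_le (hr : IsRegular σ K T u) (hT : 0 < T) (hσ0 : 0 < σ)
    (hσ1 : σ < 1) {h : ℝ} (hh : 0 < h) (x : Plane) {s : ℝ} (hs : s ∈ Set.Ioo 0 T) :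
    |fivePoint h (fun y => timeDeriv T 1 u y s) x|
      ≤ 4 * (K * (1 + max 1 T ^ 3)) * s ^ (σ - 1) := by
  have hs' : s ∈ Set.Ioc 0 T := ⟨hs.1, hs.2.le⟩
  have h1 := (hr.time_bound 1 (by simp) s hs').abs_fivePoint_le
    (hr.continuous 1 (by simp) s hs') hh x
  rw [Nat.cast_one] at h1
  have h2 := mul_one_add_rpow_le (T := T) (hr.nonneg hT) hσ0 hσ1.le (by norm_num : (1 : ℝ) ≤ 3) hs'
  linarith

lemma IsRegular.abs_le (hr : IsRegular σ K T u) (hu : IsSolution α ε L T u₀ u)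
    (hu₀ : ∀ x, |u₀ x| ≤ 1) (hT : 0 < T) (x : Plane) {s : ℝ} (hs : s ∈ Set.Icc 0 T) :
    |u x s| ≤ 1 + K := by
  have hK := hr.nonneg hT
  rcases hs.1.eq_or_lt with rfl | h0
  · rw [hu.initial]; linarith [hu₀ x]
  · have := (hr.space_bound s ⟨h0, hs.2⟩).abs_apply_le (hu.space_smooth s ⟨h0, hs.2⟩).continuous x
    linarith

end

lemma abs_bulk_sub_le {a b B : ℝ} (ha : |a| ≤ B) (hb : |b| ≤ B) :
    |bulk a - bulk b| ≤ (3 * B ^ 2 + 1) * |a - b| := by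
  have e : bulk a - bulk b = (a ^ 2 + a * b + b ^ 2 - 1) * (a - b) := by rw [bulk, bulk]; ring
  rw [e, abs_mul]
  gcongr
  have hB : 0 ≤ B := (abs_nonneg a).trans ha
  have h1 : a ^ 2 ≤ B ^ 2 := sq_le_sq' (abs_le.1 ha).1 (abs_le.1 ha).2
  have h2 : b ^ 2 ≤ B ^ 2 := sq_le_sq' (abs_le.1 hb).1 (abs_le.1 hb).2
  rw [_root_.abs_le]
  constructor <;> nlinarith [sq_nonneg (a + b), sq_nonneg (a - b)]

/-! ### The residual of the exact solution in the scheme -/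

lemma abs_convex_sub_le {θ A B X : ℝ} (h0 : 0 ≤ θ) (h1 : θ ≤ 1) (hA : |A| ≤ X) (hB : |B| ≤ X) :
    |(1 - θ) * A - θ * B| ≤ X := by
  refine (abs_sub _ _).trans ?_
  rw [abs_mul, abs_mul, abs_of_nonneg h0, abs_of_nonneg (sub_nonneg.2 h1)]
  have a1 := mul_le_mul_of_nonneg_left hA (sub_nonneg.2 h1)
  have a2 := mul_le_mul_of_nonneg_left hB h0
  linarith

open Finset in
/-- The residual of the exact solution in the scheme. Replacing the values at `t_{n-θ}` by averages
over `t_{n-1}`, `t_n` is estimated with first differences in time only: the part `τ_n^α` of this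
error is at most `C h²` by the step condition, and so belongs to the space discretization error. -/
lemma exists_residual_bound {α σ ε T K : ℝ} (L : ℝ) (hα0 : 0 < α) (hα1 : α < 1) (hσ0 : 0 < σ)
    (hσ1 : σ < 1) (hε : 0 < ε) (hL : 0 < L) (hT : 0 < T) (hK : 0 ≤ K) :
    ∃ q : ℝ, 0 < q ∧ ∀ (u₀ : Plane → ℝ) (u : Plane → ℝ → ℝ), IsSolution α ε L T u₀ u →
      (∀ x, |u₀ x| ≤ 1) → IsRegular σ K T u → ∀ (N : ℕ) (t : ℕ → ℝ) (M : ℕ) [NeZero M]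
      (n n₀ : ℕ) (Γ : ℝ), IsMesh T N t → CondM1 N t → StepCondition α ε (L / M) (maxStep N t) →
      MeshBound α σ t n₀ Γ → 1 ≤ n → n ≤ n₀ → n₀ ≤ N → ∀ p : ZMod M × ZMod M,
      |discreteCaputo α t (fun k => u (gridPoint L M p) (t k)) n
        - (ε ^ 2 * discreteLaplacian L M (fun r => (1 - α / 2) * u (gridPoint L M r) (t n)
            + α / 2 * u (gridPoint L M r) (t (n - 1))) p
          - (α / 2 * bulk (u (gridPoint L M p) (t (n - 1)))
            + (1 - α / 2) * bulk (u (gridPoint L M p) (t n))))|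
        ≤ ∑ k ∈ Ico 1 n, (kernel α t n (k + 1) - kernel α t n k)
            * (q * Γ * (step t k / t k) ^ α) + q * (Γ + (L / M) ^ 2) * t n ^ (-α) := by
  obtain ⟨Cc, hCc, hcons⟩ := exists_consistency_bound hα0 hα1 hσ0 hσ1
  obtain ⟨Cv, hCv, hvar⟩ := exists_variation_bound hα0 hα1 hσ0 hσ1 hT
  have hω := omega_pos hα1
  set K' := K * (1 + max 1 T ^ 3) with hK'
  have hm0 : (0 : ℝ) < max 1 T := lt_of_lt_of_le one_pos (le_max_left _ _)
  have hK'0 : 0 ≤ K' := by positivity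
  set ch := omega (2 - α) (1 - α / 2) / (4 * ε ^ 2) with hch
  have hch0 : 0 < ch := by positivity
  set Λ := 3 * (1 + K) ^ 2 + 1 with hΛ
  have hΛ0 : 0 < Λ := by positivity
  have hTα : 0 < T ^ α := Real.rpow_pos_of_pos hT _
  set q := Cc * K' + 4 * ε ^ 2 * K * T ^ α + (4 * ε ^ 2 + Λ) * (Cv * K') * (1 + ch) + 1 with hq
  have hq1 : Cc * K' ≤ q := by
    rw [hq]
    have : 0 ≤ 4 * ε ^ 2 * K * T ^ α := by positivity
    have : 0 ≤ (4 * ε ^ 2 + Λ) * (Cv * K') * (1 + ch) := by positivity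
    linarith
  refine ⟨q, by positivity, ?_⟩
  intro u₀ u hu hu₀ hr N t M _ n n₀ Γ hmesh hM hS hΓ hn hnn hnN p
  have hMpos : (0 : ℝ) < M := Nat.cast_pos.2 (NeZero.pos M)
  set h := L / M with hh
  have hh0 : 0 < h := by positivity
  have hΓ0 := hΓ.nonneg hmesh (by omega)
  set x := gridPoint L M p with hx
  have htn : 0 < t n := hmesh.pos hn (by omega)
  have htT : t n ≤ T := hmesh.le_last (by omega)
  have ht1 : 0 ≤ t (n - 1) := hmesh.nonneg (by omega)
  set r := offset (α / 2) t n with hrdef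
  have hr1 : t (n - 1) < r := lt_offset hα1 hmesh hn (by omega)
  have hr2 : r < t n := offset_lt hα0 hmesh hn (by omega)
  have hrI : r ∈ Set.Ioc 0 T := ⟨ht1.trans_lt hr1, by linarith⟩
  have htr := hr.timeRegular hu hT hσ0 hσ1 x
  set w : ℝ → ℝ := fun s => fivePoint h (fun y => u y s) x with hw
  -- The discrete Laplacian of the exact solution is the five-point difference `w`.
  have hper : ∀ s ∈ Set.Icc 0 T, Periodic L fun y => u y s := fun s hs y i => hu.periodic s hs y i
  have hlap : discreteLaplacian L M (fun r => (1 - α / 2) * u (gridPoint L M r) (t n)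
      + α / 2 * u (gridPoint L M r) (t (n - 1))) p
      = (1 - α / 2) * w (t n) + α / 2 * w (t (n - 1)) := by
    rw [discreteLaplacian_add_smul L M (1 - α / 2) (α / 2)
      (fun r => u (gridPoint L M r) (t n)) (fun r => u (gridPoint L M r) (t (n - 1))),
      (hper (t n) ⟨htn.le, htT⟩).discreteLaplacian_eq,
      (hper (t (n - 1)) ⟨ht1, by linarith⟩).discreteLaplacian_eq]
  have e1 := hcons K' T Γ N t n n₀ (u x) _ _ _ hmesh hM htr hK'0 (hu.time_integrable x) hΓ hn hnn
    hnN
  have hvV := hvar K' Γ N t n n₀ (u x) _ hmesh hK'0 htr.cont htr.hasDeriv₁ htr.bound₁ hΓ hn hnn hnN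
  have hvW := hvar (4 * K') Γ N t n n₀ w _ hmesh (by positivity) (hu.continuousOn_fivePoint h x)
    (fun s hs => hr.hasDerivAt_fivePoint h x hs)
    (fun s hs => hr.abs_fivePoint_timeDeriv_le hT hσ0 hσ1 hh0 x hs) hΓ hn hnn hnN
  have e2 := (hr.space_bound r hrI).abs_fivePoint_sub_laplacian_le (hu.space_smooth r hrI) hh0 x
  have heq := hu.equation r hrI x
  have e3 : |w r - ((1 - α / 2) * w (t n) + α / 2 * w (t (n - 1)))|
      ≤ Cv * (4 * K') * (Γ + step t n ^ α) * t n ^ (-α) := by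
    have e : (1 - α / 2) * w (t n) + α / 2 * w (t (n - 1)) - w r
        = (1 - α / 2) * (w (t n) - w r) - α / 2 * (w r - w (t (n - 1))) := by ring
    rw [abs_sub_comm, e]
    exact abs_convex_sub_le (by linarith) (by linarith) (hvW r (t n) hr1.le hr2.le le_rfl)
      (hvW (t (n - 1)) r le_rfl hr1.le hr2.le)
  have hB : ∀ s ∈ Set.Icc 0 T, |u x s| ≤ 1 + K := fun s hs => hr.abs_le hu hu₀ hT x hs
  have e4 : |α / 2 * bulk (u x (t (n - 1))) + (1 - α / 2) * bulk (u x (t n)) - bulk (u x r)|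
      ≤ Λ * (Cv * K' * (Γ + step t n ^ α) * t n ^ (-α)) := by
    have hBr := hB r ⟨hrI.1.le, hrI.2⟩
    have a1 := ((abs_bulk_sub_le (hB (t n) ⟨htn.le, htT⟩) hBr).trans
      (mul_le_mul_of_nonneg_left (hvV r (t n) hr1.le hr2.le le_rfl) hΛ0.le))
    have a2 := ((abs_bulk_sub_le hBr (hB (t (n - 1)) ⟨ht1, by linarith⟩)).trans
      (mul_le_mul_of_nonneg_left (hvV (t (n - 1)) r le_rfl hr1.le hr2.le) hΛ0.le))
    have e : α / 2 * bulk (u x (t (n - 1))) + (1 - α / 2) * bulk (u x (t n)) - bulk (u x r)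
        = (1 - α / 2) * (bulk (u x (t n)) - bulk (u x r))
          - α / 2 * (bulk (u x r) - bulk (u x (t (n - 1)))) := by ring
    rw [e]
    exact abs_convex_sub_le (by linarith) (by linarith) a1 a2
  have hτ : step t n ^ α ≤ ch * h ^ 2 := by
    have := hS.step_rpow_le hα0 hα1 hmesh hn (by omega)
    rw [hch]
    calc _ ≤ _ := this
      _ = _ := by ring
  have hneg : 0 < t n ^ (-α) := Real.rpow_pos_of_pos htn _
  have hone : 1 ≤ T ^ α * t n ^ (-α) := by
    have : t n ^ α * t n ^ (-α) = 1 := by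
      rw [← Real.rpow_add htn, add_neg_cancel, Real.rpow_zero]
    rw [← this]
    gcongr
  have hΓτ : Γ + step t n ^ α ≤ (1 + ch) * (Γ + h ^ 2) := by
    have : 0 ≤ ch * Γ := by positivity
    have : 0 ≤ h ^ 2 := by positivity
    linarith
  have hsum : ∑ k ∈ Ico 1 n, (kernel α t n (k + 1) - kernel α t n k)
            * (Cc * K' * Γ * (step t k / t k) ^ α)
      ≤ ∑ k ∈ Ico 1 n, (kernel α t n (k + 1) - kernel α t n k)
            * (q * Γ * (step t k / t k) ^ α) := by
    refine sum_le_sum fun k hk => ?_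
    rw [mem_Ico] at hk
    have h1 := kernel_mono hα0 hα1 hmesh hM hk.1 hk.2 (by omega)
    have h2 := hmesh.step_pos hk.1 (by omega)
    have h3 : 0 ≤ (step t k / t k) ^ α :=
      Real.rpow_nonneg (div_nonneg h2.le (hmesh.nonneg (by omega))) _
    have h4 : 0 ≤ kernel α t n (k + 1) - kernel α t n k := sub_nonneg.2 h1
    gcongr
  have hloc : Cc * K' * Γ * t n ^ (-α) + ε ^ 2 * (4 * K * h ^ 2)
      + ε ^ 2 * (Cv * (4 * K') * (Γ + step t n ^ α) * t n ^ (-α))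
      + Λ * (Cv * K' * (Γ + step t n ^ α) * t n ^ (-α))
      ≤ q * (Γ + h ^ 2) * t n ^ (-α) := by
    have b1 : Cc * K' * Γ * t n ^ (-α) ≤ Cc * K' * (Γ + h ^ 2) * t n ^ (-α) := by
      gcongr; linarith [sq_nonneg h]
    have b2 : ε ^ 2 * (4 * K * h ^ 2) ≤ 4 * ε ^ 2 * K * T ^ α * (Γ + h ^ 2) * t n ^ (-α) := by
      calc _ = 4 * ε ^ 2 * K * h ^ 2 * 1 := by ring
        _ ≤ 4 * ε ^ 2 * K * (Γ + h ^ 2) * (T ^ α * t n ^ (-α)) := by gcongr; linarith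
        _ = _ := by ring
    have b3 : (4 * ε ^ 2 + Λ) * (Cv * K') * (Γ + step t n ^ α) * t n ^ (-α)
        ≤ (4 * ε ^ 2 + Λ) * (Cv * K') * ((1 + ch) * (Γ + h ^ 2)) * t n ^ (-α) := by gcongr
    have b4 : 0 ≤ (Γ + h ^ 2) * t n ^ (-α) := by positivity
    rw [hq]
    linarith
  have hfin : ∀ a b c d : ℝ, |a + ε ^ 2 * b + ε ^ 2 * c + d|
      ≤ |a| + ε ^ 2 * |b| + ε ^ 2 * |c| + |d| := fun a b c d => by
    have h2 : (0 : ℝ) ≤ ε ^ 2 := by positivity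
    calc _ ≤ |a| + |ε ^ 2 * b| + |ε ^ 2 * c| + |d| := by
          refine (abs_add_le _ _).trans (add_le_add ?_ le_rfl)
          refine (abs_add_le _ _).trans (add_le_add ?_ le_rfl)
          exact abs_add_le _ _
      _ = _ := by rw [abs_mul, abs_mul, abs_of_nonneg h2]
  have hsplit : discreteCaputo α t (fun k => u x (t k)) n
        - (ε ^ 2 * ((1 - α / 2) * w (t n) + α / 2 * w (t (n - 1)))
          - (α / 2 * bulk (u x (t (n - 1))) + (1 - α / 2) * bulk (u x (t n))))
      = (discreteCaputo α t (fun k => u x (t k)) n - caputo α (u x) r)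
        + ε ^ 2 * (Laplacian.laplacian (fun y => u y r) x - w r)
        + ε ^ 2 * (w r - ((1 - α / 2) * w (t n) + α / 2 * w (t (n - 1))))
        + (α / 2 * bulk (u x (t (n - 1))) + (1 - α / 2) * bulk (u x (t n)) - bulk (u x r)) := by
    rw [heq]; ring
  rw [hlap, hsplit]
  refine (hfin _ _ _ _).trans ?_
  rw [abs_sub_comm (Laplacian.laplacian (fun y => u y r) x)]
  have c2 : ε ^ 2 * |w r - Laplacian.laplacian (fun y => u y r) x| ≤ ε ^ 2 * (4 * K * h ^ 2) := by
    gcongr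
  have c3 := mul_le_mul_of_nonneg_left e3 (sq_nonneg ε)
  linarith

/-! ### Convergence -/

/-- The error estimate in terms of a bound `Γ` for the time discretization terms up to the level
`n`. -/
lemma exists_error_bound {α σ ε L T K : ℝ} (hα0 : 0 < α) (hα1 : α < 1) (hσ0 : 0 < σ)
    (hσ1 : σ < 1) (hε : 0 < ε) (hL : 0 < L) (hT : 0 < T) (hK : 0 ≤ K) :
    ∃ C : ℝ, 0 < C ∧ ∀ (u₀ : Plane → ℝ) (u : Plane → ℝ → ℝ), IsSolution α ε L T u₀ u →
      (∀ x, |u₀ x| ≤ 1) → IsRegular σ K T u → ∀ (N : ℕ) (t : ℕ → ℝ) (M : ℕ) [NeZero M]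
      (U : ℕ → GridFun M), IsMesh T N t → CondM1 N t →
      StepCondition α ε (L / M) (maxStep N t) → IsSchemeSolution α ε L u₀ N t M U →
      ∀ n, 1 ≤ n → n ≤ N → ∀ Γ, MeshBound α σ t n Γ →
        gridError L u t M U n ≤ C * (Γ + (L / M) ^ 2) := by
  obtain ⟨q, hq, hres⟩ := exists_residual_bound L hα0 hα1 hσ0 hσ1 hε hL hT hK
  have hω := omega_pos hα1
  have hG : 0 < Real.Gamma (1 - α) := Real.Gamma_pos_of_pos (by linarith)
  set Λ := 3 * (1 + K) ^ 2 + 1 with hΛ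
  have hΛ0 : 0 < Λ := by positivity
  obtain ⟨C, hC, hgron⟩ := discrete_gronwall (α := α) (c := 4 / 11 / Real.Gamma (1 - α))
    (lam := 1 - α / 2) (Lam := Λ) T hα0 (by positivity) (by linarith) hΛ0.le
  refine ⟨C * (q * (1 + 3 * omega (2 - α) (1 - α / 2))), by positivity, ?_⟩
  intro u₀ u hu hu₀ hr N t M _ U hmesh hM hS hU n₀ hn₀ hn₀N Γ hΓ
  have hΓ0 := hΓ.nonneg hmesh (by omega)
  set ω := omega (2 - α) (1 - α / 2) with hωdef
  set V : ℕ → GridFun M := fun k p => u (gridPoint L M p) (t k) with hV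
  set e : ℕ → GridFun M := fun k p => V k p - U k p with he
  set Q := q * (1 + 3 * ω) * (Γ + (L / M) ^ 2) with hQ
  have hQ0 : 0 ≤ Q := by positivity
  set g : ℕ → ℝ := fun k => q * Γ * (step t k / t k) ^ α with hg
  have hstep0 : ∀ k, 0 ≤ step t k / t k ∨ N < k := fun k => by
    rcases Nat.lt_or_ge N k with h | h
    · exact Or.inr h
    · left
      rcases Nat.eq_zero_or_pos k with rfl | hk
      · simp [step]
      · exact div_nonneg (hmesh.step_pos hk h).le (hmesh.nonneg h)
  -- The mesh is arbitrary beyond `N`, where the weights need not be nonnegative.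
  set g' : ℕ → ℝ := fun k => if k ≤ N then g k else 0 with hg'
  have hg'0 : ∀ k, 0 ≤ g' k := fun k => by
    simp only [hg']
    split_ifs with h
    · exact mul_nonneg (by positivity)
        (Real.rpow_nonneg ((hstep0 k).resolve_right (by omega)) _)
    · exact le_rfl
  have he0 : e 0 = 0 := by
    funext p
    simp only [he, hV, Pi.zero_apply]
    rw [hmesh.zero, hu.initial, hU.initial, sub_self]
  have hUb := abs_scheme_le_one hα0 hα1 hε hL hmesh hM hS hU hu₀
  have hks : KernelStructure α (4 / 11 / Real.Gamma (1 - α)) (1 - α / 2) N t (kernel α t) :=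
    ⟨fun n k hk hkn hnN => kernel_mono hα0 hα1 hmesh hM hk hkn hnN,
      fun n k hk hkn hnN => kernel_lower hα0 hα1 hmesh hM hk hkn hnN,
      fun n hn hnN => hS.diag hα0 hα1 hmesh hn hnN⟩
  have hmain := hgron N t (kernel α t) hmesh hM hks n₀ (fun k => ‖e k‖) g' Q hn₀N hQ0
    (by rw [he0, norm_zero])
    (by simp only [hg', hg, step, Nat.zero_le, if_true]; simp [Real.zero_rpow hα0.ne'])
    hg'0 ?_ ?_ n₀ hn₀ le_rfl
  · calc gridError L u t M U n₀ = ‖e n₀‖ := rfl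
      _ ≤ C * Q := hmain
      _ = _ := by rw [hQ]; ring
  · intro n hn hnn
    have hs := hmesh.step_pos hn (by omega)
    have htn : 0 < t n := hmesh.pos hn (by omega)
    have h1 := kernel_diag_le hα0 hα1 hmesh hM hn (by omega)
    rw [kernelA_diag hα0 hα1 hmesh hn (by omega), ← hωdef] at h1
    have h2 : step t n ^ (-α) * (step t n / t n) ^ α = t n ^ (-α) := by
      rw [Real.div_rpow hs.le htn.le, Real.rpow_neg hs.le, Real.rpow_neg htn.le]
      field_simp
    simp only [hg', if_pos (by omega : n ≤ N), hg]
    calc _ ≤ 3 * (ω * step t n ^ (-α)) * (q * Γ * (step t n / t n) ^ α) := by gcongr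
      _ = q * (3 * ω) * Γ * t n ^ (-α) := by rw [← h2]; ring
      _ ≤ q * (1 + 3 * ω) * (Γ + (L / M) ^ 2) * t n ^ (-α) := by
          gcongr
          · linarith
          · linarith [sq_nonneg (L / M)]
  · intro n hn hnn
    have htn : 0 < t n := hmesh.pos hn (by omega)
    have h1 := kernel_mul_norm_le (e := e) (V := V) (U := U) (Λ := Λ)
      (R := ∑ k ∈ Finset.Ico 1 n, (kernel α t n (k + 1) - kernel α t n k) * g k
        + q * (Γ + (L / M) ^ 2) * t n ^ (-α)) hα0 hα1 hε hL hmesh hM hS hn (by omega)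
      (fun k p => rfl) he0 hΛ0.le ?_ ?_
    · have h2 : ∑ k ∈ Finset.Ico 1 n, (kernel α t n (k + 1) - kernel α t n k) * (‖e k‖ + g' k)
          = ∑ k ∈ Finset.Ico 1 n, (kernel α t n (k + 1) - kernel α t n k) * ‖e k‖
            + ∑ k ∈ Finset.Ico 1 n, (kernel α t n (k + 1) - kernel α t n k) * g k := by
        rw [← Finset.sum_add_distrib]
        refine Finset.sum_congr rfl fun k hk => ?_
        rw [Finset.mem_Ico] at hk
        simp only [hg', if_pos (by omega : k ≤ N)]
        ring
      have h3 : q * (Γ + (L / M) ^ 2) * t n ^ (-α) ≤ Q * t n ^ (-α) := by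
        rw [hQ]
        gcongr
        nlinarith
      rw [h2]
      linarith
    · intro p
      refine abs_bulk_sub_le ?_ ((hUb (n - 1) (by omega) p).trans (by linarith))
      exact hr.abs_le hu hu₀ hT _ ⟨hmesh.nonneg (by omega), hmesh.le_last (by omega)⟩
    · intro p
      have h2 := hres u₀ u hu hu₀ hr N t M n n₀ Γ hmesh hM hS hΓ hn hnn hn₀N p
      have h3 := hU.scheme n hn (by omega) p
      have h4 : discreteCaputo α t (fun k => e k p) n
          = discreteCaputo α t (fun k => V k p) n - discreteCaputo α t (fun k => U k p) n := by
        simp only [discreteCaputo, he]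
        rw [← Finset.sum_sub_distrib]
        exact Finset.sum_congr rfl fun k _ => by ring
      have h5 : discreteLaplacian L M (fun q => (1 - α / 2) * e n q + α / 2 * e (n - 1) q) p
          = discreteLaplacian L M (fun q => (1 - α / 2) * V n q + α / 2 * V (n - 1) q) p
          - discreteLaplacian L M (fun q => (1 - α / 2) * U n q + α / 2 * U (n - 1) q) p := by
        simp only [discreteLaplacian, he]; ring
      refine le_trans (le_of_eq ?_) h2
      rw [h4, h5, h3]
      congr 1
      simp only [hV]
      ring

lemma meshBound_meshTerm {α σ T : ℝ} {N : ℕ} {t : ℕ → ℝ} (hmesh : IsMesh T N t) {n : ℕ}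
    (hn : 1 ≤ n) (hnN : n ≤ N) :
    MeshBound α σ t n (step t 1 ^ σ + meshTerm α σ t n) ∧ 0 ≤ meshTerm α σ t n := by
  have h1 : step t 1 = t 1 := by rw [step, Nat.sub_self, hmesh.zero, sub_zero]
  have h0 : 0 ≤ meshTerm α σ t n := by
    refine Real.iSup_nonneg fun k => ?_
    obtain ⟨k, hk⟩ := k
    rw [Finset.mem_Icc] at hk
    have := hmesh.step_pos (by omega : 1 ≤ k) (by omega)
    have := hmesh.nonneg (by omega : k ≤ N)
    have := hmesh.nonneg (by omega : k - 1 ≤ N)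
    positivity
  refine ⟨⟨?_, fun k hk hkn => ?_⟩, h0⟩
  · rw [h1]; linarith
  · have h2 : t k ^ α * t (k - 1) ^ (σ - 3) * step t k ^ (3 - α) ≤ meshTerm α σ t n :=
      le_ciSup (f := fun k : Finset.Icc 2 n =>
        t k ^ α * t ((k : ℕ) - 1) ^ (σ - 3) * step t k ^ (3 - α))
        (Set.finite_range _).bddAbove ⟨k, Finset.mem_Icc.2 ⟨hk, hkn⟩⟩
    have h3 : 0 ≤ step t 1 ^ σ := Real.rpow_nonneg (hmesh.step_pos le_rfl (hn.trans hnN)).le _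
    linarith

/-- On meshes satisfying `M2` the time discretization terms are of order `τ^min(γσ, 2)`: the
condition bounds `τ_k / t_k` by `C τ t_k^(-1/γ)`, and the exponent leaves a nonnegative power of
`t_k`. -/
lemma exists_meshBound_of_condM2 {α σ T γ c₁ c₂ : ℝ} (hα1 : α < 1) (hσ0 : 0 < σ)
    (hσ1 : σ < 1) (hT : 0 < T) (hγ : 1 ≤ γ) (hc₁ : 0 < c₁) (hc₂ : 0 < c₂) :
    ∃ C : ℝ, 0 < C ∧ ∀ (N : ℕ) (t : ℕ → ℝ) (n : ℕ), IsMesh T N t → CondM2 γ c₁ c₂ N t → 1 ≤ n →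
      n ≤ N → MeshBound α σ t n (C * maxStep N t ^ min (γ * σ) 2) := by
  set β := min (γ * σ) 2 with hβ
  have hγ0 : 0 < γ := by linarith
  have hβ0 : 0 < β := lt_min (by positivity) two_pos
  have hβ2 : β ≤ 2 := min_le_right _ _
  have hβγ : 0 ≤ σ - β / γ := by
    rw [sub_nonneg, div_le_iff₀ hγ0, mul_comm]
    exact min_le_left _ _
  set D := c₁ ^ β * T ^ (σ - β / γ) with hD
  have hD0 : 0 < D := by positivity
  refine ⟨(1 + c₂ ^ (3 - σ)) * D, by positivity, ?_⟩
  intro N t n hmesh hM2 hn hnN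
  have hτ0 : 0 < maxStep N t :=
    (hmesh.step_pos le_rfl (by omega : 1 ≤ N)).trans_le (step_le_maxStep le_rfl (by omega))
  have key : ∀ k, 1 ≤ k → k ≤ N → t k ^ σ * (step t k / t k) ^ β ≤ D * maxStep N t ^ β := by
    intro k hk hkN
    have htk := hmesh.pos hk hkN
    have hs := hmesh.step_pos hk hkN
    have h1 : step t k / t k ≤ c₁ * maxStep N t * t k ^ (-(1 / γ)) := by
      rw [div_le_iff₀ htk]
      calc step t k ≤ maxStep N t * (c₁ * t k ^ (1 - 1 / γ)) :=
            (hM2.1 k hk hkN).trans (mul_le_mul_of_nonneg_left (min_le_right _ _) hτ0.le)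
        _ = _ := by
            rw [show (1 : ℝ) - 1 / γ = -(1 / γ) + 1 by ring, Real.rpow_add_one htk.ne']; ring
    calc t k ^ σ * (step t k / t k) ^ β
        ≤ t k ^ σ * (c₁ * maxStep N t * t k ^ (-(1 / γ))) ^ β := by gcongr
      _ = c₁ ^ β * maxStep N t ^ β * t k ^ (σ - β / γ) := by
          rw [Real.mul_rpow (by positivity) (by positivity), Real.mul_rpow hc₁.le hτ0.le,
            ← Real.rpow_mul htk.le, show σ - β / γ = σ + -(1 / γ) * β by ring,
            Real.rpow_add htk]
          ring
      _ ≤ c₁ ^ β * maxStep N t ^ β * T ^ (σ - β / γ) := by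
          gcongr
          exact hmesh.le_last hkN
      _ = _ := by rw [hD]; ring
  have hone : D * maxStep N t ^ β ≤ (1 + c₂ ^ (3 - σ)) * D * maxStep N t ^ β := by
    have : 0 ≤ c₂ ^ (3 - σ) * D * maxStep N t ^ β := by positivity
    linarith
  refine ⟨?_, fun k hk hkn => ?_⟩
  · have h1 := key 1 le_rfl (by omega)
    have ht1 := hmesh.pos le_rfl (by omega : 1 ≤ N)
    rw [step, Nat.sub_self, hmesh.zero, sub_zero, div_self ht1.ne', Real.one_rpow, mul_one] at h1
    exact h1.trans hone
  · have hkN : k ≤ N := by omega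
    have htk := hmesh.pos (by omega : 1 ≤ k) hkN
    have hs := hmesh.step_pos (by omega : 1 ≤ k) hkN
    have h1 : t (k - 1) ^ (σ - 3) ≤ c₂ ^ (3 - σ) * t k ^ (σ - 3) := by
      have h2 : t k / c₂ ≤ t (k - 1) := by
        rw [div_le_iff₀ hc₂, mul_comm]; exact hM2.2 k hk hkN
      calc _ ≤ (t k / c₂) ^ (σ - 3) :=
            Real.rpow_le_rpow_of_nonpos (by positivity) h2 (by linarith)
        _ = _ := by
            rw [Real.div_rpow htk.le hc₂.le, div_eq_mul_inv, ← Real.rpow_neg hc₂.le, neg_sub,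
              mul_comm]
    have h3 : t k ^ α * t k ^ (σ - 3) * step t k ^ (3 - α)
        = t k ^ σ * (step t k / t k) ^ (3 - α) := by
      rw [Real.div_rpow hs.le htk.le, show σ = α + (σ - 3) + (3 - α) by ring,
        Real.rpow_add htk, Real.rpow_add htk]
      have : t k ^ (3 - α) ≠ 0 := (Real.rpow_pos_of_pos htk _).ne'
      rw [show α + (σ - 3) + (3 - α) - 3 = σ - 3 by ring]
      field_simp
    calc _ ≤ t k ^ α * (c₂ ^ (3 - σ) * t k ^ (σ - 3)) * step t k ^ (3 - α) := by gcongr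
      _ = c₂ ^ (3 - σ) * (t k ^ σ * (step t k / t k) ^ (3 - α)) := by rw [← h3]; ring
      _ ≤ c₂ ^ (3 - σ) * (t k ^ σ * (step t k / t k) ^ β) := by
          gcongr ?_ * (?_ * ?_)
          exact Real.rpow_le_rpow_of_exponent_ge (by positivity)
            ((div_le_one htk).2 (hmesh.step_le hkN)) (by linarith)
      _ ≤ c₂ ^ (3 - σ) * (D * maxStep N t ^ β) := by
          exact mul_le_mul_of_nonneg_left (key k (by omega) hkN) (by positivity)
      _ ≤ _ := by
          have : 0 ≤ D * maxStep N t ^ β := by positivity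
          linarith

end TimeFracAllenCahn

end

theorem mainTheorem2 (α σ ε L T K : ℝ) (hα0 : 0 < α) (hα1 : α < 1) (hσ0 : 0 < σ) (hσ1 : σ < 1)
    (hε : 0 < ε) (hL : 0 < L) (hT : 0 < T) :
    (∃ C : ℝ, 0 < C ∧ ∀ (u₀ : TimeFracAllenCahn.Plane → ℝ)
      (u : TimeFracAllenCahn.Plane → ℝ → ℝ),
      TimeFracAllenCahn.IsSolution α ε L T u₀ u → (∀ x, |u₀ x| ≤ 1) →
      TimeFracAllenCahn.IsRegular σ K T u →
      ∀ (N : ℕ) (t : ℕ → ℝ) (M : ℕ) [NeZero M] (U : ℕ → TimeFracAllenCahn.GridFun M),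
      TimeFracAllenCahn.IsMesh T N t → TimeFracAllenCahn.CondM1 N t →
      TimeFracAllenCahn.StepCondition α ε (L / M) (TimeFracAllenCahn.maxStep N t) →
      TimeFracAllenCahn.IsSchemeSolution α ε L u₀ N t M U →
      ∀ n, 1 ≤ n → n ≤ N →
        TimeFracAllenCahn.gridError L u t M U n
          ≤ C * (TimeFracAllenCahn.step t 1 ^ σ / σ
              + 1 / (1 - α) * TimeFracAllenCahn.meshTerm α σ t n + (L / M) ^ 2)) ∧
    (∀ γ c₁ c₂ : ℝ, 1 ≤ γ → 0 < c₁ → 0 < c₂ →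
      ∃ C : ℝ, 0 < C ∧ ∀ (u₀ : TimeFracAllenCahn.Plane → ℝ)
      (u : TimeFracAllenCahn.Plane → ℝ → ℝ),
      TimeFracAllenCahn.IsSolution α ε L T u₀ u → (∀ x, |u₀ x| ≤ 1) →
      TimeFracAllenCahn.IsRegular σ K T u →
      ∀ (N : ℕ) (t : ℕ → ℝ) (M : ℕ) [NeZero M] (U : ℕ → TimeFracAllenCahn.GridFun M),
      TimeFracAllenCahn.IsMesh T N t → TimeFracAllenCahn.CondM1 N t →
      TimeFracAllenCahn.CondM2 γ c₁ c₂ N t →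
      TimeFracAllenCahn.StepCondition α ε (L / M) (TimeFracAllenCahn.maxStep N t) →
      TimeFracAllenCahn.IsSchemeSolution α ε L u₀ N t M U →
      ∀ n, 1 ≤ n → n ≤ N →
        TimeFracAllenCahn.gridError L u t M U n
            ≤ C / (σ * (1 - α)) * TimeFracAllenCahn.maxStep N t ^ min (γ * σ) 2
              + C * (L / M) ^ 2 ∧
        (max 1 (2 / σ) ≤ γ →
          TimeFracAllenCahn.gridError L u t M U n
            ≤ C / (σ * (1 - α)) * TimeFracAllenCahn.maxStep N t ^ 2 + C * (L / M) ^ 2)) := by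
  rcases lt_or_ge K 0 with hK | hK
  · -- A negative `K` admits no regular solution.
    refine ⟨⟨1, one_pos, fun u₀ u _ _ hr => absurd (hr.nonneg hT) (not_le.2 hK)⟩,
      fun γ c₁ c₂ _ _ _ => ⟨1, one_pos, fun u₀ u _ _ hr => absurd (hr.nonneg hT) (not_le.2 hK)⟩⟩
  obtain ⟨C, hC, herr⟩ :=
    TimeFracAllenCahn.exists_error_bound (L := L) hα0 hα1 hσ0 hσ1 hε hL hT hK
  have h1α : 0 < 1 - α := by linarith
  constructor
  · refine ⟨C, hC, ?_⟩
    intro u₀ u hu hu₀ hr N t M _ U hmesh hM hS hU n hn hnN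
    obtain ⟨hΓ, hm⟩ := TimeFracAllenCahn.meshBound_meshTerm (α := α) (σ := σ) hmesh hn hnN
    refine (herr u₀ u hu hu₀ hr N t M U hmesh hM hS hU n hn hnN _ hΓ).trans ?_
    have h1 : 0 ≤ TimeFracAllenCahn.step t 1 ^ σ :=
      Real.rpow_nonneg (hmesh.step_pos le_rfl (by omega)).le _
    have h2 : TimeFracAllenCahn.step t 1 ^ σ ≤ TimeFracAllenCahn.step t 1 ^ σ / σ := by
      rw [le_div_iff₀ hσ0]; nlinarith
    have h3 : TimeFracAllenCahn.meshTerm α σ t n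
        ≤ 1 / (1 - α) * TimeFracAllenCahn.meshTerm α σ t n := by
      rw [div_mul_eq_mul_div, one_mul, le_div_iff₀ h1α]; nlinarith
    gcongr
  · intro γ c₁ c₂ hγ hc₁ hc₂
    obtain ⟨D, hD, hmb⟩ :=
      TimeFracAllenCahn.exists_meshBound_of_condM2 (α := α) hα1 hσ0 hσ1 hT hγ hc₁ hc₂
    refine ⟨C * (D + 1), by positivity, ?_⟩
    intro u₀ u hu hu₀ hr N t M _ U hmesh hM hM2 hS hU n hn hnN
    have hτ0 : 0 < TimeFracAllenCahn.maxStep N t :=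
      (hmesh.step_pos le_rfl (by omega : 1 ≤ N)).trans_le
        (TimeFracAllenCahn.step_le_maxStep le_rfl (by omega))
    have hfirst : TimeFracAllenCahn.gridError L u t M U n
        ≤ C * (D + 1) / (σ * (1 - α)) * TimeFracAllenCahn.maxStep N t ^ min (γ * σ) 2
          + C * (D + 1) * (L / M) ^ 2 := by
      refine (herr u₀ u hu hu₀ hr N t M U hmesh hM hS hU n hn hnN _
        (hmb N t n hmesh hM2 hn hnN)).trans ?_
      have h1 : C * (D + 1) ≤ C * (D + 1) / (σ * (1 - α)) := by
        rw [le_div_iff₀ (by positivity)]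
        have : σ * (1 - α) ≤ 1 := by nlinarith
        exact mul_le_of_le_one_right (by positivity) this
      have h2 : 0 ≤ TimeFracAllenCahn.maxStep N t ^ min (γ * σ) 2 := by positivity
      have h3 := mul_le_mul_of_nonneg_right h1 h2
      have h4 : 0 ≤ C * TimeFracAllenCahn.maxStep N t ^ min (γ * σ) 2 := by positivity
      have h5 : 0 ≤ C * D * (L / M) ^ 2 := by positivity
      linarith
    refine ⟨hfirst, fun hγ2 => ?_⟩
    have h1 : 2 ≤ γ * σ := by
      have := (le_max_right _ _).trans hγ2
      rwa [div_le_iff₀ hσ0] at this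
    rw [min_eq_right h1, Real.rpow_two] at hfirst
    exact hfirst
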